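/- **Setting.** Let $dA(\zeta)=\frac1\pi d^2\zeta$ on $\mathbb C$ and let $\Delta=\frac14(\partial_x^2+\partial_y^2)$. For $n\ge1$ let $Q_n(\zeta)=g_n(|\zeta|)$ with $g_n:(0,\infty)\to\mathbb R$ of class $C^3$, $g_n(1)=0$, $g_n'(1)=1$, and assume: - there is a constant $k>1$, independent of $n$, with $\liminf_{\zeta\to\infty}\frac{Q_n(\zeta)}{2\log|\zeta|}\ge k$ for all $n$; - $Q_n$ is subharmonic on $\mathbb C\setminus\{0\}$ and strictly subharmonic in a neighbourhood of the unit circle; - there are a constant $C$ and a neighbourhood of $1$, both independent of $n$, on which $|g_n'''|\le Cn$; - with $\rho_n:=\sqrt{n/\Delta Q_n(1)}$, the limit $\rho:=\lim_{n\to\infty}\rho_n\in(0,\infty)$ exists. For large $n$ let $r_0=r_{n,0}>0$ and $r_1=r_{n,1}>0$ be the solutions of $r_0g_n'(r_0)=0$ and $r_1g_n'(r_1)=2$. Put $$\check Q_n(\zeta)=\begin{cases}g_n(r_0)&|\zeta|<r_0,\\ Q_n(\zeta)&r_0\le|\zeta|\le r_1,\\ 2\log|\zeta|-2\log r_1+g_n(r_1)&|\zeta|>r_1.\end{cases}$$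 For $\mathbf c=(\mathbf c_1,\mathbf c_2)$ with $\mathbf c_1,\mathbf c_2\in(0,\infty]$ let $Q_n^{(\mathbf c)}$ be $\mathbf c_1Q_n+(1-\mathbf c_1)\check Q_n$ for $|\zeta|<r_0$, $Q_n$ for $r_0\le|\zeta|\le r_1$, and $\mathbf c_2Q_n+(1-\mathbf c_2)\check Q_n$ for $|\zeta|>r_1$; a combination with parameter $\infty$ means $+\infty$. Let $\zeta_1,\dots,\zeta_n$ have joint law $$d\mathbf P_n=\frac1{Z_n}e^{-\mathbf H_n}\prod_{j=1}^n dA(\zeta_j),\qquad \mathbf H_n=\sum_{j>k}\log\frac1{|\zeta_j-\zeta_k|^2}+n\sum_{j=1}^nQ_n^{(\mathbf c)}(\zeta_j),$$ and put $|\zeta|_n=\max_j|\zeta_j|$, $|\zeta|_1=\min_j|\zeta_j|$. For finite $\mathbf c_1,\mathbf c_2$ let $$\Phi^{(\mathbf c)}(\xi)=\int_{-\infty}^\infty e^{-\frac12(t-\xi)^2+\frac{1-\mathbf c_1}2\min(t+\frac\rho2,0)^2+\frac{1-\mathbf c_2}2\max(t-\frac\rho2,0)^2}\,dt,$$ $$c_n=2\log\tfrac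 n\rho-2\log\log n-2\log\big(2\Phi^{(\mathbf c)}(\tfrac\rho2)\big),\qquad c_n'=2\log\tfrac n\rho-2\log\log n-2\log\big(2\Phi^{(\mathbf c)}(-\tfrac\rho2)\big).$$ **Theorem (Fluctuations of the maximal and minimal modulus).** (i) Let $\mathbf c_1,\mathbf c_2<\infty$, and set $\omega_n=a_n(|\zeta|_n-b_n)$ and $u_n=a_n'(b_n'-|\zeta|_1)$ with $$a_n=\frac{2n}\rho\sqrt{\mathbf c_2c_n},\quad b_n=r_1+\frac\rho{2n}\sqrt{\frac{c_n}{\mathbf c_2}},\quad a_n'=\frac{2n}\rho\sqrt{\mathbf c_1c_n'},\quad b_n'=r_0-\frac\rho{2n}\sqrt{\frac{c_n'}{\mathbf c_1}}.$$ If $\rho_n=\rho+o(1/\log n)$, then $\omega_n$ and $u_n$ converge in distribution to the standard Gumbel law: $$\lim_{n\to\infty}\mathbf P_n(\omega_n\le x)=\lim_{n\to\infty}\mathbf P_n(u_n\le x)=e^{-e^{-x}},\qquad x\in\mathbb R.$$ Without this rate assumption, the same holds if $\rho$ is replaced by $\rho_n$ in the prefactors $\frac{2n}\rho$ and $\frac\rho{2n}$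 of $a_n,b_n,a_n',b_n'$. (ii) Let $\mathbf c_1=\mathbf c_2=\infty$, and set $\omega_n=\frac{c\,n^2}{\rho^2}(|\zeta|_n-r_1)$ and $u_n=\frac{c'n^2}{\rho^2}(r_0-|\zeta|_1)$ with $c=2R^{(\infty)}(\frac\rho4)$ and $c'=2R^{(\infty)}(-\frac\rho4)$, where for $|\operatorname{Re}z|\le\frac\rho4$ $$R^{(\infty)}(z)=\int_{-\rho/2}^{\rho/2}\frac{e^{-\frac12(2\operatorname{Re}z-\xi)^2}}{\int_{-\rho/2}^{\rho/2}e^{-\frac12(t-\xi)^2}dt}\,d\xi .$$ Then $$\lim_{n\to\infty}\mathbf P_n(\omega_n\le x)=\lim_{n\to\infty}\mathbf P_n(u_n\le x)=e^{x},\qquad x\le0.$$ -/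

import Mathlib

open Filter Topology MeasureTheory Asymptotics
open scoped ENNReal

namespace AlmostCircular

noncomputable section

/-! ### The Gibbs ensemble of an extended-real valued external potential -/

/-- The normalised area measure `dA = d²ζ / π` on the complex plane. -/
def areaMeasure : Measure ℂ := ENNReal.ofReal (1 / Real.pi) • volume

/-- The Hamiltonian
`H_n(ζ) = ∑_{j > k} log (1 / |ζ_j - ζ_k|²) + n ∑_j Q(ζ_j)`, with value `+∞` where two points
coincide or where the potential is infinite. -/
def hamiltonian (n : ℕ) (Q : ℂ → EReal) (ζ : Fin n → ℂ) : EReal :=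
  (∑ j : Fin n, ∑ k ∈ Finset.Iio j, ENNReal.log ((‖ζ j - ζ k‖ₑ ^ 2)⁻¹))
    + (n : EReal) * ∑ j : Fin n, Q (ζ j)

/-- The Boltzmann factor `e^{-H_n}`. -/
def boltzmann (n : ℕ) (Q : ℂ → EReal) (ζ : Fin n → ℂ) : ℝ≥0∞ :=
  EReal.exp (-hamiltonian n Q ζ)

/-- The partition function `Z_n = ∫ e^{-H_n} dA^{⊗ n}`. -/
def partitionFunction (n : ℕ) (Q : ℂ → EReal) : ℝ≥0∞ :=
  ∫⁻ ζ, boltzmann n Q ζ ∂(Measure.pi fun _ : Fin n => areaMeasure)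

/-- The law `dP_n = Z_n⁻¹ e^{-H_n} dA^{⊗ n}` of the configuration `(ζ_1, …, ζ_n)`. -/
def gibbs (n : ℕ) (Q : ℂ → EReal) : Measure (Fin n → ℂ) :=
  (partitionFunction n Q)⁻¹ •
    (Measure.pi fun _ : Fin n => areaMeasure).withDensity (boltzmann n Q)

/-- The maximal modulus of a configuration. -/
def maxModulus {n : ℕ} (ζ : Fin n → ℂ) : ℝ := ⨆ j, ‖ζ j‖

/-- The minimal modulus of a configuration. -/
def minModulus {n : ℕ} (ζ : Fin n → ℂ) : ℝ := ⨅ j, ‖ζ j‖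

/-! ### Radially symmetric potentials in the almost-circular regime -/

/-- The radially symmetric potential `Q(ζ) = g(|ζ|)`. The profile `g` matters on `(0, ∞)` only. -/
def radialPotential (g : ℝ → ℝ) (ζ : ℂ) : ℝ := g ‖ζ‖

/-- `ΔQ` for `Q(ζ) = g(|ζ|)`, where `Δ = (∂_x² + ∂_y²) / 4` is a quarter of the usual Laplacian. -/
def quarterLaplacian (g : ℝ → ℝ) (ζ : ℂ) : ℝ :=
  (1 / 4) * Laplacian.laplacian (radialPotential g) ζ

/-- The width parameter at finite size, `ρ_n = √(n / ΔQ_n(1))`. -/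
def widthAt (g : ℕ → ℝ → ℝ) (n : ℕ) : ℝ := √((n : ℝ) / quarterLaplacian (g n) 1)

/-- The assumptions on the potentials `Q_n(ζ) = g_n(|ζ|)`, `n ≥ 1`. The (strict) subharmonicity of
the `C³` function `Q_n` on the punctured plane is expressed by the sign of its Laplacian. -/
structure IsAlmostCircular (g : ℕ → ℝ → ℝ) (ρ : ℝ) : Prop where
  contDiffOn : ∀ n, 0 < n → ContDiffOn ℝ 3 (g n) (Set.Ioi 0)
  apply_one : ∀ n, 0 < n → g n 1 = 0
  deriv_one : ∀ n, 0 < n → deriv (g n) 1 = 1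
  growth : ∃ k : ℝ, 1 < k ∧ ∀ n, 0 < n →
    (k : EReal) ≤ liminf
      (fun ζ : ℂ => ((radialPotential (g n) ζ / (2 * Real.log ‖ζ‖) : ℝ) : EReal)) (cocompact ℂ)
  subharmonic : ∀ n, 0 < n → ∀ ζ : ℂ, ζ ≠ 0 → 0 ≤ quarterLaplacian (g n) ζ
  strictly_subharmonic : ∀ n, 0 < n →
    ∀ᶠ ζ in 𝓝ˢ (Metric.sphere (0 : ℂ) 1), 0 < quarterLaplacian (g n) ζ
  third_deriv_bound : ∃ C : ℝ, ∀ᶠ r in 𝓝 (1 : ℝ), ∀ n : ℕ, 0 < n →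
    |iteratedDeriv 3 (g n) r| ≤ C * n
  width_pos : 0 < ρ
  width_tendsto : Tendsto (widthAt g) atTop (𝓝 ρ)

/-- `r₀ ≤ |ζ| ≤ r₁` is the droplet: `r₀ g'(r₀) = 0` and `r₁ g'(r₁) = 2`. -/
structure IsDropletRadii (g : ℝ → ℝ) (r₀ r₁ : ℝ) : Prop where
  inner_pos : 0 < r₀
  outer_pos : 0 < r₁
  inner_eq : r₀ * deriv g r₀ = 0
  outer_eq : r₁ * deriv g r₁ = 2

/-- The obstacle function of `Q(ζ) = g(|ζ|)`, for the droplet `r₀ ≤ |ζ| ≤ r₁`. -/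
def obstacle (g : ℝ → ℝ) (r₀ r₁ : ℝ) (ζ : ℂ) : ℝ :=
  if ‖ζ‖ < r₀ then g r₀
  else if ‖ζ‖ ≤ r₁ then radialPotential g ζ
  else 2 * Real.log ‖ζ‖ - 2 * Real.log r₁ + g r₁

/-- The combination `c Q + (1 - c) Q̌`, understood as `+∞` for `c = ∞`. -/
def confine (c : ℝ≥0∞) (q qObs : ℝ) : EReal :=
  if c = ∞ then ⊤ else ((c.toReal * q + (1 - c.toReal) * qObs : ℝ) : EReal)

/-- The potential `Q^{(c)}` with confinement parameters `c₁` (inner circle), `c₂` (outer circle). -/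
def confinedPotential (g : ℝ → ℝ) (r₀ r₁ : ℝ) (c₁ c₂ : ℝ≥0∞) (ζ : ℂ) : EReal :=
  if ‖ζ‖ < r₀ then confine c₁ (radialPotential g ζ) (obstacle g r₀ r₁ ζ)
  else if ‖ζ‖ ≤ r₁ then ((radialPotential g ζ : ℝ) : EReal)
  else confine c₂ (radialPotential g ζ) (obstacle g r₀ r₁ ζ)

/-! ### Limit functions and scaling constants -/

/-- `I^{(c)}(t) = (1 - c₁)/2 (t + ρ/2)_-² + (1 - c₂)/2 (t - ρ/2)_+²`. -/
def confineExponent (ρ c₁ c₂ t : ℝ) : ℝ :=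
  (1 - c₁) / 2 * (min (t + ρ / 2) 0) ^ 2 + (1 - c₂) / 2 * (max (t - ρ / 2) 0) ^ 2

/-- `Φ^{(c)}(ξ) = ∫ exp (-(t - ξ)²/2 + I^{(c)}(t)) dt`. -/
def Phi (ρ c₁ c₂ ξ : ℝ) : ℝ :=
  ∫ t : ℝ, Real.exp (-(1 / 2) * (t - ξ) ^ 2 + confineExponent ρ c₁ c₂ t)

/-- The limiting one-point function `R^{(∞)}` of the soft/hard edge ensemble, on the closed strip
`|Re z| ≤ ρ/4` and zero outside. -/
def softHardOnePoint (ρ : ℝ) (z : ℂ) : ℝ :=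
  if |z.re| ≤ ρ / 4 then
    ∫ ξ in (-(ρ / 2))..(ρ / 2), Real.exp (-(1 / 2) * (2 * z.re - ξ) ^ 2) /
      ∫ t in (-(ρ / 2))..(ρ / 2), Real.exp (-(1 / 2) * (t - ξ) ^ 2)
  else 0

/-- `2 log (n/ρ) - 2 log log n - 2 log (2 Φ^{(c)}(ξ))`; `ξ = ρ/2` gives `c_n`, `ξ = -ρ/2` gives
`c_n'`. -/
def logConst (ρ c₁ c₂ ξ : ℝ) (n : ℕ) : ℝ :=
  2 * Real.log ((n : ℝ) / ρ) - 2 * Real.log (Real.log n) - 2 * Real.log (2 * Phi ρ c₁ c₂ ξ)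

/-- `ω_n = a_n (|ζ|_n - b_n)` with `a_n = (2n/s) √(c₂ c_n)` and `b_n = r₁ + (s/(2n)) √(c_n/c₂)`,
for a width `s`. -/
def omegaSoft (s ρ c₁ c₂ r₁ : ℝ) (n : ℕ) (ζ : Fin n → ℂ) : ℝ :=
  2 * n / s * √(c₂ * logConst ρ c₁ c₂ (ρ / 2) n) *
    (maxModulus ζ - (r₁ + s / (2 * n) * √(logConst ρ c₁ c₂ (ρ / 2) n / c₂)))

/-- `u_n = a_n' (b_n' - |ζ|_1)` with `a_n' = (2n/s) √(c₁ c_n')` and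
`b_n' = r₀ - (s/(2n)) √(c_n'/c₁)`, for a width `s`. -/
def uSoft (s ρ c₁ c₂ r₀ : ℝ) (n : ℕ) (ζ : Fin n → ℂ) : ℝ :=
  2 * n / s * √(c₁ * logConst ρ c₁ c₂ (-(ρ / 2)) n) *
    ((r₀ - s / (2 * n) * √(logConst ρ c₁ c₂ (-(ρ / 2)) n / c₁)) - minModulus ζ)

/-- `ω_n = (c n²/ρ²) (|ζ|_n - r₁)` with `c = 2 R^{(∞)}(ρ/4)`. -/
def omegaHard (ρ r₁ : ℝ) (n : ℕ) (ζ : Fin n → ℂ) : ℝ :=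
  2 * softHardOnePoint ρ ((ρ / 4 : ℝ) : ℂ) * n ^ 2 / ρ ^ 2 * (maxModulus ζ - r₁)

/-- `u_n = (c' n²/ρ²) (r₀ - |ζ|_1)` with `c' = 2 R^{(∞)}(-ρ/4)`. -/
def uHard (ρ r₀ : ℝ) (n : ℕ) (ζ : Fin n → ℂ) : ℝ :=
  2 * softHardOnePoint ρ ((-(ρ / 4) : ℝ) : ℂ) * n ^ 2 / ρ ^ 2 * (r₀ - minModulus ζ)

end

end AlmostCircular

namespace AlmostCircular

/-! The potential is radial, so monomials are orthogonal for the one-particle weight. Expanding the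
squared Vandermonde determinant shows that the probability of all moduli lying in a set is a product
over the degrees `k < n` of ratios of radial moments (`gibbs_forall_mem`). The moduli thus behave
like independent variables, and the law of the maximum is a product of factors `1 - p_i`, where
`p_i` is a tail ratio. If the `p_i` are uniformly small and their sum tends to `l`, the product
tends to `e^{-l}`.

In the coordinate `t = (2n/ρ_n) log r` the moments become `∫ e^{x t} w(t) dt`. The parameters `x`
are spaced by `ρ_n/n` and fill `[-ρ/2, ρ/2]` in the limit. Inside the droplet `w = e^{-W}` with `W`
convex (subharmonicity) and close to `t²/2` on windows of length proportional to `n` (the definition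
of `ρ_n` and the third derivative bound); see `IsAlmostCircular.isProfile`. The obstacle function
continues `W` by its tangents of slope `∓ρ_n/2` at the edges.

At a soft edge the tangent slope `ρ_n/2` cancels the largest parameter, so the tail of the `i`-th
factor at distance `u` carries `e^{-(ρ_n u/n) i}` up to a fixed shift of `i`. The sum over `i`
behaves like `n/(ρ_n u)`: only `i` of order `n/u` matters, and for these the parameter tends to
`ρ/2`, which produces `Φ(ρ/2)` (`tendsto_prod_soft`). The remaining Gaussian tail is matched to
`e^{-x}` by the choice of `c_n` (`tendsto_gumbel_scale`).

At a hard edge every index contributes: each tail is the length of a window of order `1/n` times the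
density at the edge. The sum is a Riemann sum whose limit is `R^{(∞)}(ρ/4)` up to constants
(`tendsto_prod_hard`).

The minimal modulus follows by the reflection `t ↦ -t`, which exchanges the edges and shifts the
parameters by one index; hence the variable `θ`, equal to `0` or `1`. -/

/-! ### Products of factors close to one, and Riemann sums -/

/-- Each factor is squeezed: `e^{-p/(1-ε)} ≤ e^{-p/(1-p)} ≤ 1 - p ≤ e^{-p}`. The middle inequality
is `1 + s ≤ e^s` at `s = p/(1-p)`. -/
theorem tendsto_prod_one_sub {p : ℕ → ℕ → ℝ} {ε : ℕ → ℝ} {l : ℝ}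
    (hp : ∀ᶠ n in atTop, ∀ j < n, 0 ≤ p n j ∧ p n j ≤ ε n) (hε : Tendsto ε atTop (𝓝 0))
    (hs : Tendsto (fun n => ∑ j ∈ Finset.range n, p n j) atTop (𝓝 l)) :
    Tendsto (fun n => ∏ j ∈ Finset.range n, (1 - p n j)) atTop (𝓝 (Real.exp (-l))) := by
  have hlow : Tendsto (fun n => Real.exp (-((∑ j ∈ Finset.range n, p n j) / (1 - ε n)))) atTop
      (𝓝 (Real.exp (-l))) := by
    have : Tendsto (fun n => 1 - ε n) atTop (𝓝 1) := by simpa using hε.const_sub 1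
    have h := (Real.continuous_exp.tendsto _).comp (hs.div this one_ne_zero).neg
    rwa [div_one] at h
  have hupp : Tendsto (fun n => Real.exp (-(∑ j ∈ Finset.range n, p n j))) atTop
      (𝓝 (Real.exp (-l))) := (Real.continuous_exp.tendsto _).comp hs.neg
  refine tendsto_of_tendsto_of_tendsto_of_le_of_le' hlow hupp ?_ ?_
  · filter_upwards [hp, hε.eventually_lt_const (show (0 : ℝ) < 1 / 2 by norm_num)] with n h1 h2
    rw [Finset.sum_div, ← Finset.sum_neg_distrib, Real.exp_sum]
    refine Finset.prod_le_prod (fun j _ => (Real.exp_pos _).le) fun j hj => ?_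
    obtain ⟨h3, h4⟩ := h1 j (Finset.mem_range.1 hj)
    have h5 : 0 < 1 - p n j := by linarith
    have h6 : 0 < 1 - ε n := by linarith
    calc Real.exp (-(p n j / (1 - ε n))) ≤ Real.exp (-(p n j / (1 - p n j))) := by
          gcongr
      _ ≤ (1 + p n j / (1 - p n j))⁻¹ := by
          rw [Real.exp_neg]
          gcongr
          linarith [Real.add_one_le_exp (p n j / (1 - p n j))]
      _ = 1 - p n j := by field_simp; ring
  · filter_upwards [hp, hε.eventually_lt_const (show (0 : ℝ) < 1 / 2 by norm_num)] with n h1 h2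
    rw [← Finset.sum_neg_distrib, Real.exp_sum]
    refine Finset.prod_le_prod (fun j hj => ?_) fun j hj => ?_
    · linarith [(h1 j (Finset.mem_range.1 hj)).2]
    · linarith [Real.add_one_le_exp (-(p n j))]

theorem measurable_comp_floor (F : ℕ → ℝ) (v : ℝ) : Measurable fun y : ℝ => F ⌊y / v⌋₊ :=
  (measurable_from_top (f := F)).comp (Nat.measurable_floor.comp (measurable_id.div_const v))

/-- As the integral of a step function, a sum whose mesh varies with `n` becomes accessible to
dominated convergence. -/
theorem mul_sum_eq_integral_floor (F : ℕ → ℝ) (n : ℕ) {v : ℝ} (hv : 0 < v) :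
    v * ∑ j ∈ Finset.range n, F j = ∫ y in (0 : ℝ)..v * n, F ⌊y / v⌋₊ := by
  have hfl : ∀ k : ℕ, ∀ y ∈ Set.Ioo (v * k) (v * (k + 1 : ℕ)), F ⌊y / v⌋₊ = F k := by
    intro k y hy
    have : ⌊y / v⌋₊ = k := by
      rw [Nat.floor_eq_iff (by have := hy.1; exact div_nonneg (le_trans (by positivity) this.le) hv.le)]
      push_cast at hy
      exact ⟨by rw [le_div_iff₀ hv]; linarith [hy.1], by rw [div_lt_iff₀ hv]; linarith [hy.2]⟩
    rw [this]
  have hle : ∀ k : ℕ, v * k ≤ v * (k + 1 : ℕ) := fun k => by push_cast; nlinarith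
  -- At the right endpoint the floor has already jumped to `k + 1`, so the two agree only almost
  -- everywhere.
  have hae : ∀ k : ℕ, ∀ᵐ y, y ∈ Set.uIoc (v * k) (v * (k + 1 : ℕ)) → F k = F ⌊y / v⌋₊ := by
    intro k
    filter_upwards [Measure.ae_ne volume (v * (k + 1 : ℕ))] with y hy h
    rw [Set.uIoc_of_le (hle k)] at h
    exact (hfl k y ⟨h.1, lt_of_le_of_ne h.2 hy⟩).symm
  have hint : ∀ k : ℕ, IntervalIntegrable (fun y => F ⌊y / v⌋₊) volume (v * k)
      (v * (k + 1 : ℕ)) := fun k =>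
    (intervalIntegrable_const (c := F k)).congr_ae
      ((ae_restrict_iff' measurableSet_uIoc).2 (hae k))
  have := intervalIntegral.sum_integral_adjacent_intervals (f := fun y => F ⌊y / v⌋₊)
    (μ := volume) (a := fun k : ℕ => v * k) (n := n) fun k _ => hint k
  simp only [Nat.cast_zero, mul_zero] at this
  rw [← this, Finset.mul_sum]
  refine Finset.sum_congr rfl fun k _ => ?_
  rw [← intervalIntegral.integral_congr_ae (hae k), intervalIntegral.integral_const]
  push_cast
  rw [smul_eq_mul]; ring

theorem integrableOn_exp_neg_mul_Ioi {b : ℝ} (hb : 0 < b) (a : ℝ) :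
    IntegrableOn (fun y : ℝ => Real.exp (-(b * y))) (Set.Ioi a) := by
  simpa using exp_neg_integrableOn_Ioi a hb

/-- A Riemann sum of mesh `v → 0` on `[0, v n]`, an interval that exhausts the half-line; the limit
is `∫ f e^{-y} dy = f`. Only indices of order `1/v` count, so `F` needs a limit along these alone.
-/
theorem tendsto_exp_weighted_sum {F : ℕ → ℕ → ℝ} {B f θ : ℝ} {v : ℕ → ℝ} (hθ : 0 ≤ θ)
    (hB : ∀ᶠ n in atTop, ∀ j < n, |F n j| ≤ B) (hv : ∀ᶠ n in atTop, 0 < v n)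
    (hv0 : Tendsto v atTop (𝓝 0)) (hvn : Tendsto (fun n => v n * n) atTop atTop)
    (hF : ∀ y : ℝ, 0 < y → Tendsto (fun n => F n ⌊y / v n⌋₊) atTop (𝓝 f)) :
    Tendsto (fun n => v n * ∑ i ∈ Finset.range n, F n i * Real.exp (-(v n * (i + θ)))) atTop
      (𝓝 f) := by
  let H : ℕ → ℝ → ℝ := fun n y => Set.indicator (Set.Ioo 0 (v n * n))
    (fun y => F n ⌊y / v n⌋₊ * Real.exp (-(v n * (⌊y / v n⌋₊ + θ)))) y
  have hH : ∀ᶠ n in atTop,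
      v n * ∑ i ∈ Finset.range n, F n i * Real.exp (-(v n * (i + θ))) =
        ∫ y in Set.Ioi 0, H n y := by
    filter_upwards [hv] with n hn
    rw [mul_sum_eq_integral_floor _ n hn, intervalIntegral.integral_of_le (by positivity),
      integral_Ioc_eq_integral_Ioo, setIntegral_indicator measurableSet_Ioo]
    congr 2
    ext y; simp +contextual
  have hlim : (∫ y in Set.Ioi (0 : ℝ), f * Real.exp (-y)) = f := by
    rw [integral_const_mul, integral_exp_neg_Ioi_zero, mul_one]
  refine Tendsto.congr' (hH.mono fun n h => h.symm) ?_
  rw [← hlim]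
  -- The factor `e` pays for the floor: `v ⌊y/v⌋ ≥ y - v ≥ y - 1` once `v < 1`.
  refine tendsto_integral_filter_of_dominated_convergence
    (fun y => |B| * Real.exp 1 * Real.exp (-(1 * y))) ?_ ?_ ?_ ?_
  · refine Eventually.of_forall fun n => Measurable.aestronglyMeasurable ?_
    refine Measurable.indicator ?_ measurableSet_Ioo
    exact measurable_comp_floor (fun i : ℕ => F n i * Real.exp (-(v n * (i + θ)))) (v n)
  · filter_upwards [hB, hv, hv0.eventually_lt_const zero_lt_one] with n h1 h2 h3
    refine Eventually.of_forall fun y => ?_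
    by_cases hy : y ∈ Set.Ioo 0 (v n * n)
    · simp only [H, Set.indicator_of_mem hy, norm_mul, Real.norm_eq_abs, Real.abs_exp]
      have h4 : ⌊y / v n⌋₊ < n := by
        rw [Nat.floor_lt (by have := hy.1; positivity), div_lt_iff₀ h2]; linarith [hy.2]
      rw [mul_assoc, ← Real.exp_add]
      refine mul_le_mul ((h1 _ h4).trans (le_abs_self _)) (Real.exp_le_exp.2 ?_)
        (Real.exp_pos _).le (abs_nonneg _)
      · have h5 := Nat.lt_floor_add_one (y / v n)
        rw [div_lt_iff₀ h2] at h5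
        nlinarith
    · simp only [H, Set.indicator_of_notMem hy, norm_zero]; positivity
  · exact (integrableOn_exp_neg_mul_Ioi one_pos 0).const_mul _
  · refine (ae_restrict_iff' measurableSet_Ioi).2 (Eventually.of_forall fun y hy => ?_)
    have hy : 0 < y := hy
    have h1 : Tendsto (fun n => v n * (⌊y / v n⌋₊ + θ)) atTop (𝓝 y) := by
      have h2 : Tendsto (fun n => y + v n * θ) atTop (𝓝 y) := by
        simpa using (hv0.mul_const θ).const_add y
      have h3 : Tendsto (fun n => y - v n + v n * θ) atTop (𝓝 y) := by
        simpa using (hv0.const_sub y).add (hv0.mul_const θ)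
      refine tendsto_of_tendsto_of_tendsto_of_le_of_le' h3 h2 ?_ ?_
      · filter_upwards [hv] with n hn
        have h5 := Nat.lt_floor_add_one (y / v n)
        rw [div_lt_iff₀ hn] at h5
        nlinarith
      · filter_upwards [hv] with n hn
        have h5 := Nat.floor_le (a := y / v n) (by positivity)
        rw [le_div_iff₀ hn] at h5
        nlinarith
    refine ((hF y hy).mul ((Real.continuous_exp.tendsto _).comp h1.neg)).congr' ?_
    filter_upwards [hvn.eventually_gt_atTop y] with n hn
    simp only [H]
    rw [Set.indicator_of_mem (show y ∈ Set.Ioo 0 (v n * n) from ⟨hy, hn⟩)]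
    rfl

/-- A geometric series of ratio `e^{-v} ≤ 1/(1+v)`. The bound does not depend on `n`, which is what
domination in the soft case requires. -/
theorem mul_sum_exp_le {v θ : ℝ} (hv : 0 < v) (hθ : 0 ≤ θ) (n : ℕ) :
    v * ∑ i ∈ Finset.range n, Real.exp (-(v * (i + θ))) ≤ 1 + v := by
  have h1 : ∀ i ∈ Finset.range n, Real.exp (-(v * (i + θ))) ≤ Real.exp (-v) ^ i := by
    intro i _
    rw [← Real.exp_nat_mul]
    gcongr
    nlinarith
  have h2 : Real.exp (-v) ≤ (1 + v)⁻¹ := by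
    rw [Real.exp_neg]; gcongr; linarith [Real.add_one_le_exp v]
  have h3 : Real.exp (-v) < 1 := by simpa
  have h4 : 1 - Real.exp (-v) ≥ v / (1 + v) := by
    have : v / (1 + v) = 1 - (1 + v)⁻¹ := by field_simp; ring
    linarith
  calc v * ∑ i ∈ Finset.range n, Real.exp (-(v * (i + θ)))
      ≤ v * ∑ i ∈ Finset.range n, Real.exp (-v) ^ i := by gcongr with i hi; exact h1 i hi
    _ ≤ v * (1 - Real.exp (-v))⁻¹ := by
        gcongr
        rw [← tsum_geometric_of_lt_one (Real.exp_pos _).le h3]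
        exact (summable_geometric_of_lt_one (Real.exp_pos _).le h3).sum_le_tsum _
          fun i _ => by positivity
    _ ≤ v * (v / (1 + v))⁻¹ := by gcongr
    _ = 1 + v := by field_simp

theorem tendsto_riemann_sum {F : ℕ → ℕ → ℝ} {B : ℝ} {f : ℝ → ℝ}
    (hB : ∀ᶠ n in atTop, ∀ j < n, |F n j| ≤ B)
    (hF : ∀ y ∈ Set.Ioo (0 : ℝ) 1, Tendsto (fun n : ℕ => F n ⌊y * n⌋₊) atTop (𝓝 (f y))) :
    Tendsto (fun n : ℕ => (1 / (n : ℝ)) * ∑ i ∈ Finset.range n, F n i) atTop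
      (𝓝 (∫ y in (0 : ℝ)..1, f y)) := by
  have h : ∀ᶠ n : ℕ in atTop, (1 / (n : ℝ)) * ∑ i ∈ Finset.range n, F n i =
      ∫ y in Set.Ioo (0 : ℝ) 1, F n ⌊y / (1 / (n : ℝ))⌋₊ := by
    filter_upwards [eventually_gt_atTop 0] with n hn
    have hn' : (0 : ℝ) < n := by exact_mod_cast hn
    rw [mul_sum_eq_integral_floor _ n (by positivity), one_div_mul_cancel hn'.ne',
      intervalIntegral.integral_of_le zero_le_one, integral_Ioc_eq_integral_Ioo]
  rw [intervalIntegral.integral_of_le zero_le_one, integral_Ioc_eq_integral_Ioo]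
  refine Tendsto.congr' (h.mono fun n h => h.symm) ?_
  refine tendsto_integral_filter_of_dominated_convergence (fun _ => B) ?_ ?_ ?_ ?_
  · exact Eventually.of_forall fun n => (measurable_comp_floor _ _).aestronglyMeasurable
  · filter_upwards [hB, eventually_gt_atTop 0] with n h1 hn
    have hn' : (0 : ℝ) < n := by exact_mod_cast hn
    refine (ae_restrict_iff' measurableSet_Ioo).2 (Eventually.of_forall fun y hy => ?_)
    refine h1 _ ?_
    rw [Nat.floor_lt (by have := hy.1; positivity)]
    rw [div_div_eq_mul_div, div_one]
    nlinarith [hy.2]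
  · simp
  · refine (ae_restrict_iff' measurableSet_Ioo).2 (Eventually.of_forall fun y hy => ?_)
    simpa using hF y hy

/-! ### Converging families of weights and their exponential moments -/

/-- Uniformly exponentially dominated weights on the line converging almost everywhere to a limit
weight which does not vanish near the origin. -/
structure WeightLimit (w : ℕ → ℝ → ℝ) (w' : ℝ → ℝ) : Prop where
  meas : ∀ᶠ n in atTop, Measurable (w n)
  nonneg : ∀ n t, 0 ≤ w n t
  bound : ∀ M : ℝ, ∃ B : ℝ, ∀ᶠ n in atTop, ∀ t, w n t ≤ B * Real.exp (-(M * |t|))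
  lim : ∀ᵐ t, Tendsto (fun n => w n t) atTop (𝓝 (w' t))
  pos : ∃ a : ℝ, 0 < a ∧ ∀ t ∈ Set.Ioo (-a) a, 0 < w' t

/-- The exponential moment `∫ e^{xt} w(t) dt`. -/
noncomputable def expMoment (w : ℝ → ℝ) (x : ℝ) : ℝ := ∫ t, Real.exp (x * t) * w t

theorem integrable_exp_neg_abs : Integrable fun t : ℝ => Real.exp (-|t|) := by
  rw [← integrableOn_univ, ← Set.Iic_union_Ioi (a := (0 : ℝ)), integrableOn_union]
  constructor
  · refine (integrableOn_exp_Iic 0).congr_fun (fun t ht => ?_) measurableSet_Iic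
    rw [abs_of_nonpos ht, neg_neg]
  · refine (integrableOn_exp_neg_Ioi 0).congr_fun (fun t ht => ?_) measurableSet_Ioi
    rw [abs_of_pos ht]

namespace WeightLimit

variable {w : ℕ → ℝ → ℝ} {w' : ℝ → ℝ}

/-- Decay of the weights at rate `M + 1` absorbs `e^{xt}` for `|x| ≤ M` and leaves the integrable
`e^{-|t|}`. -/
theorem exp_bound (hw : WeightLimit w w') (M : ℝ) :
    ∃ B : ℝ, 0 ≤ B ∧ ∀ᶠ n in atTop, ∀ x, |x| ≤ M → ∀ t,
      Real.exp (x * t) * w n t ≤ B * Real.exp (-|t|) := by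
  obtain ⟨B, hB⟩ := hw.bound (M + 1)
  refine ⟨|B|, abs_nonneg _, hB.mono fun n h x hx t => ?_⟩
  calc Real.exp (x * t) * w n t ≤ Real.exp (M * |t|) * (|B| * Real.exp (-((M + 1) * |t|))) := by
        refine mul_le_mul (Real.exp_le_exp.2 ?_) ((h t).trans ?_) (hw.nonneg n t) (by positivity)
        · calc x * t ≤ |x * t| := le_abs_self _
            _ = |x| * |t| := abs_mul _ _
            _ ≤ M * |t| := by gcongr
        · gcongr; exact le_abs_self B
    _ = |B| * Real.exp (-|t|) := by
        rw [mul_left_comm, ← Real.exp_add]; ring_nf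

theorem integrable (hw : WeightLimit w w') (M : ℝ) :
    ∀ᶠ n in atTop, ∀ x, |x| ≤ M → Integrable fun t => Real.exp (x * t) * w n t := by
  obtain ⟨B, hB0, hB⟩ := hw.exp_bound M
  filter_upwards [hB, hw.meas] with n h hm x hx
  refine (integrable_exp_neg_abs.const_mul B).mono'
    ((by fun_prop : Measurable fun t => Real.exp (x * t)).mul hm).aestronglyMeasurable ?_
  refine Eventually.of_forall fun t => ?_
  rw [Real.norm_of_nonneg (mul_nonneg (Real.exp_pos _).le (hw.nonneg n t))]
  exact h x hx t

theorem tendsto_integral (hw : WeightLimit w w') (M : ℝ) {k : ℕ → ℝ → ℝ} {k' : ℝ → ℝ}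
    (hk : ∀ n, Measurable (k n)) (hkb : ∀ᶠ n in atTop, ∀ t, |k n t| ≤ Real.exp (M * |t|))
    (hlim : ∀ t, Tendsto (fun n => k n t) atTop (𝓝 (k' t))) :
    Tendsto (fun n => ∫ t, k n t * w n t) atTop (𝓝 (∫ t, k' t * w' t)) := by
  obtain ⟨B, hB⟩ := hw.bound (M + 1)
  refine tendsto_integral_filter_of_dominated_convergence (fun t => |B| * Real.exp (-|t|))
    ?_ ?_ (integrable_exp_neg_abs.const_mul _) ?_
  · filter_upwards [hw.meas] with n hm
    exact ((hk n).mul hm).aestronglyMeasurable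
  · filter_upwards [hB, hkb] with n h hkb
    refine Eventually.of_forall fun t => ?_
    rw [norm_mul, Real.norm_of_nonneg (hw.nonneg n t), Real.norm_eq_abs]
    calc |k n t| * w n t ≤ Real.exp (M * |t|) * (|B| * Real.exp (-((M + 1) * |t|))) := by
          refine mul_le_mul (hkb t) ((h t).trans ?_) (hw.nonneg n t) (by positivity)
          gcongr; exact le_abs_self B
      _ = |B| * Real.exp (-|t|) := by
          rw [mul_left_comm, ← Real.exp_add]; ring_nf
  · filter_upwards [hw.lim] with t ht
    exact (hlim t).mul ht

theorem tendsto_expMoment (hw : WeightLimit w w') {x : ℕ → ℝ} {ξ : ℝ}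
    (hx : Tendsto x atTop (𝓝 ξ)) :
    Tendsto (fun n => expMoment (w n) (x n)) atTop (𝓝 (expMoment w' ξ)) := by
  refine hw.tendsto_integral (|ξ| + 1) (k := fun n t => Real.exp (x n * t)) (fun n => by fun_prop)
    ?_ ?_
  · filter_upwards [hx.abs.eventually_le_const (show |ξ| < |ξ| + 1 by linarith)] with n hn t
    rw [Real.abs_exp]
    refine Real.exp_le_exp.2 ?_
    calc x n * t ≤ |x n * t| := le_abs_self _
      _ = |x n| * |t| := abs_mul _ _
      _ ≤ _ := by gcongr
  · exact fun t => (Real.continuous_exp.tendsto _).comp (hx.mul_const t)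

theorem limit_nonneg (hw : WeightLimit w w') : ∀ᵐ t, 0 ≤ w' t := by
  filter_upwards [hw.lim] with t ht
  exact ge_of_tendsto' ht fun n => hw.nonneg n t

theorem integral_limit_pos (hw : WeightLimit w w') (M : ℝ) (k : ℝ → ℝ) (hk : Measurable k)
    (hk0 : ∀ t, 0 < k t) (hkM : ∀ t, k t ≤ Real.exp (M * |t|)) : 0 < ∫ t, k t * w' t := by
  have hint : Integrable fun t => k t * w' t := by
    obtain ⟨B, hB⟩ := hw.bound (M + 1)
    have hm : AEStronglyMeasurable w' volume := by
      -- The weights are measurable only for large `n`, so the limit is taken along a shifted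
      -- sequence.
      obtain ⟨N, hN⟩ := eventually_atTop.1 hw.meas
      refine aestronglyMeasurable_of_tendsto_ae (u := (atTop : Filter ℕ)) (f := fun n => w (n + N))
        (fun n => (hN _ (by omega)).aestronglyMeasurable) ?_
      filter_upwards [hw.lim] with t ht
      exact (tendsto_add_atTop_iff_nat N).2 ht
    refine (integrable_exp_neg_abs.const_mul |B|).mono' (hk.aestronglyMeasurable.mul hm) ?_
    filter_upwards [hw.lim, hw.limit_nonneg] with t ht h0
    have hle : w' t ≤ |B| * Real.exp (-((M + 1) * |t|)) := by
      refine le_of_tendsto ht (hB.mono fun n h => (h t).trans ?_)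
      gcongr; exact le_abs_self B
    rw [Real.norm_of_nonneg (mul_nonneg (hk0 t).le h0)]
    calc k t * w' t ≤ Real.exp (M * |t|) * (|B| * Real.exp (-((M + 1) * |t|))) :=
          mul_le_mul (hkM t) hle h0 (by positivity)
      _ = |B| * Real.exp (-|t|) := by
          rw [mul_left_comm, ← Real.exp_add]; ring_nf
  rw [integral_pos_iff_support_of_nonneg_ae _ hint]
  · obtain ⟨a, ha, hpos⟩ := hw.pos
    refine lt_of_lt_of_le ?_ (measure_mono (s := Set.Ioo (-a) a) fun t ht => ?_)
    · simp [ha]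
    · exact (mul_pos (hk0 t) (hpos t ht)).ne'
  · filter_upwards [hw.limit_nonneg] with t ht using mul_nonneg (hk0 t).le ht

theorem expMoment_pos (hw : WeightLimit w w') (x : ℝ) : 0 < expMoment w' x := by
  refine hw.integral_limit_pos |x| _ (by fun_prop) (fun t => Real.exp_pos _) fun t => ?_
  refine Real.exp_le_exp.2 ?_
  rw [← abs_mul]; exact le_abs_self _

/-- Uniformity in `x` comes from the single minorant `e^{-|M||t|} ≤ e^{xt}`. Its integral against `w
n` converges to a positive number, half of which serves as `m`. -/
theorem exists_le_expMoment (hw : WeightLimit w w') (M : ℝ) :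
    ∃ m : ℝ, 0 < m ∧ ∀ᶠ n in atTop, ∀ x, |x| ≤ M → m ≤ expMoment (w n) x := by
  have hpos := hw.integral_limit_pos 0 (fun t => Real.exp (-(|M| * |t|))) (by fun_prop)
    (fun t => Real.exp_pos _) (fun t => Real.exp_le_exp.2 (by
      have : 0 ≤ |M| * |t| := by positivity
      linarith))
  have hlim := hw.tendsto_integral 0 (k := fun _ t => Real.exp (-(|M| * |t|)))
    (fun n => by fun_prop) (Eventually.of_forall fun n t => by
      rw [Real.abs_exp]
      refine Real.exp_le_exp.2 ?_
      have : 0 ≤ |M| * |t| := by positivity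
      linarith) (fun t => tendsto_const_nhds)
  refine ⟨_, half_pos hpos, ?_⟩
  filter_upwards [hlim.eventually_const_le (half_lt_self hpos), hw.integrable |M|, hw.meas]
    with n h1 h2 hm x hx
  have hx' : |x| ≤ |M| := hx.trans (le_abs_self M)
  have hle : ∀ t, Real.exp (-(|M| * |t|)) ≤ Real.exp (x * t) := fun t => by
    refine Real.exp_le_exp.2 ?_
    have h3 : |x * t| ≤ |M| * |t| := by rw [abs_mul]; gcongr
    linarith [neg_abs_le (x * t)]
  refine h1.trans (integral_mono ?_ (h2 x hx') fun t => ?_)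
  · refine (h2 x hx').mono'
      ((by fun_prop : Measurable fun t => Real.exp (-(|M| * |t|))).mul hm).aestronglyMeasurable
      (Eventually.of_forall fun t => ?_)
    rw [Real.norm_of_nonneg (mul_nonneg (Real.exp_pos _).le (hw.nonneg n t))]
    exact mul_le_mul_of_nonneg_right (hle t) (hw.nonneg n t)
  · exact mul_le_mul_of_nonneg_right (hle t) (hw.nonneg n t)

end WeightLimit

/-! ### Limits of products of tail ratios at hard and soft edges -/

/-- Natural parameters of the radial moments, in decreasing order. -/
noncomputable def momentParameter (L : ℝ) (θ : ℝ) (n i : ℕ) : ℝ := L * (1 / 2 - (i + θ) / n)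

theorem abs_momentParameter_le {L θ : ℝ} (hL : 0 ≤ L) (hθ : θ ∈ Set.Icc (0 : ℝ) 1) {n i : ℕ}
    (hi : i < n) : |momentParameter L θ n i| ≤ L := by
  have hn : (0 : ℝ) < n := by exact_mod_cast (Nat.zero_le _).trans_lt hi
  have h1 : (i + θ) / n ≤ (1 : ℝ) := by
    rw [div_le_one hn]
    have : (i : ℝ) + 1 ≤ n := by exact_mod_cast hi
    linarith [hθ.2]
  have h2 : 0 ≤ ((i : ℝ) + θ) / n := div_nonneg (by linarith [hθ.1, (Nat.cast_nonneg i : (0:ℝ) ≤ i)]) hn.le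
  rw [momentParameter, abs_mul, abs_of_nonneg hL]
  refine mul_le_of_le_one_right hL ?_
  rw [abs_le]; constructor <;> linarith

theorem tendsto_momentParameter {L : ℕ → ℝ} {ρ θ : ℝ} (hL : Tendsto L atTop (𝓝 ρ)) {i : ℕ → ℕ}
    {s : ℝ} (hi : Tendsto (fun n => (i n : ℝ) / n) atTop (𝓝 s)) :
    Tendsto (fun n => momentParameter (L n) θ n (i n)) atTop (𝓝 (ρ * (1 / 2 - s))) := by
  refine hL.mul (Tendsto.const_sub _ ?_)
  have : Tendsto (fun n : ℕ => θ / (n : ℝ)) atTop (𝓝 0) :=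
    tendsto_const_div_atTop_nhds_zero_nat θ
  simpa [add_div] using hi.add this

/-- The weight vanishes beyond `T`, so a tail ratio is `U` times a bounded quantity tending to
`e^{xτ} a / expMoment w' x`. Since `n U → l`, the sum of the ratios is `l` times a Riemann mean over
`s = i/n`, with parameter `x → ρ(1/2 - s)`. -/
theorem tendsto_prod_hard {w : ℕ → ℝ → ℝ} {w' : ℝ → ℝ} (hw : WeightLimit w w') {L T U : ℕ → ℝ}
    {ρ θ τ a l : ℝ} (hθ : θ ∈ Set.Icc (0 : ℝ) 1) (hρ : 0 < ρ) (hL : Tendsto L atTop (𝓝 ρ))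
    (hT : Tendsto T atTop (𝓝 τ)) (hU : ∀ᶠ n in atTop, 0 ≤ U n)
    (hUn : Tendsto (fun n => n * U n) atTop (𝓝 l))
    (hzero : ∀ᶠ n in atTop, ∀ t, T n < t → w n t = 0)
    (hedge' : ∀ s : ℝ, s ∈ Set.Icc (0 : ℝ) 1 →
      Tendsto (fun n => w n (T n - U n * s)) atTop (𝓝 a)) :
    Tendsto (fun n : ℕ => ∏ i ∈ Finset.range n,
      (1 - (∫ t in Set.Ioi (T n - U n), Real.exp (momentParameter (L n) θ n i * t) * w n t) /
        expMoment (w n) (momentParameter (L n) θ n i))) atTop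
      (𝓝 (Real.exp (-(l * ∫ s in (0 : ℝ)..1,
        Real.exp (ρ * (1 / 2 - s) * τ) * a / expMoment w' (ρ * (1 / 2 - s)))))) := by
  set M := ρ + 1 with hM
  have hMev : ∀ᶠ n in atTop, ∀ i < n, |momentParameter (L n) θ n i| ≤ M := by
    filter_upwards [hL.eventually_le_const (show ρ < M by linarith),
      hL.eventually_const_le hρ] with n h1 h2 i hi
    exact (abs_momentParameter_le h2 hθ hi).trans h1
  obtain ⟨m, hm, hmev⟩ := hw.exists_le_expMoment M
  obtain ⟨B, hB0, hB⟩ := hw.exp_bound M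
  -- the tail as an integral over the unit interval
  let G : ℕ → ℝ → ℝ := fun n x => ∫ s in (0 : ℝ)..1,
    Real.exp (x * (T n - U n * s)) * w n (T n - U n * s)
  have htail : ∀ᶠ n in atTop, ∀ x, (∫ t in Set.Ioi (T n - U n), Real.exp (x * t) * w n t) =
      U n * G n x := by
    filter_upwards [hU, hzero] with n h1 h2 x
    have h3 : (∫ t in Set.Ioi (T n - U n), Real.exp (x * t) * w n t) =
        ∫ t in (T n - U n)..(T n), Real.exp (x * t) * w n t := by
      rw [intervalIntegral.integral_of_le (by linarith)]
      refine setIntegral_eq_of_subset_of_forall_sdiff_eq_zero measurableSet_Ioi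
        Set.Ioc_subset_Ioi_self fun t ht => ?_
      rw [h2 t, mul_zero]
      by_contra hcon
      exact ht.2 ⟨ht.1, not_lt.1 hcon⟩
    have h4 := intervalIntegral.smul_integral_comp_sub_mul
      (fun t => Real.exp (x * t) * w n t) (a := 0) (b := 1) (U n) (T n)
    simp only [mul_one, mul_zero, sub_zero, smul_eq_mul] at h4
    rw [h3, ← h4]
  have hGbound : ∀ᶠ n in atTop, ∀ x, |x| ≤ M → 0 ≤ G n x ∧ G n x ≤ B := by
    filter_upwards [hB, hw.meas] with n h1 h2 x hx
    refine ⟨intervalIntegral.integral_nonneg zero_le_one fun s _ =>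
      mul_nonneg (Real.exp_pos _).le (hw.nonneg _ _), ?_⟩
    have := intervalIntegral.norm_integral_le_of_norm_le_const (a := 0) (b := 1) (C := B)
      (f := fun s => Real.exp (x * (T n - U n * s)) * w n (T n - U n * s)) fun s _ => by
        rw [Real.norm_of_nonneg (mul_nonneg (Real.exp_pos _).le (hw.nonneg _ _))]
        refine (h1 x hx _).trans (mul_le_of_le_one_right hB0 ?_)
        simp
    simp only [sub_zero, abs_one, mul_one] at this
    exact (le_abs_self _).trans this
  have hU0 : Tendsto U atTop (𝓝 0) := by
    have h1 := hUn.mul (tendsto_inv_atTop_nhds_zero_nat (𝕜 := ℝ))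
    rw [mul_zero] at h1
    refine h1.congr' ?_
    filter_upwards [eventually_gt_atTop 0] with n hn
    have hn' : (0 : ℝ) < n := by exact_mod_cast hn
    field_simp
  have hGlim : ∀ (x : ℕ → ℝ) (ξ : ℝ), Tendsto x atTop (𝓝 ξ) → (∀ᶠ n in atTop, |x n| ≤ M) →
      Tendsto (fun n => G n (x n)) atTop (𝓝 (Real.exp (ξ * τ) * a)) := by
    intro x ξ hx hxM
    have : (∫ _ in (0 : ℝ)..1, Real.exp (ξ * τ) * a) = Real.exp (ξ * τ) * a := by simp
    rw [← this]
    refine intervalIntegral.tendsto_integral_filter_of_dominated_convergence (fun _ => B) ?_ ?_ ?_ ?_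
    · filter_upwards [hw.meas] with n hn
      exact ((by fun_prop : Measurable fun s => Real.exp (x n * (T n - U n * s))).mul
        (hn.comp (by fun_prop))).aestronglyMeasurable
    · filter_upwards [hB, hxM] with n h1 h2
      refine Eventually.of_forall fun s _ => ?_
      rw [Real.norm_of_nonneg (mul_nonneg (Real.exp_pos _).le (hw.nonneg _ _))]
      refine (h1 _ h2 _).trans (mul_le_of_le_one_right hB0 ?_)
      simp
    · simp
    · refine Eventually.of_forall fun s hs => ?_
      rw [Set.uIoc_of_le zero_le_one] at hs
      refine Tendsto.mul ((Real.continuous_exp.tendsto _).comp (hx.mul ?_))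
        (hedge' s ⟨hs.1.le, hs.2⟩)
      simpa using hT.sub (hU0.mul_const s)
  have hp0 : ∀ᶠ n in atTop, ∀ i < n,
      (∫ t in Set.Ioi (T n - U n), Real.exp (momentParameter (L n) θ n i * t) * w n t) /
        expMoment (w n) (momentParameter (L n) θ n i) =
      U n * (G n (momentParameter (L n) θ n i) /
        expMoment (w n) (momentParameter (L n) θ n i)) := by
    filter_upwards [htail] with n h1 i _
    rw [h1, mul_div_assoc]
  have hq : ∀ᶠ n in atTop, ∀ i < n, 0 ≤ G n (momentParameter (L n) θ n i) /
        expMoment (w n) (momentParameter (L n) θ n i) ∧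
        G n (momentParameter (L n) θ n i) /
        expMoment (w n) (momentParameter (L n) θ n i) ≤ B / m := by
    filter_upwards [hGbound, hMev, hmev] with n h1 h2 h3 i hi
    have h4 := h3 _ (h2 i hi)
    have h5 := h1 _ (h2 i hi)
    exact ⟨div_nonneg h5.1 (hm.le.trans h4), by gcongr; exact h5.2⟩
  refine tendsto_prod_one_sub (ε := fun n => U n * (B / m)) ?_ (by simpa using hU0.mul_const (B / m)) ?_
  · filter_upwards [hp0, hq, hU] with n h1 h2 h3 i hi
    rw [h1 i hi]
    exact ⟨mul_nonneg h3 (h2 i hi).1, mul_le_mul_of_nonneg_left (h2 i hi).2 h3⟩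
  · have hR := tendsto_riemann_sum (F := fun n i => G n (momentParameter (L n) θ n i) /
        expMoment (w n) (momentParameter (L n) θ n i)) (B := B / m)
        (f := fun s => Real.exp (ρ * (1 / 2 - s) * τ) * a / expMoment w' (ρ * (1 / 2 - s))) ?_ ?_
    · refine (hUn.mul hR).congr' ?_
      filter_upwards [hp0, eventually_gt_atTop 0] with n h1 hn
      have hn' : (0 : ℝ) < n := by exact_mod_cast hn
      rw [Finset.sum_congr rfl fun i hi => h1 i (Finset.mem_range.1 hi), ← Finset.mul_sum]
      field_simp
    · filter_upwards [hq] with n h1 i hi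
      rw [abs_of_nonneg (h1 i hi).1]; exact (h1 i hi).2
    · intro y hy
      have hx : Tendsto (fun n => momentParameter (L n) θ n ⌊y * n⌋₊) atTop
          (𝓝 (ρ * (1 / 2 - y))) :=
        tendsto_momentParameter hL
          ((tendsto_nat_floor_mul_div_atTop hy.1.le).comp tendsto_natCast_atTop_atTop)
      refine (hGlim _ _ hx ?_).div (hw.tendsto_expMoment hx) (hw.expMoment_pos _).ne'
      filter_upwards [hMev, eventually_gt_atTop 0] with n h1 hn
      have hn' : (0 : ℝ) < n := by exact_mod_cast hn
      refine h1 _ ?_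
      rw [Nat.floor_lt (by have := hy.1; positivity)]
      nlinarith [hy.2]

theorem integral_Ioi_eq_inv_mul (φ : ℝ → ℝ) (a : ℝ) {b : ℝ} (hb : 0 < b) :
    ∫ t in Set.Ioi a, φ t = b⁻¹ * ∫ y in Set.Ioi (0 : ℝ), φ (a + y / b) := by
  have h1 := integral_comp_mul_left_Ioi (fun z => φ (a + z)) 0 (inv_pos.2 hb)
  simp only [mul_zero, inv_inv, smul_eq_mul] at h1
  have h2 : (∫ y in Set.Ioi (0 : ℝ), φ (a + y / b)) = ∫ y in Set.Ioi (0 : ℝ), φ (a + b⁻¹ * y) := by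
    simp only [div_eq_inv_mul]
  rw [h2, h1, ← mul_assoc, inv_mul_cancel₀ hb.ne', one_mul, ← integral_indicator measurableSet_Ioi,
    ← integral_indicator measurableSet_Ioi, ← integral_add_left_eq_self _ a]
  refine integral_congr_ae (Eventually.of_forall fun t => ?_)
  simp only [Set.indicator_apply, Set.mem_Ioi]
  congr 1
  simp

/-- Summing over the indices before integrating over the tail is the point: at distance `u` the
index sum is asymptotic to `n/(L u)` times the value at parameter `ρ/2`. Laplace's method at the
endpoint `U` then gives one more factor `1/(cU)`, whence the normalisation by `c U²` in `hl`. The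
function `D` plays the role of `c u²/2`. -/
theorem tendsto_prod_soft {w : ℕ → ℝ → ℝ} {w' : ℝ → ℝ} (hw : WeightLimit w w')
    {L T A U : ℕ → ℝ} {D : ℕ → ℝ → ℝ} {ρ θ τ a c l : ℝ} (hθ : θ ∈ Set.Icc (0 : ℝ) 1)
    (hρ : 0 < ρ) (hL : Tendsto L atTop (𝓝 ρ)) (hT : Tendsto T atTop (𝓝 τ))
    (hA : Tendsto A atTop (𝓝 a)) (hc : 0 < c) (hU : Tendsto U atTop atTop)
    (hUn : Tendsto (fun n => U n / n) atTop (𝓝 0))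
    (hDm : ∀ᶠ n in atTop, Measurable (D n))
    (htail : ∀ᶠ n in atTop, ∀ u, 0 ≤ u →
      w n (T n + u) = A n * Real.exp (-(L n / 2 * u) - D n u))
    (hD : ∀ y : ℝ, 0 < y →
      Tendsto (fun n => D n (U n + y / (c * U n)) - c * U n ^ 2 / 2) atTop (𝓝 y))
    (hD' : ∀ᶠ n in atTop, ∀ y : ℝ, 0 < y →
      y / 2 - 1 ≤ D n (U n + y / (c * U n)) - c * U n ^ 2 / 2)
    (hl : Tendsto (fun n => n / L n * (Real.exp (-(c * U n ^ 2 / 2)) / (c * U n ^ 2))) atTop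
      (𝓝 l)) :
    Tendsto (fun n : ℕ => ∏ i ∈ Finset.range n,
      (1 - (∫ t in Set.Ioi (T n + U n), Real.exp (momentParameter (L n) θ n i * t) * w n t) /
        expMoment (w n) (momentParameter (L n) θ n i))) atTop
      (𝓝 (Real.exp (-(l * (Real.exp (ρ / 2 * τ) * a / expMoment w' (ρ / 2)))))) := by
  set M := ρ + 1 with hM
  have hLpos : ∀ᶠ n in atTop, 0 < L n := hL.eventually_const_lt hρ
  have hMev : ∀ᶠ n in atTop, ∀ i < n, |momentParameter (L n) θ n i| ≤ M := by
    filter_upwards [hL.eventually_le_const (show ρ < M by linarith), hLpos] with n h1 h2 i hi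
    exact (abs_momentParameter_le h2.le hθ hi).trans h1
  obtain ⟨m, hm, hmev⟩ := hw.exists_le_expMoment M
  set F : ℕ → ℕ → ℝ := fun n i => Real.exp (momentParameter (L n) θ n i * T n) * A n /
    expMoment (w n) (momentParameter (L n) θ n i) with hFdef
  set B := Real.exp (M * (|τ| + 1)) * (|a| + 1) / m with hBdef
  have hB0 : 0 ≤ B := by positivity
  have hFB : ∀ᶠ n in atTop, ∀ i < n, |F n i| ≤ B := by
    filter_upwards [hMev, hmev, hT.abs.eventually_le_const (show |τ| < |τ| + 1 by linarith),
      hA.abs.eventually_le_const (show |a| < |a| + 1 by linarith)] with n h1 h2 h3 h4 i hi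
    have h5 := h2 _ (h1 i hi)
    rw [hFdef]
    simp only
    rw [abs_div, abs_mul, Real.abs_exp, abs_of_pos (hm.trans_le h5)]
    refine div_le_div₀ (by positivity) (mul_le_mul (Real.exp_le_exp.2 ?_) h4 (abs_nonneg _)
      (Real.exp_pos _).le) hm h5
    calc momentParameter (L n) θ n i * T n ≤ |momentParameter (L n) θ n i * T n| := le_abs_self _
      _ = |momentParameter (L n) θ n i| * |T n| := abs_mul _ _
      _ ≤ M * (|τ| + 1) := mul_le_mul (h1 i hi) h3 (abs_nonneg _) (by positivity)
  -- `1/(cU)` is the length over which `e^{-c u²/2}` drops by a factor `e` near `u = U`; `v` is the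
  -- resulting decay rate in the index.
  let u : ℕ → ℝ → ℝ := fun n y => U n + y / (c * U n)
  let v : ℕ → ℝ → ℝ := fun n y => L n * u n y / n
  -- The edge slope `L/2` cancels the constant part of the parameter: `x_i u - L u/2 = -(L u/n)(i +
  -- θ)`.
  have hp : ∀ᶠ n in atTop, ∀ i < n,
      (∫ t in Set.Ioi (T n + U n), Real.exp (momentParameter (L n) θ n i * t) * w n t) /
        expMoment (w n) (momentParameter (L n) θ n i) =
      (c * U n)⁻¹ * (F n i * ∫ y in Set.Ioi (0 : ℝ),
        Real.exp (-(v n y * (i + θ))) * Real.exp (-D n (u n y))) := by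
    filter_upwards [htail, hU.eventually_gt_atTop 0, eventually_gt_atTop 0] with n h1 h2 hn i hi
    have hn' : (0 : ℝ) < n := by exact_mod_cast hn
    have hcU : 0 < c * U n := by positivity
    have key : ∀ y ∈ Set.Ioi (0 : ℝ),
        Real.exp (momentParameter (L n) θ n i * (T n + U n + y / (c * U n))) *
          w n (T n + U n + y / (c * U n)) =
        Real.exp (momentParameter (L n) θ n i * T n) * A n *
          (Real.exp (-(v n y * (i + θ))) * Real.exp (-D n (u n y))) := by
      intro y hy
      have hy : 0 < y := hy
      have hu : 0 ≤ u n y := by simp only [u]; positivity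
      rw [add_assoc, h1 (U n + y / (c * U n)) hu, mul_left_comm, ← Real.exp_add, ← Real.exp_add,
        mul_comm (Real.exp _) (A n), mul_assoc, ← Real.exp_add]
      congr 2
      simp only [momentParameter, v, u]
      field_simp
      ring
    rw [integral_Ioi_eq_inv_mul _ _ hcU, setIntegral_congr_fun measurableSet_Ioi key,
      integral_const_mul]
    simp only [hFdef]
    ring
  have hu0 : ∀ᶠ n in atTop, ∀ y : ℝ, 0 < y → 0 < v n y ∧ U n ≤ u n y ∧ v n y ≤ 1 + y := by
    have hLU : Tendsto (fun n => L n * (U n / n)) atTop (𝓝 0) := by simpa using hL.mul hUn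
    have hLU' : Tendsto (fun n => L n * (n : ℝ)⁻¹) atTop (𝓝 0) := by
      simpa using hL.mul (tendsto_inv_atTop_nhds_zero_nat (𝕜 := ℝ))
    filter_upwards [hU.eventually_ge_atTop 1, hU.eventually_ge_atTop c⁻¹, hLpos,
      eventually_gt_atTop 0, hLU.eventually_le_const zero_lt_one,
      hLU'.eventually_le_const zero_lt_one] with n h1 h2 h3 hn h4 h5 y hy
    have hn' : (0 : ℝ) < n := by exact_mod_cast hn
    have hU0 : 0 < U n := by linarith
    have hcU : 1 ≤ c * U n := by
      rw [inv_le_iff_one_le_mul₀ hc] at h2; linarith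
    have h6 : 0 ≤ y / (c * U n) := by positivity
    have h7 : y / (c * U n) ≤ y := div_le_self hy.le hcU
    refine ⟨by simp only [v, u]; positivity, by simp only [u]; linarith, ?_⟩
    have h8 : v n y = L n * (U n / n) + L n * (n : ℝ)⁻¹ * (y / (c * U n)) := by
      simp only [v, u]; field_simp
    rw [h8]
    have h9 : L n * (n : ℝ)⁻¹ * (y / (c * U n)) ≤ 1 * y := mul_le_mul h5 h7 h6 zero_le_one
    linarith
  have hDb : ∀ᶠ n in atTop, ∀ y : ℝ, 0 < y → Real.exp (-D n (u n y)) ≤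
      Real.exp (-(c * U n ^ 2 / 2)) * (Real.exp 1 * Real.exp (-(1 / 2 * y))) := by
    filter_upwards [hD'] with n h1 y hy
    rw [← Real.exp_add, ← Real.exp_add]
    refine Real.exp_le_exp.2 ?_
    have := h1 y hy
    simp only [u]
    linarith
  have hInt0 : IntegrableOn (fun y : ℝ => Real.exp 1 * Real.exp (-(1 / 2 * y))) (Set.Ioi 0) :=
    (integrableOn_exp_neg_mul_Ioi one_half_pos 0).const_mul _
  have hInt : ∀ᶠ n in atTop, ∀ i < n, IntegrableOn (fun y : ℝ =>
      Real.exp (-(v n y * (i + θ))) * Real.exp (-D n (u n y))) (Set.Ioi 0) := by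
    filter_upwards [hu0, hDb, hDm] with n h1 h2 h3 i _
    have hum : Measurable (u n) := by fun_prop
    have hvm : Measurable (v n) := by fun_prop
    refine (hInt0.const_mul (Real.exp (-(c * U n ^ 2 / 2)))).mono' (Measurable.aestronglyMeasurable
      (((hvm.mul_const _).neg.exp).mul (h3.comp hum).neg.exp)) ?_
    refine (ae_restrict_iff' measurableSet_Ioi).2 (Eventually.of_forall fun y hy => ?_)
    have hiθ : 0 ≤ (i : ℝ) + θ := add_nonneg (Nat.cast_nonneg i) hθ.1
    rw [norm_mul, Real.norm_eq_abs, Real.norm_eq_abs, Real.abs_exp, Real.abs_exp]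
    refine (mul_le_of_le_one_left (Real.exp_pos _).le ?_).trans (h2 y hy)
    rw [Real.exp_le_one_iff, neg_nonpos]
    exact mul_nonneg (h1 y hy).1.le hiθ
  set C := ∫ y in Set.Ioi (0 : ℝ), Real.exp 1 * Real.exp (-(1 / 2 * y)) with hC
  -- For uniform smallness the Jacobian `1/(cU)` suffices; the exponential factors in the index and
  -- in `U` are bounded by one.
  refine tendsto_prod_one_sub (ε := fun n => (c * U n)⁻¹ * (B * C)) ?_ ?_ ?_
  · filter_upwards [hp, hFB, hu0, hDb, hInt, hU.eventually_gt_atTop 0, hMev, hmev]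
      with n h1 h2 h3 h4 h5 h6 h7 h8 i hi
    constructor
    · refine div_nonneg (setIntegral_nonneg measurableSet_Ioi fun t _ =>
        mul_nonneg (Real.exp_pos _).le (hw.nonneg _ _)) (hm.le.trans (h8 _ (h7 i hi)))
    · rw [h1 i hi]
      have hI : 0 ≤ ∫ y in Set.Ioi (0 : ℝ),
          Real.exp (-(v n y * (i + θ))) * Real.exp (-D n (u n y)) :=
        integral_nonneg fun y => by positivity
      refine mul_le_mul_of_nonneg_left (mul_le_mul ((le_abs_self _).trans (h2 i hi)) ?_ hI hB0)
        (by positivity)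
      refine setIntegral_mono_on (h5 i hi) hInt0 measurableSet_Ioi fun y hy => ?_
      have hiθ : 0 ≤ (i : ℝ) + θ := add_nonneg (Nat.cast_nonneg i) hθ.1
      have e1 : Real.exp (-(v n y * (i + θ))) ≤ 1 := by
        rw [Real.exp_le_one_iff, neg_nonpos]
        exact mul_nonneg (h3 y hy).1.le hiθ
      have e2 : Real.exp (-(c * U n ^ 2 / 2)) ≤ 1 := by
        rw [Real.exp_le_one_iff, neg_nonpos]; positivity
      refine (mul_le_of_le_one_left (Real.exp_pos _).le e1).trans ((h4 y hy).trans ?_)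
      exact mul_le_of_le_one_left (by positivity) e2
  · have : Tendsto (fun n => (c * U n)⁻¹) atTop (𝓝 0) :=
      (hU.const_mul_atTop hc).inv_tendsto_atTop
    simpa using this.mul_const (B * C)
  -- Inserting `v = L u/n` turns the index sum into a Riemann sum of mesh `v`. The compensating
  -- `n/(L u)` is split as `n/(L U)` times `U/u`, and the latter tends to one.
  · let H : ℕ → ℝ → ℝ := fun n y => U n / u n y *
      (v n y * ∑ i ∈ Finset.range n, F n i * Real.exp (-(v n y * (i + θ)))) *
      Real.exp (-(D n (u n y) - c * U n ^ 2 / 2))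
    have hsum : ∀ᶠ n in atTop, ∑ i ∈ Finset.range n,
        (∫ t in Set.Ioi (T n + U n), Real.exp (momentParameter (L n) θ n i * t) * w n t) /
        expMoment (w n) (momentParameter (L n) θ n i) =
        n / L n * (Real.exp (-(c * U n ^ 2 / 2)) / (c * U n ^ 2)) *
          ∫ y in Set.Ioi (0 : ℝ), H n y := by
      filter_upwards [hp, hInt, hu0, hU.eventually_gt_atTop 0, hLpos, eventually_gt_atTop 0]
        with n h1 h2 h3 h4 h5 hn
      have hn' : (0 : ℝ) < n := by exact_mod_cast hn
      rw [Finset.sum_congr rfl fun i hi => h1 i (Finset.mem_range.1 hi), ← Finset.mul_sum]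
      simp_rw [← integral_const_mul]
      rw [← integral_finsetSum _ fun i hi => (h2 i (Finset.mem_range.1 hi)).const_mul _,
        ← integral_const_mul]
      refine setIntegral_congr_fun measurableSet_Ioi fun y hy => ?_
      have hu : 0 < u n y := h4.trans_le (h3 y hy).2.1
      simp only [H]
      have e1 : Real.exp (-D n (u n y)) = Real.exp (-(c * U n ^ 2 / 2)) *
          Real.exp (-(D n (u n y) - c * U n ^ 2 / 2)) := by
        rw [← Real.exp_add]; ring_nf
      simp_rw [← mul_assoc (F n _)]
      rw [← Finset.sum_mul, e1]
      have e2 : v n y = L n * u n y / n := rfl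
      generalize (∑ i ∈ Finset.range n, F n i * Real.exp (-(v n y * (i + θ)))) = S
      rw [e2]
      field_simp
    have hFlim : ∀ y : ℝ, 0 < y → Tendsto (fun n => v n y *
        ∑ i ∈ Finset.range n, F n i * Real.exp (-(v n y * (i + θ)))) atTop
        (𝓝 (Real.exp (ρ / 2 * τ) * a / expMoment w' (ρ / 2))) := by
      intro y hy
      have hyU : Tendsto (fun n => y / (c * U n)) atTop (𝓝 0) :=
        (hU.const_mul_atTop hc).const_div_atTop y
      have huinf : Tendsto (fun n => u n y) atTop atTop :=
        tendsto_atTop_mono' _ (hu0.mono fun n h => (h y hy).2.1) hU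
      have hv0 : Tendsto (fun n => v n y) atTop (𝓝 0) := by
        have := (hL.mul hUn).add ((hL.mul hyU).mul (tendsto_inv_atTop_nhds_zero_nat (𝕜 := ℝ)))
        simp only [mul_zero, add_zero] at this
        refine this.congr fun n => ?_
        simp only [v, u]; ring
      have hvn : Tendsto (fun n => v n y * n) atTop atTop := by
        refine (hL.pos_mul_atTop hρ huinf).congr' ?_
        filter_upwards [eventually_gt_atTop 0] with n hn
        have hn' : (0 : ℝ) < n := by exact_mod_cast hn
        simp only [v]; field_simp
      refine tendsto_exp_weighted_sum hθ.1 hFB (hu0.mono fun n h => (h y hy).1) hv0 hvn ?_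
      intro s hs
      -- The relevant indices have order `1/v = o(n)`, so their parameters all tend to the extreme
      -- value `ρ/2`.
      have hi : Tendsto (fun n => ((⌊s / v n y⌋₊ : ℕ) : ℝ) / n) atTop (𝓝 0) := by
        refine squeeze_zero' (Eventually.of_forall fun n => by positivity) ?_
          (hvn.const_div_atTop s)
        filter_upwards [hu0, eventually_gt_atTop 0] with n h1 hn
        have hn' : (0 : ℝ) < n := by exact_mod_cast hn
        have h2 := (h1 y hy).1
        have h3 : ((⌊s / v n y⌋₊ : ℕ) : ℝ) ≤ s / v n y := Nat.floor_le (by positivity)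
        rw [← div_div]
        gcongr
      have hx := tendsto_momentParameter (θ := θ) hL hi
      have e : ρ * (1 / 2 - 0) = ρ / 2 := by ring
      rw [e] at hx
      exact (((Real.continuous_exp.tendsto _).comp (hx.mul hT)).mul hA).div
        (hw.tendsto_expMoment hx) (hw.expMoment_pos _).ne'
    set f := Real.exp (ρ / 2 * τ) * a / expMoment w' (ρ / 2) with hf
    have hHlim : Tendsto (fun n => ∫ y in Set.Ioi (0 : ℝ), H n y) atTop (𝓝 f) := by
      have hlim : (∫ y in Set.Ioi (0 : ℝ), f * Real.exp (-y)) = f := by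
        rw [integral_const_mul, integral_exp_neg_Ioi_zero, mul_one]
      rw [← hlim]
      -- `2 + y` bounds `1 + v`, since `v ≤ 1 + y`; the decay `e^{-y/2}` is that of the lower bound
      -- `hD'`, which holds for every `y > 0`.
      refine tendsto_integral_filter_of_dominated_convergence
        (fun y => B * (2 + y) * Real.exp 1 * Real.exp (-(1 / 2 * y))) ?_ ?_ ?_ ?_
      · filter_upwards [hDm] with n h3
        have hum : Measurable (u n) := by fun_prop
        have hvm : Measurable (v n) := by fun_prop
        refine Measurable.aestronglyMeasurable (((measurable_const.div hum).mul (hvm.mul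
          (Finset.measurable_sum _ fun i _ => ?_))).mul ((h3.comp hum).sub_const _).neg.exp)
        exact ((hvm.mul_const _).neg.exp).const_mul _
      · filter_upwards [hFB, hu0, hDb, hU.eventually_gt_atTop 0] with n h1 h2 h3 h4
        refine (ae_restrict_iff' measurableSet_Ioi).2 (Eventually.of_forall fun y hy => ?_)
        have hy : 0 < y := hy
        obtain ⟨k1, k2, k3⟩ := h2 y hy
        have hu : 0 < u n y := h4.trans_le k2
        have e1 : Real.exp (-(D n (u n y) - c * U n ^ 2 / 2)) ≤
            Real.exp 1 * Real.exp (-(1 / 2 * y)) := by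
          have := h3 y hy
          rw [neg_sub, sub_eq_add_neg, Real.exp_add]
          calc _ ≤ Real.exp (c * U n ^ 2 / 2) * (Real.exp (-(c * U n ^ 2 / 2)) *
                (Real.exp 1 * Real.exp (-(1 / 2 * y)))) := by gcongr
            _ = _ := by rw [← mul_assoc, ← Real.exp_add]; simp
        have e2 : |v n y * ∑ i ∈ Finset.range n, F n i * Real.exp (-(v n y * (i + θ)))| ≤
            B * (2 + y) := by
          calc _ ≤ v n y * ∑ i ∈ Finset.range n, B * Real.exp (-(v n y * (i + θ))) := by
                rw [abs_mul, abs_of_pos k1]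
                gcongr
                refine (Finset.abs_sum_le_sum_abs _ _).trans (Finset.sum_le_sum fun i hi => ?_)
                rw [abs_mul, Real.abs_exp]
                gcongr
                exact h1 i (Finset.mem_range.1 hi)
            _ = B * (v n y * ∑ i ∈ Finset.range n, Real.exp (-(v n y * (i + θ)))) := by
                rw [← Finset.mul_sum]; ring
            _ ≤ B * (2 + y) := by
                gcongr
                linarith [mul_sum_exp_le k1 hθ.1 n]
        have e3 : |U n / u n y| ≤ 1 := by
          rw [abs_of_pos (by positivity)]
          exact (div_le_one hu).2 k2
        simp only [H]
        rw [norm_mul, norm_mul, Real.norm_eq_abs, Real.norm_eq_abs, Real.norm_eq_abs,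
          Real.abs_exp, mul_assoc (B * (2 + y))]
        refine mul_le_mul ?_ e1 (Real.exp_pos _).le (by positivity)
        calc _ ≤ 1 * (B * (2 + y)) := mul_le_mul e3 e2 (abs_nonneg _) zero_le_one
          _ = _ := one_mul _
      · have h1 := integrableOn_exp_neg_mul_Ioi (b := 1 / 2) one_half_pos 0
        have h2 : IntegrableOn (fun y : ℝ => y * Real.exp (-(1 / 2 * y))) (Set.Ioi 0) := by
          have := integrableOn_rpow_mul_exp_neg_mul_rpow (p := 1) (s := 1) (b := 1 / 2)
            (by norm_num) one_pos (by norm_num)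
          simpa using this
        have h3 : IntegrableOn (fun y : ℝ => B * Real.exp 1 * (2 * Real.exp (-(1 / 2 * y)) +
            y * Real.exp (-(1 / 2 * y)))) (Set.Ioi 0) :=
          ((h1.const_mul 2).add h2).const_mul (B * Real.exp 1)
        refine h3.congr_fun (fun y _ => ?_) measurableSet_Ioi
        ring
      · refine (ae_restrict_iff' measurableSet_Ioi).2 (Eventually.of_forall fun y hy => ?_)
        have hy : 0 < y := hy
        have h1 : Tendsto (fun n => U n / u n y) atTop (𝓝 1) := by
          have h2 : Tendsto (fun n => 1 + y / (c * U n) * (U n)⁻¹) atTop (𝓝 (1 + 0 * 0)) :=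
            (((hU.const_mul_atTop hc).const_div_atTop y).mul hU.inv_tendsto_atTop).const_add 1
          have h3 := h2.inv₀ (by norm_num)
          norm_num at h3
          refine h3.congr' ?_
          filter_upwards [hU.eventually_gt_atTop 0] with n h4
          simp only [u]
          field_simp
        have h2 := (h1.mul (hFlim y hy)).mul ((Real.continuous_exp.tendsto _).comp (hD y hy).neg)
        simpa [H] using h2
    exact (hl.mul hHlim).congr' (hsum.mono fun n h => h.symm)

/-! ### Convex profiles close to `t²/2` -/

theorem abs_le_mul_of_hasDerivAt {f f' : ℝ → ℝ} {K t : ℝ} (hf : ∀ s, HasDerivAt f (f' s) s)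
    (h0 : f 0 = 0) (hK : ∀ s, |s| ≤ |t| → |f' s| ≤ K) : |f t| ≤ K * |t| := by
  have := Convex.norm_image_sub_le_of_norm_hasDerivWithin_le (f := f) (f' := f')
    (s := Metric.closedBall (0 : ℝ) |t|) (x := 0) (y := t) (C := K)
    (fun s _ => (hf s).hasDerivWithinAt)
    (fun s hs => hK s (by simpa using hs)) (convex_closedBall _ _)
    (by simp) (by simp)
  simpa [h0] using this

theorem tangent_le {f f' : ℝ → ℝ} (hf : ∀ s, HasDerivAt f (f' s) s) (hm : Monotone f') (x y : ℝ) :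
    f x + f' x * (y - x) ≤ f y := by
  rcases lt_trichotomy x y with h | h | h
  · obtain ⟨z, hz, he⟩ := exists_hasDerivAt_eq_slope f f' h
      (fun s _ => (hf s).continuousAt.continuousWithinAt) fun s _ => hf s
    have h1 := hm hz.1.le
    rw [he, le_div_iff₀ (by linarith)] at h1
    linarith
  · simp [h]
  · obtain ⟨z, hz, he⟩ := exists_hasDerivAt_eq_slope f f' h
      (fun s _ => (hf s).continuousAt.continuousWithinAt) fun s _ => hf s
    have h1 := hm hz.2.le
    rw [he, div_le_iff₀ (by linarith)] at h1
    linarith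

/-- Convex profiles `W n` with first and second derivatives `W1 n`, `W2 n`, close to `t² / 2` on
windows of size proportional to `n`, with slopes `∓ L n / 2` at `t₀ n`, `t₁ n`. -/
structure IsProfile (W W1 W2 : ℕ → ℝ → ℝ) (L t₀ t₁ : ℕ → ℝ) (ρ : ℝ) : Prop where
  width_pos : 0 < ρ
  width : Tendsto L atTop (𝓝 ρ)
  deriv_one : ∀ᶠ n in atTop, ∀ t, HasDerivAt (W n) (W1 n t) t
  deriv_two : ∀ᶠ n in atTop, ∀ t, HasDerivAt (W1 n) (W2 n t) t
  apply_zero : ∀ᶠ n in atTop, W n 0 = 0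
  slope_zero : ∀ᶠ n in atTop, W1 n 0 = 0
  convex : ∀ᶠ n in atTop, ∀ t, 0 ≤ W2 n t
  curvature : ∃ C δ : ℝ, 0 ≤ C ∧ 0 < δ ∧ ∀ᶠ n : ℕ in atTop, ∀ t, |t| ≤ δ * n →
    |W2 n t - 1| ≤ C * |t| / n
  inner : ∀ᶠ n in atTop, W1 n (t₀ n) = -(L n / 2)
  outer : ∀ᶠ n in atTop, W1 n (t₁ n) = L n / 2

namespace IsProfile

variable {W W1 W2 : ℕ → ℝ → ℝ} {L t₀ t₁ : ℕ → ℝ} {ρ : ℝ}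

/-- This symmetry reduces every statement about the inner edge to one about the outer edge. -/
theorem reflect (h : IsProfile W W1 W2 L t₀ t₁ ρ) :
    IsProfile (fun n t => W n (-t)) (fun n t => -W1 n (-t)) (fun n t => W2 n (-t)) L
      (fun n => -t₁ n) (fun n => -t₀ n) ρ where
  width_pos := h.width_pos
  width := h.width
  deriv_one := h.deriv_one.mono fun n hn t => by
    have h1 : HasDerivAt (fun t => W n (-t)) (W1 n (-t) * -1) t :=
      (hn (-t)).comp t (hasDerivAt_neg t)
    simpa using h1
  deriv_two := h.deriv_two.mono fun n hn t => by
    have h1 : HasDerivAt (fun t => -W1 n (-t)) (-(W2 n (-t) * -1)) t :=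
      ((hn (-t)).comp t (hasDerivAt_neg t)).neg
    simpa using h1
  apply_zero := by simpa using h.apply_zero
  slope_zero := by simpa using h.slope_zero
  convex := h.convex.mono fun n hn t => hn _
  curvature := by
    obtain ⟨C, δ, hC, hδ, hev⟩ := h.curvature
    exact ⟨C, δ, hC, hδ, hev.mono fun n hn t ht => by simpa using hn (-t) (by simpa using ht)⟩
  inner := h.outer.mono fun n hn => by simp [hn]
  outer := h.inner.mono fun n hn => by simp [hn]

theorem slope_monotone (h : IsProfile W W1 W2 L t₀ t₁ ρ) : ∀ᶠ n in atTop, Monotone (W1 n) := by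
  filter_upwards [h.deriv_two, h.convex] with n h1 h2
  exact monotone_of_hasDerivAt_nonneg (fun t => h1 t) fun t => h2 t

theorem tangent (h : IsProfile W W1 W2 L t₀ t₁ ρ) :
    ∀ᶠ n in atTop, ∀ x y, W n x + W1 n x * (y - x) ≤ W n y := by
  filter_upwards [h.deriv_one, h.slope_monotone] with n h1 h2 x y
  exact tangent_le h1 h2 x y

theorem nonneg (h : IsProfile W W1 W2 L t₀ t₁ ρ) : ∀ᶠ n in atTop, ∀ t, 0 ≤ W n t := by
  filter_upwards [h.tangent, h.apply_zero, h.slope_zero] with n h1 h2 h3 t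
  simpa [h2, h3] using h1 0 t

/-- The curvature bound integrated twice from the origin, where value and slope vanish. -/
theorem approx (h : IsProfile W W1 W2 L t₀ t₁ ρ) : ∃ C δ : ℝ, 0 ≤ C ∧ 0 < δ ∧
    ∀ᶠ n : ℕ in atTop, ∀ t, |t| ≤ δ * n →
      |W1 n t - t| ≤ C * |t| ^ 2 / n ∧ |W n t - t ^ 2 / 2| ≤ C * |t| ^ 3 / n := by
  obtain ⟨C, δ, hC, hδ, hev⟩ := h.curvature
  refine ⟨C, δ, hC, hδ, ?_⟩
  filter_upwards [hev, h.deriv_one, h.deriv_two, h.apply_zero, h.slope_zero] with n h0 h1 h2 h3 h4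
  have key : ∀ t, |t| ≤ δ * n → |W1 n t - t| ≤ C * |t| ^ 2 / n := by
    intro t ht
    have := abs_le_mul_of_hasDerivAt (f := fun s => W1 n s - s) (f' := fun s => W2 n s - 1)
      (K := C * |t| / n) (t := t) (fun s => (h2 s).sub (hasDerivAt_id s)) (by simp [h4])
      fun s hs => (h0 s (hs.trans ht)).trans (by gcongr)
    exact this.trans_eq (by ring)
  intro t ht
  refine ⟨key t ht, ?_⟩
  have := abs_le_mul_of_hasDerivAt (f := fun s => W n s - s ^ 2 / 2) (f' := fun s => W1 n s - s)
    (K := C * |t| ^ 2 / n) (t := t) (fun s => ?_) (by simp [h3])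
    fun s hs => (key s (hs.trans ht)).trans (by gcongr)
  · exact this.trans_eq (by ring)
  · refine (h1 s).sub ?_
    have := ((hasDerivAt_id s).pow 2).div_const 2
    simpa using this

theorem tendsto_apply (h : IsProfile W W1 W2 L t₀ t₁ ρ) {x : ℕ → ℝ} {a : ℝ}
    (hx : Tendsto x atTop (𝓝 a)) :
    Tendsto (fun n => W n (x n)) atTop (𝓝 (a ^ 2 / 2)) ∧
      Tendsto (fun n => W1 n (x n)) atTop (𝓝 a) := by
  obtain ⟨C, δ, hC, hδ, hev⟩ := h.approx
  have hsmall : ∀ᶠ n : ℕ in atTop, |x n| ≤ δ * n := by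
    have h1 : Tendsto (fun n : ℕ => δ * (n : ℝ)) atTop atTop :=
      tendsto_natCast_atTop_atTop.const_mul_atTop hδ
    filter_upwards [hx.abs.eventually_le_const (show |a| < |a| + 1 by linarith),
      h1.eventually_ge_atTop (|a| + 1)] with n h2 h3
    exact h2.trans h3
  have hz : ∀ k : ℕ, Tendsto (fun n : ℕ => C * |x n| ^ k / n) atTop (𝓝 0) := fun k =>
    ((hx.abs.pow k).const_mul C).div_atTop tendsto_natCast_atTop_atTop
  constructor
  · have h1 : Tendsto (fun n => W n (x n) - x n ^ 2 / 2) atTop (𝓝 0) :=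
      squeeze_zero_norm' ((hev.and hsmall).mono fun n hn => (hn.1 _ hn.2).2) (hz 3)
    simpa using h1.add ((hx.pow 2).div_const 2)
  · have h1 : Tendsto (fun n => W1 n (x n) - x n) atTop (𝓝 0) :=
      squeeze_zero_norm' ((hev.and hsmall).mono fun n hn => (hn.1 _ hn.2).1) (hz 2)
    simpa using h1.add hx

/-- The slopes are monotone and converge pointwise to the identity, so the point where the slope is
`L/2 → ρ/2` is trapped. -/
theorem tendsto_outer (h : IsProfile W W1 W2 L t₀ t₁ ρ) : Tendsto t₁ atTop (𝓝 (ρ / 2)) := by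
  rw [tendsto_order]
  have hL : Tendsto (fun n => L n / 2) atTop (𝓝 (ρ / 2)) := h.width.div_const 2
  constructor
  · intro a ha
    filter_upwards [((h.tendsto_apply (tendsto_const_nhds (x := a))).2).eventually_lt hL ha, h.outer,
      h.slope_monotone] with n h1 h2 h3
    rw [← h2] at h1
    exact h3.reflect_lt h1
  · intro a ha
    filter_upwards [hL.eventually_lt ((h.tendsto_apply (tendsto_const_nhds (x := a))).2) ha, h.outer,
      h.slope_monotone] with n h1 h2 h3
    rw [← h2] at h1
    exact h3.reflect_lt h1

theorem tendsto_inner (h : IsProfile W W1 W2 L t₀ t₁ ρ) : Tendsto t₀ atTop (𝓝 (-(ρ / 2))) := by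
  simpa using h.reflect.tendsto_outer.neg

theorem inner_lt_outer (h : IsProfile W W1 W2 L t₀ t₁ ρ) : ∀ᶠ n in atTop, t₀ n < t₁ n :=
  h.tendsto_inner.eventually_lt h.tendsto_outer (by linarith [h.width_pos])

end IsProfile

/-- The excess of `W` over its tangent of slope `l` at `t₁`. -/
def excess (W : ℝ → ℝ) (l t₁ u : ℝ) : ℝ := W (t₁ + u) - W t₁ - l * u

namespace IsProfile

variable {W W1 W2 : ℕ → ℝ → ℝ} {L t₀ t₁ : ℕ → ℝ} {ρ : ℝ}

theorem excess_nonneg (h : IsProfile W W1 W2 L t₀ t₁ ρ) :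
    ∀ᶠ n in atTop, ∀ u, 0 ≤ excess (W n) (L n / 2) (t₁ n) u := by
  filter_upwards [h.tangent, h.outer] with n h1 h2 u
  have := h1 (t₁ n) (t₁ n + u)
  rw [h2, add_sub_cancel_left] at this
  rw [excess]; linarith

theorem excess_tangent (h : IsProfile W W1 W2 L t₀ t₁ ρ) :
    ∀ᶠ n in atTop, ∀ R u, excess (W n) (L n / 2) (t₁ n) R + (W1 n (t₁ n + R) - L n / 2) * (u - R) ≤
      excess (W n) (L n / 2) (t₁ n) u := by
  filter_upwards [h.tangent] with n h1 R u
  have := h1 (t₁ n + R) (t₁ n + u)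
  simp only [excess]
  linarith

theorem excess_approx (h : IsProfile W W1 W2 L t₀ t₁ ρ) : ∃ C K δ : ℝ, 0 ≤ C ∧ 0 ≤ K ∧ 0 < δ ∧
    ∀ᶠ n : ℕ in atTop, ∀ u, 0 ≤ u → u ≤ δ * n →
      |W1 n (t₁ n + u) - L n / 2 - u| ≤ C * (K + u) * u / n ∧
      |excess (W n) (L n / 2) (t₁ n) u - u ^ 2 / 2| ≤ C * (K + u) * u ^ 2 / n := by
  obtain ⟨C, δ, hC, hδ, hev⟩ := h.curvature
  have hρ := h.width_pos
  -- Half the window, because the expansion is now centred at `t₁`: `|t₁ + s| ≤ ρ + u ≤ δ n` for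
  -- large `n`.
  refine ⟨C, ρ, δ / 2, hC, hρ.le, by positivity, ?_⟩
  have hbig : Tendsto (fun n : ℕ => δ / 2 * (n : ℝ)) atTop atTop :=
    tendsto_natCast_atTop_atTop.const_mul_atTop (by positivity)
  have habs : |ρ / 2| < ρ := by rw [abs_of_pos (by positivity)]; linarith
  filter_upwards [hev, h.deriv_one, h.deriv_two, h.outer,
    h.tendsto_outer.abs.eventually_le_const habs, hbig.eventually_ge_atTop ρ]
    with n h0 h1 h2 h3 h4 h5
  have key : ∀ u, 0 ≤ u → u ≤ δ / 2 * n → ∀ s, |s| ≤ |u| →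
      |W1 n (t₁ n + s) - L n / 2 - s| ≤ C * (ρ + u) / n * |s| := by
    intro u hu hun s hs
    rw [abs_of_nonneg hu] at hs
    refine abs_le_mul_of_hasDerivAt (f := fun s => W1 n (t₁ n + s) - L n / 2 - s)
      (f' := fun s => W2 n (t₁ n + s) - 1) (fun s => ?_) (by simp [h3]) fun r hr => ?_
    · exact (((h2 (t₁ n + s)).comp_const_add (t₁ n) s).sub_const _).sub (hasDerivAt_id s)
    · have h6 : |t₁ n + r| ≤ ρ + u := (abs_add_le _ _).trans (add_le_add h4 (hr.trans hs))
      refine (h0 _ (h6.trans (by linarith))).trans ?_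
      gcongr
  intro u hu hun
  refine ⟨(key u hu hun u le_rfl).trans_eq (by rw [abs_of_nonneg hu]; ring), ?_⟩
  have := abs_le_mul_of_hasDerivAt (f := fun s => excess (W n) (L n / 2) (t₁ n) s - s ^ 2 / 2)
    (f' := fun s => W1 n (t₁ n + s) - L n / 2 - s) (K := C * (ρ + u) / n * |u|) (t := u)
    (fun s => ?_) (by simp [excess]) fun s hs => (key u hu hun s hs).trans (by gcongr)
  · exact this.trans_eq (by rw [abs_of_nonneg hu]; ring)
  · have e1 := ((h1 (t₁ n + s)).comp_const_add (t₁ n) s).sub_const (W n (t₁ n))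
    have e2 := (hasDerivAt_id s).const_mul (L n / 2)
    have e3 := ((hasDerivAt_id s).pow 2).div_const 2
    have e4 : HasDerivAt (fun s => excess (W n) (L n / 2) (t₁ n) s - s ^ 2 / 2)
      (W1 n (t₁ n + s) - L n / 2 * 1 - (2 : ℕ) * id s ^ (2 - 1) * 1 / 2) s := (e1.sub e2).sub e3
    simpa using e4

/-- Outside the quadratic window only convexity is available. The tangent of the excess at `R`
starts at a nonnegative value and has slope tending to `R`, hence eventually at least `R/2`. -/
theorem excess_linear_growth (h : IsProfile W W1 W2 L t₀ t₁ ρ) {R : ℝ} (hR : 0 < R) :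
    ∀ᶠ n in atTop, ∀ u, R ≤ u → R / 2 * (u - R) ≤ excess (W n) (L n / 2) (t₁ n) u := by
  have h1 : Tendsto (fun n => W1 n (t₁ n + R) - L n / 2) atTop (𝓝 (ρ / 2 + R - ρ / 2)) :=
    (h.tendsto_apply (h.tendsto_outer.add_const R)).2.sub (h.width.div_const 2)
  rw [add_sub_cancel_left] at h1
  filter_upwards [h.excess_nonneg, h.excess_tangent, h1.eventually_const_le (half_lt_self hR)]
    with n h2 h3 h4 u hu
  have h5 := h3 R u
  have h6 := h2 R
  have h7 : R / 2 * (u - R) ≤ (W1 n (t₁ n + R) - L n / 2) * (u - R) :=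
    mul_le_mul_of_nonneg_right h4 (by linarith)
  linarith

end IsProfile

/-! ### Soft and hard weights of a profile -/

/-- The Boltzmann weight of `W`, flattened or steepened by `c₁`, `c₂` outside `[t₀, t₁]`. -/
noncomputable def softWeight (W : ℝ → ℝ) (l t₀ t₁ c₁ c₂ t : ℝ) : ℝ :=
  Real.exp (-(if t < t₀ then c₁ * W t + (1 - c₁) * (W t₀ - l * (t - t₀))
    else if t ≤ t₁ then W t else c₂ * W t + (1 - c₂) * (W t₁ + l * (t - t₁))))

/-- The Boltzmann weight of `W` restricted to `[t₀, t₁]`. -/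
noncomputable def hardWeight (W : ℝ → ℝ) (t₀ t₁ t : ℝ) : ℝ :=
  Set.indicator (Set.Icc t₀ t₁) (fun t => Real.exp (-W t)) t

/-- The limit of the soft weights. -/
noncomputable def softLimit (ρ c₁ c₂ t : ℝ) : ℝ :=
  Real.exp (-(t ^ 2 / 2) + confineExponent ρ c₁ c₂ t)

/-- The limit of the hard weights. -/
noncomputable def hardLimit (ρ t : ℝ) : ℝ :=
  Set.indicator (Set.Icc (-(ρ / 2)) (ρ / 2)) (fun t => Real.exp (-(t ^ 2 / 2))) t

theorem softWeight_neg (W : ℝ → ℝ) (l c₁ c₂ t : ℝ) {t₀ t₁ : ℝ} (h : t₀ ≤ t₁) :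
    softWeight (fun s => W (-s)) l (-t₁) (-t₀) c₂ c₁ t = softWeight W l t₀ t₁ c₁ c₂ (-t) := by
  simp only [softWeight, neg_neg]
  congr 2
  by_cases h1 : t < -t₁
  · rw [if_pos h1, if_neg (by linarith), if_neg (by linarith)]; ring
  · rw [if_neg h1]
    by_cases h2 : t ≤ -t₀
    · rw [if_pos h2, if_neg (by linarith), if_pos (by linarith)]
    · rw [if_neg h2, if_pos (by linarith)]; ring

theorem hardWeight_neg (W : ℝ → ℝ) (t₀ t₁ t : ℝ) :
    hardWeight (fun s => W (-s)) (-t₁) (-t₀) t = hardWeight W t₀ t₁ (-t) := by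
  simp only [hardWeight, Set.indicator_apply, Set.mem_Icc]
  congr 1
  rw [eq_iff_iff]
  constructor <;> rintro ⟨_, _⟩ <;> constructor <;> linarith

namespace IsProfile

variable {W W1 W2 : ℕ → ℝ → ℝ} {L t₀ t₁ : ℕ → ℝ} {ρ : ℝ}

/-- Beyond `t₁` the exponent is the tangent plus `c₂` times the excess, which treats `c₂ < 1` and
`c₂ > 1` alike. The excess outgrows any given linear rate. -/
theorem softWeight_outer_bound (h : IsProfile W W1 W2 L t₀ t₁ ρ) {c₁ c₂ : ℝ} (hc₂ : 0 < c₂)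
    (M : ℝ) : ∃ B : ℝ, ∀ᶠ n in atTop, ∀ t, t₁ n < t →
      softWeight (W n) (L n / 2) (t₀ n) (t₁ n) c₁ c₂ t ≤ B * Real.exp (-(M * |t|)) := by
  -- Chosen so that `c₂ R/2 = |M| + 1`: the growth rate of `c₂` times the excess beats `|M|`.
  set R := 2 * (|M| + 1) / c₂ with hRdef
  have hR : 0 < R := by positivity
  have hρ := h.width_pos
  refine ⟨Real.exp (|M| * (R + ρ)), ?_⟩
  have habs : |ρ / 2| < ρ := by rw [abs_of_pos (by positivity)]; linarith
  filter_upwards [h.excess_nonneg, h.excess_linear_growth hR, h.nonneg, h.inner_lt_outer,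
    h.width.eventually_const_le hρ, h.tendsto_outer.abs.eventually_le_const habs]
    with n h1 h2 h3 h4 h5 h6 t ht
  rw [softWeight, if_neg (by linarith), if_neg (by linarith), ← Real.exp_add, Real.exp_le_exp]
  have e1 : c₂ * W n t + (1 - c₂) * (W n (t₁ n) + L n / 2 * (t - t₁ n)) =
      W n (t₁ n) + L n / 2 * (t - t₁ n) + c₂ * excess (W n) (L n / 2) (t₁ n) (t - t₁ n) := by
    simp only [excess, add_sub_cancel]; ring
  have e2 : 0 ≤ L n / 2 * (t - t₁ n) := mul_nonneg (by positivity) (by linarith)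
  have e3 : |M| * (t - t₁ n - R) ≤ c₂ * excess (W n) (L n / 2) (t₁ n) (t - t₁ n) := by
    by_cases hu : R ≤ t - t₁ n
    · have h7 := mul_le_mul_of_nonneg_left (h2 _ hu) hc₂.le
      refine le_trans ?_ h7
      have h8 : c₂ * (R / 2 * (t - t₁ n - R)) = (|M| + 1) * (t - t₁ n - R) := by
        rw [hRdef]; field_simp
      rw [h8]
      exact mul_le_mul_of_nonneg_right (by linarith) (by linarith)
    · have := mul_nonneg hc₂.le (h1 (t - t₁ n))
      refine le_trans ?_ this
      exact mul_nonpos_of_nonneg_of_nonpos (abs_nonneg _) (by linarith)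
  have e4 : M * |t| ≤ |M| * (ρ + (t - t₁ n)) := by
    have h7 : |t| ≤ ρ + (t - t₁ n) := by
      calc |t| = |t₁ n + (t - t₁ n)| := by ring_nf
        _ ≤ |t₁ n| + |t - t₁ n| := abs_add_le _ _
        _ ≤ _ := by rw [abs_of_pos (by linarith : 0 < t - t₁ n)]; linarith
    exact mul_le_mul (le_abs_self M) h7 (abs_nonneg _) (abs_nonneg _)
  rw [e1]
  have := h3 (t₁ n)
  nlinarith

theorem continuous (h : IsProfile W W1 W2 L t₀ t₁ ρ) : ∀ᶠ n in atTop, Continuous (W n) :=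
  h.deriv_one.mono fun _ hn => continuous_iff_continuousAt.2 fun t => (hn t).continuousAt

theorem softWeight_weightLimit (h : IsProfile W W1 W2 L t₀ t₁ ρ) {c₁ c₂ : ℝ} (hc₁ : 0 < c₁)
    (hc₂ : 0 < c₂) :
    WeightLimit (fun n => softWeight (W n) (L n / 2) (t₀ n) (t₁ n) c₁ c₂)
      (softLimit ρ c₁ c₂) where
  meas := by
    filter_upwards [h.continuous] with n hn
    have hm := hn.measurable
    refine (Measurable.neg (Measurable.ite measurableSet_Iio ?_
      (Measurable.ite measurableSet_Iic hm ?_))).exp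
    · fun_prop
    · fun_prop
  nonneg _ _ := (Real.exp_pos _).le
  bound M := by
    obtain ⟨B₁, hB₁⟩ := h.softWeight_outer_bound (c₁ := c₁) hc₂ M
    obtain ⟨B₂, hB₂⟩ := h.reflect.softWeight_outer_bound (c₁ := c₂) hc₁ M
    have hρ := h.width_pos
    refine ⟨max (max B₁ B₂) (Real.exp (|M| * ρ)), ?_⟩
    filter_upwards [hB₁, hB₂, h.inner_lt_outer, h.nonneg,
      h.tendsto_outer.eventually_le_const (show ρ / 2 < ρ by linarith),
      h.tendsto_inner.eventually_const_le (show -ρ < -(ρ / 2) by linarith)]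
      with n h1 h2 h3 h4 h5 h6 t
    by_cases ht : t₁ n < t
    · refine (h1 t ht).trans ?_
      gcongr
      exact (le_max_left _ _).trans (le_max_left _ _)
    · by_cases ht' : t < t₀ n
      · have := h2 (-t) (by linarith)
        rw [softWeight_neg _ _ _ _ _ h3.le, neg_neg, abs_neg] at this
        refine this.trans ?_
        gcongr
        exact (le_max_right _ _).trans (le_max_left _ _)
      · rw [softWeight, if_neg ht', if_pos (not_lt.1 ht)]
        calc Real.exp (-W n t) ≤ Real.exp (|M| * ρ) * Real.exp (-(M * |t|)) := by
              rw [← Real.exp_add, Real.exp_le_exp]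
              have h7 : |t| ≤ ρ := abs_le.2 ⟨by linarith, by linarith⟩
              have h8 : M * |t| ≤ |M| * ρ :=
                mul_le_mul (le_abs_self M) h7 (abs_nonneg _) (abs_nonneg _)
              linarith [h4 t]
          _ ≤ _ := by
              gcongr
              exact le_max_right _ _
  lim := by
    have hl : Tendsto (fun n => L n / 2) atTop (𝓝 (ρ / 2)) := h.width.div_const 2
    have hρ := h.width_pos
    -- Away from `±ρ/2` the position of `t` relative to the moving endpoints is eventually decided.
    filter_upwards [Measure.ae_ne volume (ρ / 2), Measure.ae_ne volume (-(ρ / 2))] with t ht1 ht0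
    refine (Real.continuous_exp.tendsto _).comp ?_
    have hW := (h.tendsto_apply (tendsto_const_nhds (x := t))).1
    rcases lt_or_gt_of_ne ht0 with h0 | h0
    · have hlim : Tendsto (fun n => -(c₁ * W n t + (1 - c₁) * (W n (t₀ n) - L n / 2 * (t - t₀ n))))
          atTop (𝓝 (-(c₁ * (t ^ 2 / 2) + (1 - c₁) * ((-(ρ / 2)) ^ 2 / 2 - ρ / 2 * (t - -(ρ / 2)))))) :=
        ((hW.const_mul c₁).add (((h.tendsto_apply h.tendsto_inner).1.sub
          (hl.mul (h.tendsto_inner.const_sub t))).const_mul (1 - c₁))).neg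
      -- The tangent of `t²/2` at `-ρ/2` lies below `t²/2` by `(t + ρ/2)²/2`, which is the source of
      -- `confineExponent`.
      have e : -(t ^ 2 / 2) + confineExponent ρ c₁ c₂ t =
          -(c₁ * (t ^ 2 / 2) + (1 - c₁) * ((-(ρ / 2)) ^ 2 / 2 - ρ / 2 * (t - -(ρ / 2)))) := by
        rw [confineExponent, min_eq_left (by linarith), max_eq_right (by linarith)]; ring
      rw [e]
      refine hlim.congr' ?_
      filter_upwards [h.tendsto_inner.eventually_const_lt h0] with n hn
      rw [if_pos hn]
    · rcases lt_or_gt_of_ne ht1 with h1 | h1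
      · have e : -(t ^ 2 / 2) + confineExponent ρ c₁ c₂ t = -(t ^ 2 / 2) := by
          rw [confineExponent, min_eq_right (by linarith), max_eq_right (by linarith)]; ring
        rw [e]
        refine hW.neg.congr' ?_
        filter_upwards [h.tendsto_inner.eventually_lt_const h0,
          h.tendsto_outer.eventually_const_lt h1] with n hn hn'
        rw [if_neg (by linarith), if_pos hn'.le]
      · have hlim : Tendsto (fun n => -(c₂ * W n t + (1 - c₂) *
              (W n (t₁ n) + L n / 2 * (t - t₁ n)))) atTop
            (𝓝 (-(c₂ * (t ^ 2 / 2) + (1 - c₂) * ((ρ / 2) ^ 2 / 2 + ρ / 2 * (t - ρ / 2))))) :=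
          ((hW.const_mul c₂).add (((h.tendsto_apply h.tendsto_outer).1.add
            (hl.mul (h.tendsto_outer.const_sub t))).const_mul (1 - c₂))).neg
        have e : -(t ^ 2 / 2) + confineExponent ρ c₁ c₂ t =
            -(c₂ * (t ^ 2 / 2) + (1 - c₂) * ((ρ / 2) ^ 2 / 2 + ρ / 2 * (t - ρ / 2))) := by
          rw [confineExponent, min_eq_right (by linarith), max_eq_left (by linarith)]; ring
        rw [e]
        refine hlim.congr' ?_
        filter_upwards [h.tendsto_inner.eventually_lt_const h0,
          h.tendsto_outer.eventually_lt_const h1] with n hn hn'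
        rw [if_neg (by linarith), if_neg (by linarith)]
  pos := ⟨1, one_pos, fun _ _ => Real.exp_pos _⟩

theorem hardWeight_weightLimit (h : IsProfile W W1 W2 L t₀ t₁ ρ) :
    WeightLimit (fun n => hardWeight (W n) (t₀ n) (t₁ n)) (hardLimit ρ) where
  meas := by
    filter_upwards [h.continuous] with n hn
    exact (Measurable.exp hn.measurable.neg).indicator measurableSet_Icc
  nonneg _ _ := Set.indicator_nonneg (fun _ _ => (Real.exp_pos _).le) _
  bound M := by
    have hρ := h.width_pos
    refine ⟨Real.exp (|M| * ρ), ?_⟩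
    filter_upwards [h.nonneg, h.tendsto_outer.eventually_le_const (show ρ / 2 < ρ by linarith),
      h.tendsto_inner.eventually_const_le (show -ρ < -(ρ / 2) by linarith)]
      with n h4 h5 h6 t
    rw [hardWeight, ← Real.exp_add]
    refine Set.indicator_apply_le' (fun ht => Real.exp_le_exp.2 ?_) fun _ => (Real.exp_pos _).le
    have h7 : |t| ≤ ρ := abs_le.2 ⟨by linarith [ht.1], by linarith [ht.2]⟩
    have h8 : M * |t| ≤ |M| * ρ :=
      mul_le_mul (le_abs_self M) h7 (abs_nonneg _) (abs_nonneg _)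
    linarith [h4 t]
  lim := by
    filter_upwards [Measure.ae_ne volume (ρ / 2), Measure.ae_ne volume (-(ρ / 2))] with t ht1 ht0
    by_cases ht : t ∈ Set.Icc (-(ρ / 2)) (ρ / 2)
    · rw [hardLimit, Set.indicator_of_mem ht]
      have hW := (h.tendsto_apply (tendsto_const_nhds (x := t))).1
      refine ((Real.continuous_exp.tendsto _).comp hW.neg).congr' ?_
      filter_upwards [h.tendsto_inner.eventually_le_const (lt_of_le_of_ne ht.1 ht0.symm),
        h.tendsto_outer.eventually_const_le (lt_of_le_of_ne ht.2 ht1)] with n h1 h2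
      rw [hardWeight, Set.indicator_of_mem (show t ∈ Set.Icc (t₀ n) (t₁ n) from ⟨h1, h2⟩)]
      rfl
    · rw [hardLimit, Set.indicator_of_notMem ht]
      refine tendsto_const_nhds.congr' ?_
      rw [Set.mem_Icc, not_and_or, not_le, not_le] at ht
      rcases ht with ht | ht
      · filter_upwards [h.tendsto_inner.eventually_const_lt ht] with n hn
        rw [hardWeight, Set.indicator_of_notMem fun hm => not_le.2 hn hm.1]
      · filter_upwards [h.tendsto_outer.eventually_lt_const ht] with n hn
        rw [hardWeight, Set.indicator_of_notMem fun hm => not_le.2 hn hm.2]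
  pos := by
    have hρ := h.width_pos
    refine ⟨ρ / 2, by positivity, fun t ht => ?_⟩
    rw [hardLimit, Set.indicator_of_mem (Set.Ioo_subset_Icc_self ht)]
    exact Real.exp_pos _

end IsProfile

/-! ### Limiting moments in terms of `Φ` and `R^{(∞)}` -/

/-- Completing the square: `ξ t - t²/2 = ξ²/2 - (t - ξ)²/2`. -/
theorem expMoment_softLimit (ρ c₁ c₂ ξ : ℝ) :
    expMoment (softLimit ρ c₁ c₂) ξ = Real.exp (ξ ^ 2 / 2) * Phi ρ c₁ c₂ ξ := by
  rw [expMoment, Phi, ← integral_const_mul]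
  refine integral_congr_ae (Eventually.of_forall fun t => ?_)
  simp only [softLimit]
  rw [← Real.exp_add, ← Real.exp_add]
  ring_nf

theorem Phi_reflect (ρ c₁ c₂ ξ : ℝ) : Phi ρ c₂ c₁ ξ = Phi ρ c₁ c₂ (-ξ) := by
  rw [Phi, Phi, ← integral_neg_eq_self]
  refine integral_congr_ae (Eventually.of_forall fun t => ?_)
  have h1 : min (-t + ρ / 2) 0 = -max (t - ρ / 2) 0 := by
    rw [← min_neg_neg]; ring_nf
  have h2 : max (-t - ρ / 2) 0 = -min (t + ρ / 2) 0 := by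
    rw [← max_neg_neg]; ring_nf
  simp only [confineExponent, h1, h2]
  ring_nf

theorem expMoment_hardLimit {ρ : ℝ} (hρ : 0 < ρ) (ξ : ℝ) :
    expMoment (hardLimit ρ) ξ = Real.exp (ξ ^ 2 / 2) *
      ∫ t in (-(ρ / 2))..(ρ / 2), Real.exp (-(1 / 2) * (t - ξ) ^ 2) := by
  rw [expMoment, intervalIntegral.integral_of_le (by linarith), ← integral_Icc_eq_integral_Ioc,
    ← integral_const_mul, ← integral_indicator measurableSet_Icc]
  refine integral_congr_ae (Eventually.of_forall fun t => ?_)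
  simp only [hardLimit, Set.indicator_apply]
  split_ifs
  · rw [← Real.exp_add, ← Real.exp_add]
    ring_nf
  · simp

/-- Substitute `ξ = ρ(1/2 - s)`; the factor `e^{ξ²/2}` from the square in the moment accounts for
the rest. The right side is the integral delivered by `tendsto_prod_hard`. -/
theorem softHardOnePoint_pos_edge {ρ : ℝ} (hρ : 0 < ρ) :
    softHardOnePoint ρ ((ρ / 4 : ℝ) : ℂ) = ρ * ∫ s in (0 : ℝ)..1,
      Real.exp (ρ * (1 / 2 - s) * (ρ / 2)) * Real.exp (-((ρ / 2) ^ 2 / 2)) /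
        expMoment (hardLimit ρ) (ρ * (1 / 2 - s)) := by
  rw [softHardOnePoint, if_pos (by rw [Complex.ofReal_re, abs_of_pos (by positivity)]),
    Complex.ofReal_re]
  have := intervalIntegral.smul_integral_comp_sub_mul
    (fun ξ => Real.exp (-(1 / 2) * (2 * (ρ / 4) - ξ) ^ 2) /
      ∫ t in (-(ρ / 2))..(ρ / 2), Real.exp (-(1 / 2) * (t - ξ) ^ 2)) (a := 0) (b := 1) ρ (ρ / 2)
  have e1 : ρ / 2 - ρ * 1 = -(ρ / 2) := by ring
  have e2 : ρ / 2 - ρ * 0 = ρ / 2 := by ring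
  rw [e1, e2] at this
  rw [← this, smul_eq_mul]
  congr 1
  refine intervalIntegral.integral_congr fun s _ => ?_
  rw [expMoment_hardLimit hρ, ← div_div, ← Real.exp_add, ← Real.exp_sub]
  ring_nf

/-- The change of variables `ξ ↦ -ξ`, `t ↦ -t`. Thus the two scaling constants `c` and `c'`
coincide. -/
theorem softHardOnePoint_neg_edge {ρ : ℝ} (hρ : 0 < ρ) :
    softHardOnePoint ρ ((-(ρ / 4) : ℝ) : ℂ) = softHardOnePoint ρ ((ρ / 4 : ℝ) : ℂ) := by
  rw [softHardOnePoint, softHardOnePoint, Complex.ofReal_re, Complex.ofReal_re,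
    if_pos (by rw [abs_neg, abs_of_pos (by positivity)]),
    if_pos (by rw [abs_of_pos (by positivity)])]
  have := intervalIntegral.integral_comp_neg (a := -(ρ / 2)) (b := ρ / 2)
    (fun ξ => Real.exp (-(1 / 2) * (2 * (ρ / 4) - ξ) ^ 2) /
      ∫ t in (-(ρ / 2))..(ρ / 2), Real.exp (-(1 / 2) * (t - ξ) ^ 2))
  rw [neg_neg] at this
  rw [← this]
  refine intervalIntegral.integral_congr fun ξ _ => ?_
  have h2 := intervalIntegral.integral_comp_neg (a := -(ρ / 2)) (b := ρ / 2)
    (fun t => Real.exp (-(1 / 2) * (t - ξ) ^ 2))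
  rw [neg_neg] at h2
  rw [← h2]
  ring_nf

theorem softHardOnePoint_edge_pos {ρ : ℝ} (hρ : 0 < ρ) :
    0 < softHardOnePoint ρ ((ρ / 4 : ℝ) : ℂ) := by
  rw [softHardOnePoint, if_pos (by rw [Complex.ofReal_re, abs_of_pos (by positivity)])]
  have hpos : ∀ ξ : ℝ, 0 < ∫ t in (-(ρ / 2))..(ρ / 2), Real.exp (-(1 / 2) * (t - ξ) ^ 2) :=
    fun ξ => intervalIntegral.intervalIntegral_pos_of_pos
      (Continuous.intervalIntegrable (by fun_prop) _ _) (fun t => Real.exp_pos _) (by linarith)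
  have hcont : Continuous fun ξ : ℝ =>
      ∫ t in (-(ρ / 2))..(ρ / 2), Real.exp (-(1 / 2) * (t - ξ) ^ 2) :=
    intervalIntegral.continuous_parametric_intervalIntegral_of_continuous' (by fun_prop) _ _
  refine intervalIntegral.intervalIntegral_pos_of_pos (Continuous.intervalIntegrable ?_ _ _)
    (fun ξ => div_pos (Real.exp_pos _) (hpos ξ)) (by linarith)
  exact Continuous.div (by fun_prop) hcont fun ξ => (hpos ξ).ne'

/-! ### Product limits for the weights of a profile -/

namespace IsProfile

variable {W W1 W2 : ℕ → ℝ → ℝ} {L t₀ t₁ : ℕ → ℝ} {ρ : ℝ}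

theorem Phi_pos (h : IsProfile W W1 W2 L t₀ t₁ ρ) {c₁ c₂ : ℝ} (hc₁ : 0 < c₁) (hc₂ : 0 < c₂)
    (ξ : ℝ) : 0 < Phi ρ c₁ c₂ ξ := by
  have := (h.softWeight_weightLimit hc₁ hc₂).expMoment_pos ξ
  rw [expMoment_softLimit] at this
  exact pos_of_mul_pos_right this (Real.exp_pos _).le

/-- The case of `tendsto_prod_soft` where `D` is `c₂` times the excess. The cubic error of the
quadratic approximation is of order `U³/n`, whence the growth condition on `U`. -/
theorem tendsto_prod_softWeight (h : IsProfile W W1 W2 L t₀ t₁ ρ) {c₁ c₂ θ l : ℝ} {U : ℕ → ℝ}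
    (hc₁ : 0 < c₁) (hc₂ : 0 < c₂) (hθ : θ ∈ Set.Icc (0 : ℝ) 1) (hU : Tendsto U atTop atTop)
    (hU3 : Tendsto (fun n => U n ^ 3 / n) atTop (𝓝 0))
    (hl : Tendsto (fun n => n / L n * (Real.exp (-(c₂ * U n ^ 2 / 2)) / (c₂ * U n ^ 2))) atTop
      (𝓝 l)) :
    Tendsto (fun n : ℕ => ∏ i ∈ Finset.range n,
      (1 - (∫ t in Set.Ioi (t₁ n + U n), Real.exp (momentParameter (L n) θ n i * t) *
          softWeight (W n) (L n / 2) (t₀ n) (t₁ n) c₁ c₂ t) /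
        expMoment (softWeight (W n) (L n / 2) (t₀ n) (t₁ n) c₁ c₂)
          (momentParameter (L n) θ n i))) atTop
      (𝓝 (Real.exp (-(l / Phi ρ c₁ c₂ (ρ / 2))))) := by
  obtain ⟨C, K, δ, hC, hK, hδ, hE⟩ := h.excess_approx
  have hU3' : ∀ a : ℝ, 0 ≤ a → ∀ b : ℝ, 0 < b → ∀ᶠ n : ℕ in atTop, a * (U n ^ 3 / n) ≤ b := by
    intro a _ b hb
    have : Tendsto (fun n : ℕ => a * (U n ^ 3 / n)) atTop (𝓝 0) := by simpa using hU3.const_mul a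
    exact this.eventually_le_const hb
  have hwin : ∀ᶠ n : ℕ in atTop, 2 * U n ≤ δ * n := by
    filter_upwards [hU3' 2 (by norm_num) δ hδ, hU.eventually_ge_atTop 1, eventually_gt_atTop 0]
      with n h1 h2 hn
    have hn' : (0 : ℝ) < n := by exact_mod_cast hn
    rw [← mul_div_assoc, div_le_iff₀ hn'] at h1
    have : U n ≤ U n ^ 3 := le_self_pow₀ h2 (by norm_num)
    linarith
  -- The Gaussian factors cancel exactly: `ρ²/4 - ρ²/8` against the `ρ²/8` of the completed square.
  have e : Real.exp (ρ / 2 * (ρ / 2)) * Real.exp (-((ρ / 2) ^ 2 / 2)) /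
      expMoment (softLimit ρ c₁ c₂) (ρ / 2) = 1 / Phi ρ c₁ c₂ (ρ / 2) := by
    have hΦ := h.Phi_pos hc₁ hc₂ (ρ / 2)
    rw [expMoment_softLimit, ← Real.exp_add]
    have : ρ / 2 * (ρ / 2) + -((ρ / 2) ^ 2 / 2) = (ρ / 2) ^ 2 / 2 := by ring
    rw [this]
    field_simp
  have main := tendsto_prod_soft (h.softWeight_weightLimit hc₁ hc₂) (L := L) (T := t₁)
    (A := fun n => Real.exp (-(W n (t₁ n)))) (U := U)
    (D := fun n u => c₂ * excess (W n) (L n / 2) (t₁ n) u) (ρ := ρ) (θ := θ) (τ := ρ / 2)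
    (a := Real.exp (-((ρ / 2) ^ 2 / 2))) (c := c₂) (l := l) hθ h.width_pos h.width
    h.tendsto_outer
    ((Real.continuous_exp.tendsto _).comp (h.tendsto_apply h.tendsto_outer).1.neg) hc₂ hU
    ?_ ?_ ?_ ?_ ?_ hl
  · rwa [e, mul_one_div] at main
  · refine squeeze_zero' ((hU.eventually_ge_atTop 0).mono fun n hn => by positivity) ?_ hU3
    filter_upwards [hU.eventually_ge_atTop 1] with n h2
    have : U n ≤ U n ^ 3 := le_self_pow₀ h2 (by norm_num)
    gcongr
  · filter_upwards [h.continuous] with n hn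
    have := hn.measurable
    simp only [excess]
    fun_prop
  · filter_upwards [h.inner_lt_outer] with n hn u hu
    rw [softWeight, if_neg (by linarith), ← Real.exp_add]
    congr 1
    by_cases h0 : t₁ n + u ≤ t₁ n
    · have : u = 0 := by linarith
      subst this
      simp [excess]
    · rw [if_neg h0, excess]; ring
  · intro y hy
    -- `c₂ u²/2 = c₂ U²/2 + y + y²/(2 c₂ U²)` for `u = U + y/(c₂ U)`. The `12` bounds the cubic
    -- error when `K ≤ U` and `u ≤ 2U`: `(U + 2U)(2U)² = 12 U³`.
    have hz : Tendsto (fun n : ℕ => c₂ * C * 12 * (U n ^ 3 / n) + y ^ 2 / (2 * c₂) * (U n ^ 2)⁻¹)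
        atTop (𝓝 0) := by
      have h2 : Tendsto (fun n => (U n ^ 2)⁻¹) atTop (𝓝 0) :=
        ((tendsto_pow_atTop two_ne_zero).comp hU).inv_tendsto_atTop
      simpa using (hU3.const_mul (c₂ * C * 12)).add (h2.const_mul (y ^ 2 / (2 * c₂)))
    rw [tendsto_iff_norm_sub_tendsto_zero]
    refine squeeze_zero' (Eventually.of_forall fun n => norm_nonneg _) ?_ hz
    filter_upwards [hE, hwin, hU.eventually_ge_atTop 1, hU.eventually_ge_atTop (y / c₂),
      hU.eventually_ge_atTop K, eventually_gt_atTop 0] with n h1 h2 h3 h4 h5 hn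
    have hn' : (0 : ℝ) < n := by exact_mod_cast hn
    have hU0 : 0 < U n := by linarith
    set u := U n + y / (c₂ * U n) with hu
    have hy1 : y / (c₂ * U n) ≤ U n := by
      rw [div_mul_eq_div_div]
      exact (div_le_self (by positivity) h3).trans h4
    have hu0 : 0 ≤ u := by positivity
    have hu2 : u ≤ 2 * U n := by linarith
    have h6 := (h1 u hu0 (hu2.trans h2)).2
    have h7 : C * (K + u) * u ^ 2 / n ≤ C * 12 * (U n ^ 3 / n) := by
      calc C * (K + u) * u ^ 2 / n ≤ C * (U n + 2 * U n) * (2 * U n) ^ 2 / n := by gcongr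
        _ = _ := by ring
    have h8 : c₂ * excess (W n) (L n / 2) (t₁ n) u - c₂ * U n ^ 2 / 2 - y =
        c₂ * (excess (W n) (L n / 2) (t₁ n) u - u ^ 2 / 2) +
          y ^ 2 / (2 * c₂) * (U n ^ 2)⁻¹ := by
      rw [hu]; field_simp; ring
    rw [Real.norm_eq_abs, h8]
    refine (abs_add_le _ _).trans (add_le_add ?_ (abs_of_nonneg (by positivity)).le)
    rw [abs_mul, abs_of_pos hc₂]
    calc c₂ * _ ≤ c₂ * (C * 12 * (U n ^ 3 / n)) := by gcongr; exact h6.trans h7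
      _ = _ := by ring
  -- For large `y` the point `u` leaves the quadratic window, so the bound uses the tangent at `U`:
  -- slope at least `U/2` yields `y/2`, and the error at `U` costs at most `1`.
  · filter_upwards [hE, hwin, hU.eventually_ge_atTop 1, h.excess_tangent,
      hU.eventually_ge_atTop K, eventually_gt_atTop 0, hU3' (c₂ * (C * 2)) (by positivity) 1 one_pos,
      hU3' (C * 2) (by positivity) (1 / 2) one_half_pos] with n h1 h2 h3 h4 h5 hn h6 h7 y hy
    have hn' : (0 : ℝ) < n := by exact_mod_cast hn
    have hU0 : 0 < U n := by linarith
    obtain ⟨k1, k2⟩ := h1 (U n) hU0.le (by linarith)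
    have k3 : C * (K + U n) * U n ^ 2 / n ≤ C * 2 * (U n ^ 3 / n) := by
      calc C * (K + U n) * U n ^ 2 / n ≤ C * (U n + U n) * U n ^ 2 / n := by gcongr
        _ = _ := by ring
    have k4 : C * (K + U n) * U n / n ≤ C * 2 * (U n ^ 3 / n) := by
      calc C * (K + U n) * U n / n ≤ C * (U n + U n) * U n ^ 2 / n := by
            gcongr
            exact le_self_pow₀ h3 two_ne_zero
        _ = _ := by ring
    have k5 := (abs_le.1 k1).1
    have k6 := (abs_le.1 k2).1
    have k7 := h4 (U n) (U n + y / (c₂ * U n))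
    rw [add_sub_cancel_left] at k7
    have k8 : U n / 2 * (y / (c₂ * U n)) ≤
        (W1 n (t₁ n + U n) - L n / 2) * (y / (c₂ * U n)) :=
      mul_le_mul_of_nonneg_right (by linarith) (by positivity)
    have k9 : c₂ * (U n / 2 * (y / (c₂ * U n))) = y / 2 := by field_simp
    have k10 : c₂ * (U n ^ 2 / 2 - C * 2 * (U n ^ 3 / n) + U n / 2 * (y / (c₂ * U n))) ≤
        c₂ * excess (W n) (L n / 2) (t₁ n) (U n + y / (c₂ * U n)) :=
      mul_le_mul_of_nonneg_left (by linarith) hc₂.le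
    have k11 : c₂ * (U n ^ 2 / 2 - C * 2 * (U n ^ 3 / n) + U n / 2 * (y / (c₂ * U n))) =
      c₂ * U n ^ 2 / 2 - c₂ * (C * 2) * (U n ^ 3 / n) + y / 2 := by rw [← k9]; ring
    rw [k11] at k10
    linarith

theorem tendsto_prod_hardWeight (h : IsProfile W W1 W2 L t₀ t₁ ρ) {θ l : ℝ} {U : ℕ → ℝ}
    (hθ : θ ∈ Set.Icc (0 : ℝ) 1) (hU : ∀ᶠ n in atTop, 0 ≤ U n)
    (hUn : Tendsto (fun n => n * U n) atTop (𝓝 l)) :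
    Tendsto (fun n : ℕ => ∏ i ∈ Finset.range n,
      (1 - (∫ t in Set.Ioi (t₁ n - U n), Real.exp (momentParameter (L n) θ n i * t) *
          hardWeight (W n) (t₀ n) (t₁ n) t) /
        expMoment (hardWeight (W n) (t₀ n) (t₁ n)) (momentParameter (L n) θ n i))) atTop
      (𝓝 (Real.exp (-(l / ρ * softHardOnePoint ρ ((ρ / 4 : ℝ) : ℂ))))) := by
  have hρ := h.width_pos
  have hU0 : Tendsto U atTop (𝓝 0) := by
    have h1 := hUn.mul (tendsto_inv_atTop_nhds_zero_nat (𝕜 := ℝ))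
    rw [mul_zero] at h1
    refine h1.congr' ?_
    filter_upwards [eventually_gt_atTop 0] with n hn
    have hn' : (0 : ℝ) < n := by exact_mod_cast hn
    field_simp
  have main := tendsto_prod_hard h.hardWeight_weightLimit (L := L) (T := t₁) (U := U) (ρ := ρ)
    (θ := θ) (τ := ρ / 2) (a := Real.exp (-((ρ / 2) ^ 2 / 2))) (l := l) hθ hρ h.width
    h.tendsto_outer hU hUn ?_ ?_
  · rw [softHardOnePoint_pos_edge hρ, ← mul_assoc, div_mul_cancel₀ _ hρ.ne']
    exact main
  · refine Eventually.of_forall fun n t ht => ?_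
    rw [hardWeight, Set.indicator_of_notMem fun hm => not_le.2 ht hm.2]
  · intro s hs
    have hx : Tendsto (fun n => t₁ n - U n * s) atTop (𝓝 (ρ / 2)) := by
      simpa using h.tendsto_outer.sub (hU0.mul_const s)
    refine ((Real.continuous_exp.tendsto _).comp (h.tendsto_apply hx).1.neg).congr' ?_
    filter_upwards [hU, h.tendsto_inner.eventually_lt hx (by linarith)] with n h1 h2
    rw [hardWeight, Set.indicator_of_mem (show t₁ n - U n * s ∈ Set.Icc (t₀ n) (t₁ n) from
      ⟨h2.le, by linarith [mul_nonneg h1 hs.1]⟩)]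
    rfl

end IsProfile

/-! ### Radial Gibbs ensembles and the product formula -/

section

open scoped ComplexConjugate

instance : SigmaFinite areaMeasure := by
  rw [areaMeasure, ENNReal.ofReal]
  exact inferInstanceAs (SigmaFinite ((_ : NNReal) • (volume : Measure ℂ)))

theorem exp_finset_sum {ι : Type*} (s : Finset ι) (f : ι → EReal) :
    EReal.exp (∑ i ∈ s, f i) = ∏ i ∈ s, EReal.exp (f i) := by
  classical
  induction s using Finset.induction_on with
  | empty => simp
  | insert a s ha ih => rw [Finset.sum_insert ha, Finset.prod_insert ha, EReal.exp_add, ih]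

/-- Inversion distributes over the products because no `0 · ∞` occurs. The inverse squared distances
never vanish, and `e^{nQ}` never vanishes since its inverse is finite by `hω`. -/
theorem boltzmann_eq {n : ℕ} {Q : ℂ → EReal} {ω : ℝ → ℝ}
    (hω : ∀ z, (EReal.exp (Q z) ^ n)⁻¹ = ENNReal.ofReal (ω ‖z‖)) (ζ : Fin n → ℂ) :
    boltzmann n Q ζ = ENNReal.ofReal (‖(Matrix.vandermonde ζ).det‖ ^ 2) *
      ∏ j, ENNReal.ofReal (ω ‖ζ j‖) := by
  have hQ0 : ∀ j : Fin n, EReal.exp (Q (ζ j)) ^ n ≠ 0 := by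
    intro j h
    have := hω (ζ j)
    rw [h, ENNReal.inv_zero] at this
    exact ENNReal.ofReal_ne_top this.symm
  have hd : ∀ j k : Fin n, (‖ζ j - ζ k‖ₑ ^ 2)⁻¹ ≠ 0 := fun j k => by simp
  rw [boltzmann, EReal.exp_neg, hamiltonian, EReal.exp_add, exp_finset_sum, EReal.exp_nmul,
    exp_finset_sum, ← Finset.prod_pow]
  simp_rw [exp_finset_sum, ENNReal.exp_log]
  rw [ENNReal.mul_inv (Or.inl (Finset.prod_ne_zero_iff.2 fun j _ =>
      Finset.prod_ne_zero_iff.2 fun k _ => hd j k))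
      (Or.inr (Finset.prod_ne_zero_iff.2 fun j _ => hQ0 j)),
    ENNReal.prod_inv_distrib fun i _ j _ _ => Or.inl (hQ0 i),
    ENNReal.prod_inv_distrib fun i _ j _ _ => Or.inl
      (Finset.prod_ne_zero_iff.2 fun k _ => hd i k)]
  congr 1
  · rw [Matrix.det_vandermonde, norm_prod, ← Finset.prod_pow, ENNReal.ofReal_prod_of_nonneg
      fun i _ => by positivity]
    simp_rw [norm_prod, ← Finset.prod_pow]
    have h1 : ∀ i : Fin n, (∏ k ∈ Finset.Iio i, (‖ζ i - ζ k‖ₑ ^ 2)⁻¹)⁻¹ =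
        ∏ k ∈ Finset.Iio i, ENNReal.ofReal (‖ζ i - ζ k‖ ^ 2) := by
      intro i
      rw [ENNReal.prod_inv_distrib fun k _ j _ _ => Or.inl (hd i k)]
      refine Finset.prod_congr rfl fun k _ => ?_
      rw [inv_inv, ENNReal.ofReal_pow (norm_nonneg _), ofReal_norm]
    simp_rw [h1]
    rw [Finset.prod_comm' (t' := Finset.univ) (s' := fun k => Finset.Ioi k) (by simp)]
    refine Finset.prod_congr rfl fun i _ => ?_
    rw [ENNReal.ofReal_prod_of_nonneg fun i _ => by positivity]
  · exact Finset.prod_congr rfl fun j _ => hω _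

theorem integral_rotation (f : ℂ → ℂ) (a : Circle) :
    ∫ z, f (a * z) ∂areaMeasure = ∫ z, f z ∂areaMeasure := by
  rw [areaMeasure, integral_smul_measure, integral_smul_measure]
  congr 1
  exact (rotation a).measurePreserving.integral_comp
    (rotation a).toHomeomorph.measurableEmbedding f

/-- Rotation by the angle `π/(a - b)` preserves the measure and changes the sign of the integrand.
No integrability is needed for this. -/
theorem integral_monomial_eq_zero (φ : ℝ → ℝ) {a b : ℕ} (hab : a ≠ b) :
    ∫ z : ℂ, z ^ a * conj z ^ b * (φ ‖z‖ : ℂ) ∂areaMeasure = 0 := by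
  set I := ∫ z : ℂ, z ^ a * conj z ^ b * (φ ‖z‖ : ℂ) ∂areaMeasure with hI
  have hd : ((a : ℝ) - b) ≠ 0 := sub_ne_zero.2 (by exact_mod_cast hab)
  set c : Circle := Circle.exp (Real.pi / (a - b)) with hc
  have hcc : (c : ℂ) ^ a * conj (c : ℂ) ^ b = -1 := by
    rw [hc, Circle.coe_exp, ← Complex.exp_conj, ← Complex.exp_nat_mul, ← Complex.exp_nat_mul,
      ← Complex.exp_add, ← Complex.exp_pi_mul_I]
    congr 1
    simp only [map_mul, Complex.conj_ofReal, Complex.conj_I]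
    have hd' : ((a : ℂ) - b) ≠ 0 := by exact_mod_cast hd
    push_cast
    field_simp
    ring
  have h1 := integral_rotation (fun z : ℂ => z ^ a * conj z ^ b * (φ ‖z‖ : ℂ)) c
  have h2 : (fun z : ℂ => (c * z) ^ a * conj (c * z) ^ b * (φ ‖(c : ℂ) * z‖ : ℂ)) =
      fun z : ℂ => -(z ^ a * conj z ^ b * (φ ‖z‖ : ℂ)) := by
    funext z
    rw [norm_mul, Circle.norm_coe, one_mul, map_mul, mul_pow, mul_pow]
    linear_combination (z ^ a * conj z ^ b * (φ ‖z‖ : ℂ)) * hcc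
  rw [h2, integral_neg] at h1
  have h3 : -I = I := h1
  exact self_eq_neg.1 h3.symm

/-- The radial moment `∫ |z|^{2 k} φ(|z|) dA`. -/
noncomputable def radialMoment (φ : ℝ → ℝ) (k : ℕ) : ℝ :=
  ∫ z : ℂ, ‖z‖ ^ (2 * k) * φ ‖z‖ ∂areaMeasure

theorem integrable_monomial {φ : ℝ → ℝ} (hφ : Measurable φ) (hφ0 : ∀ r, 0 ≤ φ r) {n : ℕ}
    (hint : ∀ k < n, Integrable (fun z : ℂ => ‖z‖ ^ (2 * k) * φ ‖z‖) areaMeasure) {a b : ℕ}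
    (ha : a < n) (hb : b < n) :
    Integrable (fun z : ℂ => z ^ a * conj z ^ b * (φ ‖z‖ : ℂ)) areaMeasure := by
  refine ((hint a ha).add (hint b hb)).mono' (Measurable.aestronglyMeasurable ?_)
    (Eventually.of_forall fun z => ?_)
  · have h1 : Measurable fun z : ℂ => φ ‖z‖ := hφ.comp measurable_norm
    have h2 : Measurable fun z : ℂ => conj z := Complex.continuous_conj.measurable
    fun_prop
  · simp only [norm_mul, norm_pow, RCLike.norm_conj, Complex.norm_real, Pi.add_apply,
      Real.norm_of_nonneg (hφ0 _)]
    rw [← add_mul]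
    refine mul_le_mul_of_nonneg_right ?_ (hφ0 _)
    have h1 := two_mul_le_add_sq (‖z‖ ^ a) (‖z‖ ^ b)
    have h2 : 0 ≤ ‖z‖ ^ a * ‖z‖ ^ b := by positivity
    rw [mul_comm 2 a, mul_comm 2 b, pow_mul, pow_mul]
    linarith

theorem integral_monomial_self (φ : ℝ → ℝ) (k : ℕ) :
    ∫ z : ℂ, z ^ k * conj z ^ k * (φ ‖z‖ : ℂ) ∂areaMeasure = (radialMoment φ k : ℂ) := by
  rw [radialMoment, ← integral_complex_ofReal]
  refine integral_congr_ae (Eventually.of_forall fun z => ?_)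
  simp only
  rw [← mul_pow, Complex.mul_conj, Complex.normSq_eq_norm_sq, pow_mul]
  push_cast
  rfl

/-- Expand the determinant and its conjugate over pairs of permutations and integrate each
coordinate. Orthogonality kills the pairs with `σ ≠ τ`, and each of the `n!` diagonal pairs gives
the same product. -/
theorem lintegral_vandermonde {φ : ℝ → ℝ} (hφ : Measurable φ) (hφ0 : ∀ r, 0 ≤ φ r) {n : ℕ}
    (hint : ∀ k < n, Integrable (fun z : ℂ => ‖z‖ ^ (2 * k) * φ ‖z‖) areaMeasure) :
    ∫⁻ ζ : Fin n → ℂ, ENNReal.ofReal (‖(Matrix.vandermonde ζ).det‖ ^ 2) *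
      ∏ j, ENNReal.ofReal (φ ‖ζ j‖) ∂(Measure.pi fun _ => areaMeasure) =
    ENNReal.ofReal (n.factorial * ∏ k ∈ Finset.range n, radialMoment φ k) := by
  let G : Equiv.Perm (Fin n) → Equiv.Perm (Fin n) → (Fin n → ℂ) → ℂ := fun σ τ ζ =>
    ((σ.sign : ℤ) : ℂ) * ((τ.sign : ℤ) : ℂ) *
      ∏ j, (ζ j ^ (σ j : ℕ) * conj (ζ j) ^ (τ j : ℕ) * (φ ‖ζ j‖ : ℂ))
  have hexp : ∀ ζ : Fin n → ℂ, ((‖(Matrix.vandermonde ζ).det‖ ^ 2 * ∏ j, φ ‖ζ j‖ : ℝ) : ℂ) =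
      ∑ σ : Equiv.Perm (Fin n), ∑ τ : Equiv.Perm (Fin n), G σ τ ζ := by
    intro ζ
    push_cast
    rw [← Complex.mul_conj', ← Matrix.det_transpose, Matrix.det_apply', map_sum, Finset.sum_mul_sum,
      Finset.sum_mul]
    refine Finset.sum_congr rfl fun σ _ => ?_
    rw [Finset.sum_mul]
    refine Finset.sum_congr rfl fun τ _ => ?_
    simp only [G, Matrix.transpose_apply, Matrix.vandermonde_apply, map_mul, map_prod, map_pow,
      map_intCast, Finset.prod_mul_distrib]
    ring
  have hGint : ∀ σ τ, Integrable (G σ τ) (Measure.pi fun _ => areaMeasure) := fun σ τ =>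
    (Integrable.fintype_prod (f := fun (j : Fin n) (z : ℂ) =>
      z ^ (σ j : ℕ) * conj z ^ (τ j : ℕ) * (φ ‖z‖ : ℂ)) fun j =>
      integrable_monomial hφ hφ0 hint (σ j).2 (τ j).2).const_mul _
  have hGval : ∀ σ τ, ∫ ζ, G σ τ ζ ∂(Measure.pi fun _ => areaMeasure) =
      if σ = τ then ((∏ k ∈ Finset.range n, radialMoment φ k : ℝ) : ℂ) else 0 := by
    intro σ τ
    simp only [G]
    rw [integral_const_mul, integral_fintype_prod_eq_prod (f := fun (j : Fin n) (z : ℂ) =>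
      z ^ (σ j : ℕ) * conj z ^ (τ j : ℕ) * (φ ‖z‖ : ℂ))]
    split_ifs with h
    · subst h
      simp_rw [integral_monomial_self]
      rw [Equiv.prod_comp σ fun j : Fin n => ((radialMoment φ (j : ℕ) : ℝ) : ℂ),
        Finset.prod_range]
      push_cast
      rw [← Int.cast_mul, Int.units_coe_mul_self, Int.cast_one, one_mul]
    · obtain ⟨j, hj⟩ : ∃ j, σ j ≠ τ j := by
        by_contra hcon
        push Not at hcon
        exact h (Equiv.ext hcon)
      rw [Finset.prod_eq_zero (Finset.mem_univ j), mul_zero]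
      exact integral_monomial_eq_zero φ fun h => hj (Fin.ext h)
  have hval : ∫ ζ : Fin n → ℂ, ((‖(Matrix.vandermonde ζ).det‖ ^ 2 * ∏ j, φ ‖ζ j‖ : ℝ) : ℂ)
      ∂(Measure.pi fun _ => areaMeasure) =
      ((n.factorial * ∏ k ∈ Finset.range n, radialMoment φ k : ℝ) : ℂ) := by
    simp_rw [hexp]
    rw [integral_finsetSum _ fun σ _ => integrable_finsetSum _ fun τ _ => hGint σ τ]
    simp_rw [integral_finsetSum _ fun τ _ => hGint _ τ, hGval]
    simp [Fintype.card_perm]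
  have hInt : Integrable (fun ζ : Fin n → ℂ =>
      ‖(Matrix.vandermonde ζ).det‖ ^ 2 * ∏ j, φ ‖ζ j‖) (Measure.pi fun _ => areaMeasure) := by
    have h1 : Integrable (fun ζ : Fin n → ℂ =>
        ((‖(Matrix.vandermonde ζ).det‖ ^ 2 * ∏ j, φ ‖ζ j‖ : ℝ) : ℂ))
        (Measure.pi fun _ => areaMeasure) := by
      simp_rw [hexp]
      exact integrable_finsetSum _ fun σ _ => integrable_finsetSum _ fun τ _ => hGint σ τ
    exact h1.re
  rw [integral_complex_ofReal, Complex.ofReal_inj] at hval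
  rw [← hval, ofReal_integral_eq_lintegral_ofReal hInt (Eventually.of_forall fun ζ =>
    mul_nonneg (by positivity) (Finset.prod_nonneg fun j _ => hφ0 _))]
  refine lintegral_congr fun ζ => ?_
  rw [ENNReal.ofReal_mul (by positivity), ENNReal.ofReal_prod_of_nonneg fun j _ => hφ0 _]

/-- The event merely replaces `ω` by its restriction to `B`, so `lintegral_vandermonde` evaluates
both the numerator and the partition function, and `n!` cancels. -/
theorem gibbs_forall_mem {n : ℕ} {Q : ℂ → EReal} {ω : ℝ → ℝ}
    (hQ : ∀ z, (EReal.exp (Q z) ^ n)⁻¹ = ENNReal.ofReal (ω ‖z‖)) (hω : Measurable ω)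
    (hω0 : ∀ r, 0 ≤ ω r)
    (hint : ∀ k < n, Integrable (fun z : ℂ => ‖z‖ ^ (2 * k) * ω ‖z‖) areaMeasure)
    (hpos : ∀ k < n, 0 < radialMoment ω k) {B : Set ℝ} (hB : MeasurableSet B) :
    gibbs n Q {ζ | ∀ j, ‖ζ j‖ ∈ B} = ENNReal.ofReal
      (∏ k ∈ Finset.range n, radialMoment (B.indicator ω) k / radialMoment ω k) := by
  have hS : MeasurableSet {ζ : Fin n → ℂ | ∀ j, ‖ζ j‖ ∈ B} := by
    rw [Set.ofPred_forall]
    exact MeasurableSet.iInter fun j => (measurable_norm.comp (measurable_pi_apply j)) hB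
  have hB0 : ∀ r, 0 ≤ B.indicator ω r := fun r => Set.indicator_nonneg (fun _ _ => hω0 _) r
  have hintB : ∀ k < n, Integrable (fun z : ℂ => ‖z‖ ^ (2 * k) * B.indicator ω ‖z‖)
      areaMeasure := by
    intro k hk
    refine (hint k hk).mono' (Measurable.aestronglyMeasurable ?_) (Eventually.of_forall fun z => ?_)
    · have : Measurable fun z : ℂ => B.indicator ω ‖z‖ := (hω.indicator hB).comp measurable_norm
      fun_prop
    · rw [Real.norm_of_nonneg (mul_nonneg (by positivity) (hB0 _))]
      gcongr
      exact Set.indicator_le_self' (fun _ _ => hω0 _) _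
  have hZ : partitionFunction n Q = ENNReal.ofReal
      (n.factorial * ∏ k ∈ Finset.range n, radialMoment ω k) := by
    rw [partitionFunction, ← lintegral_vandermonde hω hω0 hint]
    exact lintegral_congr fun ζ => boltzmann_eq hQ ζ
  have hN : ∫⁻ ζ in {ζ : Fin n → ℂ | ∀ j, ‖ζ j‖ ∈ B}, boltzmann n Q ζ
      ∂(Measure.pi fun _ => areaMeasure) = ENNReal.ofReal
      (n.factorial * ∏ k ∈ Finset.range n, radialMoment (B.indicator ω) k) := by
    rw [← lintegral_vandermonde (hω.indicator hB) hB0 hintB, ← lintegral_indicator hS]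
    refine lintegral_congr fun ζ => ?_
    by_cases h : ∀ j, ‖ζ j‖ ∈ B
    · rw [Set.indicator_of_mem (show ζ ∈ {ζ : Fin n → ℂ | ∀ j, ‖ζ j‖ ∈ B} from h),
        boltzmann_eq hQ ζ]
      congr 1
      exact Finset.prod_congr rfl fun j _ => by rw [Set.indicator_of_mem (h j)]
    · rw [Set.indicator_of_notMem (show ζ ∉ {ζ : Fin n → ℂ | ∀ j, ‖ζ j‖ ∈ B} from h)]
      push Not at h
      obtain ⟨j, hj⟩ := h
      rw [Finset.prod_eq_zero (Finset.mem_univ j), mul_zero]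
      rw [Set.indicator_of_notMem hj, ENNReal.ofReal_zero]
  have hprod : 0 < ∏ k ∈ Finset.range n, radialMoment ω k :=
    Finset.prod_pos fun k hk => hpos k (Finset.mem_range.1 hk)
  have hfac : (0 : ℝ) < n.factorial := by exact_mod_cast n.factorial_pos
  rw [gibbs, Measure.smul_apply, withDensity_apply _ hS, hN, hZ, smul_eq_mul, mul_comm,
    ← div_eq_mul_inv, ← ENNReal.ofReal_div_of_pos (by positivity), mul_div_mul_left _ _ hfac.ne',
    Finset.prod_div_distrib]

end

/-! ### Logarithmic radial coordinate -/

theorem image_exp_mul {κ : ℝ} (hκ : 0 < κ) :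
    Set.image (fun t : ℝ => Real.exp (κ * t)) Set.univ = Set.Ioi 0 := by
  ext r
  simp only [Set.image_univ, Set.mem_range, Set.mem_Ioi]
  constructor
  · rintro ⟨t, rfl⟩; exact Real.exp_pos _
  · intro hr
    exact ⟨Real.log r / κ, by rw [mul_div_cancel₀ _ hκ.ne', Real.exp_log hr]⟩

theorem hasDerivAt_exp_mul (κ t : ℝ) :
    HasDerivAt (fun t : ℝ => Real.exp (κ * t)) (Real.exp (κ * t) * κ) t := by
  have h1 : HasDerivAt (fun t : ℝ => κ * t) κ t := by
    simpa using (hasDerivAt_id t).const_mul κ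
  exact h1.exp

theorem injOn_exp_mul {κ : ℝ} (hκ : 0 < κ) :
    Set.InjOn (fun t : ℝ => Real.exp (κ * t)) Set.univ := by
  intro a _ b _ hab
  exact mul_left_cancel₀ hκ.ne' (Real.exp_injective hab)

theorem areaMeasure_integral_norm (f : ℝ → ℝ) :
    ∫ z : ℂ, f ‖z‖ ∂areaMeasure = 2 * ∫ r in Set.Ioi (0 : ℝ), r * f r := by
  have hπ := Real.pi_pos
  rw [areaMeasure, integral_smul_measure, integral_fun_norm_addHaar,
    Complex.finrank_real_complex, ENNReal.toReal_ofReal (by positivity)]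
  have hv : (volume : Measure ℂ).real (Metric.ball 0 1) = Real.pi := by
    rw [Measure.real, Complex.volume_ball]
    simp
  rw [hv]
  simp only [smul_eq_mul, nsmul_eq_mul, Nat.add_one_sub_one, pow_one, Nat.cast_ofNat]
  field_simp

theorem areaMeasure_integrable_norm (f : ℝ → ℝ) :
    Integrable (fun z : ℂ => f ‖z‖) areaMeasure ↔
      IntegrableOn (fun r => r * f r) (Set.Ioi (0 : ℝ)) := by
  have hπ := Real.pi_pos
  rw [areaMeasure, integrable_smul_measure (by simpa using hπ) ENNReal.ofReal_ne_top,
    integrable_fun_norm_addHaar, Complex.finrank_real_complex]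
  simp

/-- Polar coordinates followed by `r = e^{κt}`; the area element and the Jacobian each add one power
of `r`, whence `2k + 2`. -/
theorem radialMoment_eq (φ : ℝ → ℝ) (k : ℕ) {κ : ℝ} (hκ : 0 < κ) :
    radialMoment φ k = 2 * κ *
      ∫ t, Real.exp ((2 * k + 2) * κ * t) * φ (Real.exp (κ * t)) := by
  rw [radialMoment, areaMeasure_integral_norm fun r => r ^ (2 * k) * φ r, ← image_exp_mul hκ,
    integral_image_eq_integral_abs_deriv_smul MeasurableSet.univ
      (fun t _ => (hasDerivAt_exp_mul κ t).hasDerivWithinAt) (injOn_exp_mul hκ),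
    Measure.restrict_univ, mul_assoc, ← integral_const_mul κ]
  congr 1
  refine integral_congr_ae (Eventually.of_forall fun t => ?_)
  simp only [smul_eq_mul]
  rw [abs_of_pos (by positivity), ← Real.exp_nat_mul]
  have : Real.exp ((2 * k + 2) * κ * t) =
      Real.exp (κ * t) * Real.exp (κ * t) * Real.exp ((2 * k : ℕ) * (κ * t)) := by
    rw [← Real.exp_add, ← Real.exp_add]; push_cast; ring_nf
  rw [this]
  ring

theorem integrable_radial (φ : ℝ → ℝ) (k : ℕ) {κ : ℝ} (hκ : 0 < κ)
    (h : Integrable fun t => Real.exp ((2 * k + 2) * κ * t) * φ (Real.exp (κ * t))) :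
    Integrable (fun z : ℂ => ‖z‖ ^ (2 * k) * φ ‖z‖) areaMeasure := by
  rw [areaMeasure_integrable_norm fun r => r ^ (2 * k) * φ r, ← image_exp_mul hκ,
    integrableOn_image_iff_integrableOn_abs_deriv_smul MeasurableSet.univ
      (fun t _ => (hasDerivAt_exp_mul κ t).hasDerivWithinAt) (injOn_exp_mul hκ),
    integrableOn_univ]
  refine (h.const_mul κ).congr (Eventually.of_forall fun t => ?_)
  simp only [smul_eq_mul]
  rw [abs_of_pos (by positivity), ← Real.exp_nat_mul]
  have : Real.exp ((2 * k + 2) * κ * t) =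
      Real.exp (κ * t) * Real.exp (κ * t) * Real.exp ((2 * k : ℕ) * (κ * t)) := by
    rw [← Real.exp_add, ← Real.exp_add]; push_cast; ring_nf
  rw [this]
  ring

/-- `w` is the weight of `Q` on the logarithmic scale `t = (2 n / L) log |z|`. -/
structure IsLogWeight (n : ℕ) (Q : ℂ → EReal) (L : ℝ) (w : ℝ → ℝ) : Prop where
  index_pos : 0 < n
  width_pos : 0 < L
  zero_ne_bot : Q 0 ≠ ⊥
  weight : ∀ z, z ≠ 0 → (EReal.exp (Q z) ^ n)⁻¹ =
    ENNReal.ofReal (Real.exp (-(L / 2 * (2 * n / L * Real.log ‖z‖))) * w (2 * n / L * Real.log ‖z‖))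
  meas : Measurable w
  nonneg : ∀ t, 0 ≤ w t
  integrable : ∀ x, |x| ≤ L → Integrable fun t => Real.exp (x * t) * w t
  pos : ∀ x, |x| ≤ L → 0 < expMoment w x

theorem IsLogWeight.gibbs_forall_mem {n : ℕ} {Q : ℂ → EReal} {L : ℝ} {w : ℝ → ℝ}
    (h : IsLogWeight n Q L w) {B : Set ℝ} (hB : MeasurableSet B) {S : Set ℝ}
    (hS : MeasurableSet S) (hSB : ∀ t, Real.exp (L / (2 * n) * t) ∈ B ↔ t ∉ S) :
    gibbs n Q {ζ | ∀ j, ‖ζ j‖ ∈ B} = ENNReal.ofReal (∏ i ∈ Finset.range n,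
      (1 - (∫ t in S, Real.exp (momentParameter L 0 n i * t) * w t) /
        expMoment w (momentParameter L 0 n i))) := by
  have hn : (0 : ℝ) < n := by exact_mod_cast h.index_pos
  have hL := h.width_pos
  set κ := L / (2 * n) with hκdef
  have hκ : 0 < κ := by positivity
  -- The product formula asks for the weight at every point, including the origin, where the
  -- logarithmic description says nothing. There the actual value is used, finite by `zero_ne_bot`.
  set ω : ℝ → ℝ := fun r => if 0 < r then
    Real.exp (-(L / 2 * (2 * n / L * Real.log r))) * w (2 * n / L * Real.log r)
    else ((EReal.exp (Q 0) ^ n)⁻¹).toReal with hωdef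
  have hω : Measurable ω := by
    refine Measurable.ite measurableSet_Ioi ?_ measurable_const
    have h1 : Measurable fun r : ℝ => 2 * n / L * Real.log r := by fun_prop
    exact (h1.const_mul (L / 2)).neg.exp.mul (h.meas.comp h1)
  have hω0 : ∀ r, 0 ≤ ω r := by
    intro r
    simp only [hωdef]
    split_ifs
    · exact mul_nonneg (Real.exp_pos _).le (h.nonneg _)
    · exact ENNReal.toReal_nonneg
  have hQ : ∀ z, (EReal.exp (Q z) ^ n)⁻¹ = ENNReal.ofReal (ω ‖z‖) := by
    intro z
    by_cases hz : z = 0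
    · subst hz
      simp only [hωdef, norm_zero, lt_irrefl, if_false]
      rw [ENNReal.ofReal_toReal]
      simp [h.zero_ne_bot]
    · simp only [hωdef, norm_pos_iff.2 hz, if_true]
      exact h.weight z hz
  have hωexp : ∀ t, ω (Real.exp (κ * t)) = Real.exp (-(L / 2 * t)) * w t := by
    intro t
    have : 2 * n / L * (κ * t) = t := by rw [hκdef]; field_simp
    simp only [hωdef, Real.exp_pos, if_true, Real.log_exp, this]
  -- This is `(2k + 2)κ - L/2` for `κ = L/(2n)`. Reversing the order by `k = n - 1 - i` gives
  -- `momentParameter` with `θ = 0`, the largest parameter first.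
  set ξ : ℕ → ℝ := fun k => L * ((k + 1) / n - 1 / 2) with hξ
  have hξL : ∀ k < n, |ξ k| ≤ L := by
    intro k hk
    have h1 := abs_momentParameter_le (θ := 1) hL.le ⟨zero_le_one, le_rfl⟩ hk
    rw [← abs_neg] at h1
    convert h1 using 2
    simp only [hξ, momentParameter]; ring
  have hexp : ∀ (k : ℕ) (t : ℝ), Real.exp ((2 * k + 2) * κ * t) * Real.exp (-(L / 2 * t)) =
      Real.exp (ξ k * t) := by
    intro k t
    rw [← Real.exp_add]
    congr 1
    simp only [hξ, hκdef]
    field_simp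
    ring
  have hmom : ∀ k, radialMoment ω k = 2 * κ * expMoment w (ξ k) := by
    intro k
    rw [radialMoment_eq ω k hκ, expMoment]
    simp_rw [hωexp, ← mul_assoc (Real.exp _), hexp]
  have hmomB : ∀ k < n, radialMoment (B.indicator ω) k = 2 * κ *
      (expMoment w (ξ k) - ∫ t in S, Real.exp (ξ k * t) * w t) := by
    intro k hk
    rw [radialMoment_eq _ k hκ, expMoment, ← integral_add_compl hS (h.integrable _ (hξL k hk)),
      add_sub_cancel_left, ← integral_indicator hS.compl]
    congr 1
    refine integral_congr_ae (Eventually.of_forall fun t => ?_)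
    change Real.exp ((2 * k + 2) * κ * t) * B.indicator ω (Real.exp (κ * t)) = _
    by_cases ht : t ∈ S
    · rw [Set.indicator_of_notMem (s := B) (by rwa [hSB, not_not]), Set.indicator_of_notMem (by simpa),
        mul_zero]
    · rw [Set.indicator_of_mem ((hSB t).2 ht), Set.indicator_of_mem (Set.mem_compl ht), hωexp,
        ← mul_assoc, hexp]
  rw [AlmostCircular.gibbs_forall_mem hQ hω hω0 (fun k hk => ?_) (fun k hk => ?_) hB]
  · congr 1
    rw [← Finset.prod_range_reflect]
    refine Finset.prod_congr rfl fun i hi => ?_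
    have hi := Finset.mem_range.1 hi
    have hk : n - 1 - i < n := by omega
    have hp := h.pos _ (hξL _ hk)
    have hξi : ξ (n - 1 - i) = momentParameter L 0 n i := by
      simp only [hξ, momentParameter]
      have : ((n - 1 - i : ℕ) : ℝ) = n - 1 - i := by
        rw [Nat.sub_sub, Nat.cast_sub (by omega)]; push_cast; ring
      rw [this]
      field_simp
      ring
    rw [hmom, hmomB _ hk, mul_div_mul_left _ _ (by positivity), sub_div, div_self hp.ne', hξi]
  · refine integrable_radial ω k hκ ?_
    simp_rw [hωexp, ← mul_assoc (Real.exp _), hexp]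
    exact h.integrable _ (hξL k hk)
  · rw [hmom]
    have := h.pos _ (hξL k hk)
    positivity

theorem IsLogWeight.gibbs_norm_le {n : ℕ} {Q : ℂ → EReal} {L : ℝ} {w : ℝ → ℝ}
    (h : IsLogWeight n Q L w) {r : ℝ} (hr : 0 < r) :
    gibbs n Q {ζ | ∀ j, ‖ζ j‖ ≤ r} = ENNReal.ofReal (∏ i ∈ Finset.range n,
      (1 - (∫ t in Set.Ioi (2 * n / L * Real.log r), Real.exp (momentParameter L 0 n i * t) * w t) /
        expMoment w (momentParameter L 0 n i))) := by
  refine h.gibbs_forall_mem (B := Set.Iic r) measurableSet_Iic measurableSet_Ioi fun t => ?_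
  have hn : (0 : ℝ) < n := by exact_mod_cast h.index_pos
  have hL := h.width_pos
  rw [Set.mem_Iic, Set.mem_Ioi, not_lt, ← Real.le_log_iff_exp_le hr]
  have : L / (2 * n) * t = t / (2 * n / L) := by field_simp
  rw [this, div_le_iff₀' (by positivity)]

/-- After `t ↦ -t` the parameters change sign, and `-L((i+1)/n - 1/2)` is `momentParameter` with `θ
= 1`, already in decreasing order. -/
theorem IsLogWeight.gibbs_le_norm {n : ℕ} {Q : ℂ → EReal} {L : ℝ} {w : ℝ → ℝ}
    (h : IsLogWeight n Q L w) {r : ℝ} (hr : 0 < r) :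
    gibbs n Q {ζ | ∀ j, r ≤ ‖ζ j‖} = ENNReal.ofReal (∏ i ∈ Finset.range n,
      (1 - (∫ t in Set.Ioi (-(2 * n / L * Real.log r)),
          Real.exp (momentParameter L 1 n i * t) * w (-t)) /
        expMoment (fun t => w (-t)) (momentParameter L 1 n i))) := by
  have hn : (0 : ℝ) < n := by exact_mod_cast h.index_pos
  have hL := h.width_pos
  have h1 := h.gibbs_forall_mem (B := Set.Ici r) measurableSet_Ici
    (S := Set.Iio (2 * n / L * Real.log r)) measurableSet_Iio fun t => ?_
  · rw [show {ζ : Fin n → ℂ | ∀ j, r ≤ ‖ζ j‖} = {ζ | ∀ j, ‖ζ j‖ ∈ Set.Ici r} from rfl, h1,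
      ← Finset.prod_range_reflect]
    congr 1
    refine Finset.prod_congr rfl fun i hi => ?_
    have hi := Finset.mem_range.1 hi
    have hξi : momentParameter L 0 n (n - 1 - i) = -momentParameter L 1 n i := by
      simp only [momentParameter]
      have : ((n - 1 - i : ℕ) : ℝ) = n - 1 - i := by
        rw [Nat.sub_sub, Nat.cast_sub (by omega)]; push_cast; ring
      rw [this]
      field_simp
      ring
    rw [hξi]
    have e1 : ∀ S : Set ℝ, MeasurableSet S →
        ∫ t in S, Real.exp (-momentParameter L 1 n i * t) * w t =
        ∫ t in -S, Real.exp (momentParameter L 1 n i * t) * w (-t) := by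
      intro S hS
      rw [← integral_indicator hS, ← integral_indicator hS.neg, ← integral_neg_eq_self]
      refine integral_congr_ae (Eventually.of_forall fun t => ?_)
      change S.indicator _ (-t) = _
      by_cases ht : -t ∈ S
      · rw [Set.indicator_of_mem ht, Set.indicator_of_mem (Set.mem_neg.2 ht), neg_mul_neg]
      · rw [Set.indicator_of_notMem ht, Set.indicator_of_notMem fun h => ht (Set.mem_neg.1 h)]
    have e2 := e1 Set.univ MeasurableSet.univ
    rw [Set.neg_univ, Measure.restrict_univ] at e2
    rw [e1 _ measurableSet_Iio, Set.neg_Iio, expMoment, e2, expMoment]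
  · rw [Set.mem_Ici, Set.mem_Iio, not_lt, ← Real.log_le_iff_le_exp hr]
    have : L / (2 * n) * t = t / (2 * n / L) := by field_simp
    rw [this, le_div_iff₀' (by positivity)]

/-! ### Radial Laplacian and the profile of `Q_n` -/

theorem iteratedFDeriv_two_line {f : ℂ → ℝ} {x v : ℂ} (hf : ContDiffAt ℝ 2 f x) {φ₁ : ℝ → ℝ}
    {d : ℝ} (h1 : ∀ᶠ t in 𝓝 (0 : ℝ), HasDerivAt (fun t : ℝ => f (x + t • v)) (φ₁ t) t)
    (h2 : HasDerivAt φ₁ d 0) : iteratedFDeriv ℝ 2 f x ![v, v] = d := by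
  rw [iteratedFDeriv_two_apply]
  simp only [Matrix.cons_val_zero, Matrix.cons_val_one]
  have hline : ∀ t : ℝ, HasDerivAt (fun t : ℝ => x + t • v) v t := fun t => by
    simpa using ((hasDerivAt_id t).smul_const v).const_add x
  have hcont : Tendsto (fun t : ℝ => x + t • v) (𝓝 0) (𝓝 x) := by
    simpa using (hline 0).continuousAt.tendsto
  have hd1 : ∀ᶠ y in 𝓝 x, DifferentiableAt ℝ f y := by
    filter_upwards [hf.eventually (by simp)] with y hy
    exact hy.differentiableAt (by norm_num)
  have hd2 : DifferentiableAt ℝ (fderiv ℝ f) x :=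
    (hf.fderiv_right (m := 1) (by norm_num)).differentiableAt (by norm_num)
  have e1 : φ₁ =ᶠ[𝓝 0] fun t : ℝ => fderiv ℝ f (x + t • v) v := by
    filter_upwards [h1, hcont.eventually hd1] with t ht hdt
    exact ht.unique (hdt.hasFDerivAt.comp_hasDerivAt t (hline t))
  have hd2' : HasFDerivAt (fderiv ℝ f) (fderiv ℝ (fderiv ℝ f) x) (x + (0 : ℝ) • v) := by
    simpa using hd2.hasFDerivAt
  have e2 : HasDerivAt (fun t : ℝ => fderiv ℝ f (x + t • v)) (fderiv ℝ (fderiv ℝ f) x v) 0 :=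
    hd2'.comp_hasDerivAt (0 : ℝ) (hline 0)
  have e3 : HasDerivAt (fun t : ℝ => fderiv ℝ f (x + t • v) v)
      (fderiv ℝ (fderiv ℝ f) x v v) 0 := by
    simpa using e2.clm_apply (hasDerivAt_const (0 : ℝ) v)
  exact ((h2.congr_of_eventuallyEq e1.symm).unique e3).symm

/-- At a positive real point the direction `1` is radial and contributes `g''`. The direction `I` is
tangential; the modulus along it is `√(r² + t²)`, and it contributes `g'/r`. -/
theorem quarterLaplacian_ofReal {g g₁ g₂ : ℝ → ℝ} (hg : ContDiffOn ℝ 2 g (Set.Ioi 0))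
    (h1 : ∀ r, 0 < r → HasDerivAt g (g₁ r) r) (h2 : ∀ r, 0 < r → HasDerivAt g₁ (g₂ r) r)
    {r : ℝ} (hr : 0 < r) : quarterLaplacian g (r : ℂ) = 1 / 4 * (g₂ r + g₁ r / r) := by
  have hr0 : (r : ℂ) ≠ 0 := by exact_mod_cast hr.ne'
  have hnorm : ‖(r : ℂ)‖ = r := by simp [abs_of_pos hr]
  have hC : ContDiffAt ℝ 2 (radialPotential g) (r : ℂ) := by
    have hgr : ContDiffAt ℝ 2 g ‖(r : ℂ)‖ := by
      rw [hnorm]; exact hg.contDiffAt (Ioi_mem_nhds hr)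
    exact hgr.comp (r : ℂ) (contDiffAt_norm ℝ hr0)
  rw [quarterLaplacian, InnerProductSpace.laplacian_eq_iteratedFDeriv_complexPlane]
  congr 1
  have ha : iteratedFDeriv ℝ 2 (radialPotential g) (r : ℂ) ![1, 1] = g₂ r := by
    refine iteratedFDeriv_two_line hC (φ₁ := fun t => g₁ (r + t)) ?_ ?_
    · filter_upwards [Ioi_mem_nhds (show -r < 0 by linarith)] with t ht
      have ht : -r < t := ht
      have h3 := (h1 (r + t) (by linarith)).comp_const_add r t
      refine h3.congr_of_eventuallyEq ?_
      filter_upwards [Ioi_mem_nhds ht] with s hs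
      have hs : -r < s := hs
      rw [radialPotential]
      congr 1
      rw [Complex.real_smul, mul_one, ← Complex.ofReal_add, Complex.norm_real,
        Real.norm_of_nonneg (by linarith)]
    · have := (h2 (r + 0) (by simpa)).comp_const_add r 0
      simpa using this
  have hb : iteratedFDeriv ℝ 2 (radialPotential g) (r : ℂ) ![Complex.I, Complex.I] =
      g₁ r / r := by
    have hs0 : ∀ t : ℝ, 0 < r ^ 2 + t ^ 2 := fun t => by positivity
    have hs : ∀ t : ℝ, HasDerivAt (fun t : ℝ => √(r ^ 2 + t ^ 2)) (t / √(r ^ 2 + t ^ 2)) t := by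
      intro t
      have h3 : HasDerivAt (fun t : ℝ => r ^ 2 + t ^ 2) (2 * t) t := by
        simpa using ((hasDerivAt_id t).pow 2).const_add (r ^ 2)
      convert h3.sqrt (hs0 t).ne' using 1
      field_simp
    have hfun : (fun t : ℝ => radialPotential g ((r : ℂ) + t • Complex.I)) =
        fun t : ℝ => g √(r ^ 2 + t ^ 2) := by
      funext t
      rw [radialPotential, Complex.real_smul, Complex.norm_add_mul_I]
    refine iteratedFDeriv_two_line hC
      (φ₁ := fun t => g₁ √(r ^ 2 + t ^ 2) * (t / √(r ^ 2 + t ^ 2))) ?_ ?_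
    · rw [hfun]
      exact Eventually.of_forall fun t => (h1 _ (Real.sqrt_pos.2 (hs0 t))).comp t (hs t)
    · have h4 := ((h2 _ (Real.sqrt_pos.2 (hs0 0))).comp 0 (hs 0)).mul
        ((hasDerivAt_id (0 : ℝ)).div (hs 0) (Real.sqrt_pos.2 (hs0 0)).ne')
      have e : √(r ^ 2 + 0 ^ 2) = r := by simp [Real.sqrt_sq hr.le]
      simp only [e] at h4
      refine HasDerivAt.congr_deriv h4 ?_
      simp [Real.sqrt_sq hr.le]
      field_simp
  exact congrArg₂ (· + ·) ha hb

theorem exists_derivs {g : ℝ → ℝ} (hg : ContDiffOn ℝ 3 g (Set.Ioi 0)) :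
    (∀ r, 0 < r → HasDerivAt g (deriv g r) r) ∧
    (∀ r, 0 < r → HasDerivAt (deriv g) (deriv (deriv g) r) r) ∧
    (∀ r, 0 < r → HasDerivAt (deriv (deriv g)) (iteratedDeriv 3 g r) r) := by
  have h2 : ContDiffOn ℝ 2 (deriv g) (Set.Ioi 0) :=
    ((contDiffOn_succ_iff_deriv_of_isOpen (n := 2) isOpen_Ioi).1 (by norm_num; exact hg)).2.2
  have h3 : ContDiffOn ℝ 1 (deriv (deriv g)) (Set.Ioi 0) :=
    ((contDiffOn_succ_iff_deriv_of_isOpen (n := 1) isOpen_Ioi).1 (by norm_num; exact h2)).2.2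
  refine ⟨fun r hr => ?_, fun r hr => ?_, fun r hr => ?_⟩
  · exact ((hg.differentiableOn (by norm_num)).differentiableAt (Ioi_mem_nhds hr)).hasDerivAt
  · exact ((h2.differentiableOn (by norm_num)).differentiableAt (Ioi_mem_nhds hr)).hasDerivAt
  · have := ((h3.differentiableOn (by norm_num)).differentiableAt (Ioi_mem_nhds hr)).hasDerivAt
    rwa [iteratedDeriv_succ, iteratedDeriv_succ, iteratedDeriv_one]

theorem abs_sub_le_of_hasDerivAt {f f' : ℝ → ℝ} {K ε x r : ℝ}
    (hf : ∀ s, |s - x| ≤ ε → HasDerivAt f (f' s) s) (hK : ∀ s, |s - x| ≤ ε → |f' s| ≤ K)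
    (hr : |r - x| ≤ ε) : |f r - f x| ≤ K * |r - x| := by
  have hε : 0 ≤ ε := (abs_nonneg _).trans hr
  exact Convex.norm_image_sub_le_of_norm_hasDerivWithin_le (f := f) (f' := f')
    (s := Metric.closedBall x ε) (x := x) (y := r) (C := K)
    (fun s hs => (hf s (by simpa [Real.dist_eq] using hs)).hasDerivWithinAt)
    (fun s hs => hK s (by simpa [Real.dist_eq] using hs)) (convex_closedBall _ _)
    (by simpa using hε) (by simpa [Real.dist_eq] using hr)

/-- Lipschitz bound at `1` for the logarithmic curvature of a radial profile, from a bound on the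
third derivative. -/
theorem radial_curvature_bound {g₁ g₂ g₃ : ℝ → ℝ} {C A ε : ℝ} (hε : ε ≤ 1 / 2) (hC : 0 ≤ C)
    (hA : 1 ≤ A) (h2 : ∀ r, 0 < r → HasDerivAt g₁ (g₂ r) r) (h3 : ∀ r, 0 < r → HasDerivAt g₂ (g₃ r) r)
    (hg1 : g₁ 1 = 1) (hg2 : |g₂ 1| ≤ A) (hg3 : ∀ r, |r - 1| ≤ ε → |g₃ r| ≤ C) {r : ℝ}
    (hr : |r - 1| ≤ ε) :
    |r ^ 2 * g₂ r + r * g₁ r - (g₂ 1 + g₁ 1)| ≤ 15 * (A + C) * |r - 1| := by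
  have hpos : ∀ s : ℝ, |s - 1| ≤ ε → 0 < s ∧ s ≤ 3 / 2 := fun s hs => by
    have := abs_le.1 hs
    constructor <;> linarith
  have b2 : ∀ s, |s - 1| ≤ ε → |g₂ s| ≤ A + C := by
    intro s hs
    have := abs_sub_le_of_hasDerivAt (fun s hs => h3 s (hpos s hs).1) hg3 hs
    have h4 : C * |s - 1| ≤ C * 1 := by gcongr; linarith
    have h5 := abs_sub_abs_le_abs_sub (g₂ s) (g₂ 1)
    linarith
  have b1 : ∀ s, |s - 1| ≤ ε → |g₁ s| ≤ 2 * (A + C) := by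
    intro s hs
    have := abs_sub_le_of_hasDerivAt (fun s hs => h2 s (hpos s hs).1) b2 hs
    have h4 : (A + C) * |s - 1| ≤ (A + C) * 1 := by gcongr; linarith
    have h5 := abs_sub_abs_le_abs_sub (g₁ s) (g₁ 1)
    rw [hg1, abs_one] at h5
    rw [hg1] at this
    linarith
  have := abs_sub_le_of_hasDerivAt (f := fun r => r ^ 2 * g₂ r + r * g₁ r)
    (f' := fun r => r ^ 2 * g₃ r + 3 * r * g₂ r + g₁ r) (K := 15 * (A + C)) (x := 1)
    (fun s hs => ?_) (fun s hs => ?_) hr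
  · simpa using this
  · have e1 := ((hasDerivAt_id s).pow 2).mul (h3 s (hpos s hs).1)
    have e2 := (hasDerivAt_id s).mul (h2 s (hpos s hs).1)
    refine HasDerivAt.congr_deriv (e1.add e2) ?_
    norm_num
    ring
  · obtain ⟨k1, k2⟩ := hpos s hs
    have j1 : |s ^ 2 * g₃ s| ≤ 4 * C := by
      rw [abs_mul, abs_of_pos (by positivity)]
      exact mul_le_mul (by nlinarith) (hg3 s hs) (abs_nonneg _) (by norm_num)
    have j2 : |3 * s * g₂ s| ≤ 5 * (A + C) := by
      rw [abs_mul, abs_of_pos (by positivity)]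
      exact mul_le_mul (by linarith) (b2 s hs) (abs_nonneg _) (by norm_num)
    have j3 := b1 s hs
    have := abs_add_three (s ^ 2 * g₃ s) (3 * s * g₂ s) (g₁ s)
    linarith

/-- The potential on the logarithmic scale `t = (2 n / L) log r`, without its linear part. -/
noncomputable def logProfile (g : ℝ → ℝ) (L : ℝ) (n : ℕ) (t : ℝ) : ℝ :=
  n * g (Real.exp (L / (2 * n) * t)) - L / 2 * t

/-- The derivative of `logProfile`. -/
noncomputable def logProfileSlope (g : ℝ → ℝ) (L : ℝ) (n : ℕ) (t : ℝ) : ℝ :=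
  L / 2 * (Real.exp (L / (2 * n) * t) * deriv g (Real.exp (L / (2 * n) * t)) - 1)

/-- The second derivative of `logProfile`. -/
noncomputable def logProfileCurvature (g : ℝ → ℝ) (L : ℝ) (n : ℕ) (t : ℝ) : ℝ :=
  L ^ 2 / (4 * n) * (Real.exp (L / (2 * n) * t) ^ 2 *
    deriv (deriv g) (Real.exp (L / (2 * n) * t)) +
    Real.exp (L / (2 * n) * t) * deriv g (Real.exp (L / (2 * n) * t)))

theorem hasDerivAt_logProfile {g : ℝ → ℝ} (hg : ContDiffOn ℝ 3 g (Set.Ioi 0)) (L : ℝ) {n : ℕ}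
    (hn : 0 < n) (t : ℝ) : HasDerivAt (logProfile g L n) (logProfileSlope g L n t) t := by
  have hn' : (0 : ℝ) < n := by exact_mod_cast hn
  have h1 := ((exists_derivs hg).1 _ (Real.exp_pos (L / (2 * n) * t))).comp t
    (hasDerivAt_exp_mul (L / (2 * n)) t)
  have h2 := (h1.const_mul (n : ℝ)).sub ((hasDerivAt_id t).const_mul (L / 2))
  refine HasDerivAt.congr_deriv h2 ?_
  rw [logProfileSlope]
  field_simp

theorem hasDerivAt_logProfileSlope {g : ℝ → ℝ} (hg : ContDiffOn ℝ 3 g (Set.Ioi 0)) (L : ℝ)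
    {n : ℕ} (hn : 0 < n) (t : ℝ) :
    HasDerivAt (logProfileSlope g L n) (logProfileCurvature g L n t) t := by
  have hn' : (0 : ℝ) < n := by exact_mod_cast hn
  have h0 := hasDerivAt_exp_mul (L / (2 * n)) t
  have h1 := ((exists_derivs hg).2.1 _ (Real.exp_pos (L / (2 * n) * t))).comp t h0
  have h2 := ((h0.mul h1).sub_const 1).const_mul (L / 2)
  refine HasDerivAt.congr_deriv h2 ?_
  rw [logProfileCurvature]
  simp only [Function.comp_apply]
  field_simp
  ring

/-- The curvature of the profile is `(ρ_n²/n) r² ΔQ_n(r)`. It is nonnegative by subharmonicity,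
equals `1` at the origin by the definition of `ρ_n`, and varies slowly because the third derivative
is `O(n)`. -/
theorem IsAlmostCircular.isProfile {g : ℕ → ℝ → ℝ} {ρ : ℝ} (hg : IsAlmostCircular g ρ)
    {r₀ r₁ : ℕ → ℝ} (hr : ∀ᶠ n in atTop, IsDropletRadii (g n) (r₀ n) (r₁ n)) :
    IsProfile (fun n => logProfile (g n) (widthAt g n) n)
      (fun n => logProfileSlope (g n) (widthAt g n) n)
      (fun n => logProfileCurvature (g n) (widthAt g n) n) (widthAt g)
      (fun n => 2 * n / widthAt g n * Real.log (r₀ n))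
      (fun n => 2 * n / widthAt g n * Real.log (r₁ n)) ρ := by
  have hρ := hg.width_pos
  have hLpos : ∀ᶠ n in atTop, 0 < widthAt g n := hg.width_tendsto.eventually_const_lt hρ
  have hlap : ∀ n, 0 < n → ∀ r : ℝ, 0 < r → quarterLaplacian (g n) (r : ℂ) =
      1 / 4 * (deriv (deriv (g n)) r + deriv (g n) r / r) := fun n hn r hr =>
    quarterLaplacian_ofReal ((hg.contDiffOn n hn).of_le (by norm_num))
      (exists_derivs (hg.contDiffOn n hn)).1 (exists_derivs (hg.contDiffOn n hn)).2.1 hr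
  have hone : ∀ᶠ n in atTop, deriv (deriv (g n)) 1 + 1 = 4 * n / widthAt g n ^ 2 := by
    filter_upwards [hLpos, eventually_gt_atTop 0] with n h1 hn
    have hn' : (0 : ℝ) < n := by exact_mod_cast hn
    have h2 := hlap n hn 1 one_pos
    rw [hg.deriv_one n hn, Complex.ofReal_one, div_one] at h2
    have h3 : 0 < (n : ℝ) / quarterLaplacian (g n) 1 := Real.sqrt_pos.1 h1
    have h4 : quarterLaplacian (g n) 1 ≠ 0 := by
      intro h; rw [h, div_zero] at h3; exact lt_irrefl _ h3
    rw [widthAt, Real.sq_sqrt h3.le]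
    field_simp
    linarith
  refine ⟨hρ, hg.width_tendsto, ?_, ?_, ?_, ?_, ?_, ?_, ?_, ?_⟩
  · filter_upwards [eventually_gt_atTop 0] with n hn
    exact hasDerivAt_logProfile (hg.contDiffOn n hn) _ hn
  · filter_upwards [eventually_gt_atTop 0] with n hn
    exact hasDerivAt_logProfileSlope (hg.contDiffOn n hn) _ hn
  · filter_upwards [eventually_gt_atTop 0] with n hn
    simp [logProfile, hg.apply_one n hn]
  · filter_upwards [eventually_gt_atTop 0] with n hn
    simp [logProfileSlope, hg.deriv_one n hn]
  · filter_upwards [eventually_gt_atTop 0] with n hn t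
    have hpos := Real.exp_pos (widthAt g n / (2 * n) * t)
    set r := Real.exp (widthAt g n / (2 * n) * t) with hrdef
    have h1 := hg.subharmonic n hn (r : ℂ) (by exact_mod_cast hpos.ne')
    rw [hlap n hn r hpos] at h1
    have h2 : logProfileCurvature (g n) (widthAt g n) n t = widthAt g n ^ 2 / n * (r ^ 2 *
        (1 / 4 * (deriv (deriv (g n)) r + deriv (g n) r / r))) := by
      rw [logProfileCurvature, ← hrdef]
      field_simp
    rw [h2]
    positivity
  · obtain ⟨C, hC⟩ := hg.third_deriv_bound
    obtain ⟨ε, hε, hball⟩ := Metric.eventually_nhds_iff.1 hC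
    set η := min (ε / 2) (1 / 2) with hη
    have hη0 : 0 < η := by positivity
    set A := 4 / (ρ / 2) ^ 2 + 1 with hA
    -- With this window `|L t/(2n)| ≤ η/2`, hence `|r - 1| ≤ η`. The constant is `L²/(4n)` times
    -- `15(A + |C|) n` times `|r - 1| ≤ L|t|/n`, with `L ≤ ρ + 1`; `A n` bounds `|g''(1)|` because
    -- `L ≥ ρ/2`.
    refine ⟨(ρ + 1) ^ 3 * (15 * (A + |C|)) / 4, η / (ρ + 1), by positivity, by positivity, ?_⟩
    filter_upwards [hLpos, hone, eventually_gt_atTop 0,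
      hg.width_tendsto.eventually_le_const (show ρ < ρ + 1 by linarith),
      hg.width_tendsto.eventually_const_le (half_lt_self hρ)] with n h1 h2 hn h3 h4 t ht
    have hn' : (0 : ℝ) < n := by exact_mod_cast hn
    have hn1 : (1 : ℝ) ≤ n := by exact_mod_cast hn
    set L := widthAt g n with hL
    obtain ⟨d1, d2, d3⟩ := exists_derivs (hg.contDiffOn n hn)
    have hκt : |L / (2 * n) * t| ≤ η / 2 := by
      rw [abs_mul, abs_of_pos (by positivity)]
      calc L / (2 * n) * |t| ≤ (ρ + 1) / (2 * n) * (η / (ρ + 1) * n) := by gcongr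
        _ = η / 2 := by field_simp
    have hexp : |Real.exp (L / (2 * n) * t) - 1| ≤ 2 * |L / (2 * n) * t| := by
      refine Real.abs_exp_sub_one_le (hκt.trans ?_)
      have : η ≤ 1 / 2 := min_le_right _ _
      linarith
    have hA2 : |deriv (deriv (g n)) 1| ≤ A * n := by
      have e1 : deriv (deriv (g n)) 1 = 4 * n / L ^ 2 - 1 := by linarith
      have e2 : 4 * n / L ^ 2 ≤ 4 * n / (ρ / 2) ^ 2 := by gcongr
      have e3 : 0 ≤ 4 * n / L ^ 2 := by positivity
      rw [e1, abs_le, hA, add_mul, one_mul, div_mul_eq_mul_div]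
      constructor
      · have : 0 ≤ 4 * n / (ρ / 2) ^ 2 := by positivity
        linarith
      · linarith
    have hA1 : (1 : ℝ) ≤ A * n := by
      have : 1 ≤ A := by rw [hA]; linarith [show 0 ≤ 4 / (ρ / 2) ^ 2 by positivity]
      nlinarith
    have hb := radial_curvature_bound (ε := η) (C := |C| * n) (A := A * n) (min_le_right _ _)
      (by positivity) hA1 d2 d3 (hg.deriv_one n hn) hA2 (fun s hs => ?_)
      (r := Real.exp (L / (2 * n) * t)) (hexp.trans (by linarith))
    · have e1 : logProfileCurvature (g n) L n t - 1 = L ^ 2 / (4 * n) *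
          (Real.exp (L / (2 * n) * t) ^ 2 * deriv (deriv (g n)) (Real.exp (L / (2 * n) * t)) +
            Real.exp (L / (2 * n) * t) * deriv (g n) (Real.exp (L / (2 * n) * t)) -
            (deriv (deriv (g n)) 1 + deriv (g n) 1)) := by
        rw [logProfileCurvature, mul_sub, hg.deriv_one n hn, h2]
        field_simp
      rw [e1, abs_mul, abs_of_pos (by positivity)]
      calc _ ≤ L ^ 2 / (4 * n) * (15 * (A * n + |C| * n) * (2 * |L / (2 * n) * t|)) := by
            gcongr
            exact hb.trans (by gcongr)
        _ = L ^ 3 * (15 * (A + |C|)) / 4 * |t| / n := by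
            rw [abs_mul, abs_of_pos (show 0 < L / (2 * n) by positivity)]
            field_simp
        _ ≤ _ := by gcongr
    · refine (hball ?_ n hn).trans (by gcongr; exact le_abs_self C)
      rw [Real.dist_eq]
      have : η ≤ ε / 2 := min_le_left _ _
      linarith
  · filter_upwards [hr, hLpos, eventually_gt_atTop 0] with n h1 h2 hn
    have hn' : (0 : ℝ) < n := by exact_mod_cast hn
    have e : widthAt g n / (2 * n) * (2 * n / widthAt g n * Real.log (r₀ n)) = Real.log (r₀ n) := by
      field_simp
    simp only [logProfileSlope]
    rw [e, Real.exp_log h1.inner_pos, h1.inner_eq]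
    ring
  · filter_upwards [hr, hLpos, eventually_gt_atTop 0] with n h1 h2 hn
    have hn' : (0 : ℝ) < n := by exact_mod_cast hn
    have e : widthAt g n / (2 * n) * (2 * n / widthAt g n * Real.log (r₁ n)) = Real.log (r₁ n) := by
      field_simp
    simp only [logProfileSlope]
    rw [e, Real.exp_log h1.outer_pos, h1.outer_eq]
    ring

/-! ### Confined potentials as weights in the logarithmic coordinate -/

theorem confinedPotential_zero_ne_bot (g : ℝ → ℝ) (r₀ r₁ : ℝ) (c₁ c₂ : ℝ≥0∞) (z : ℂ) :
    confinedPotential g r₀ r₁ c₁ c₂ z ≠ ⊥ := by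
  rw [confinedPotential, confine, confine]
  split_ifs
  exacts [top_ne_bot, EReal.coe_ne_bot _, EReal.coe_ne_bot _, top_ne_bot,
    EReal.coe_ne_bot _]

theorem exp_coe_pow_inv (q : ℝ) (n : ℕ) :
    (EReal.exp (q : EReal) ^ n)⁻¹ = ENNReal.ofReal (Real.exp (-(n * q))) := by
  rw [EReal.exp_coe, ← ENNReal.ofReal_pow (Real.exp_pos _).le, ← Real.exp_nat_mul, Real.exp_neg,
    ENNReal.ofReal_inv_of_pos (Real.exp_pos _)]

theorem logProfile_log (g : ℝ → ℝ) {L : ℝ} (hL : 0 < L) {n : ℕ} (hn : 0 < n) {r : ℝ}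
    (hr : 0 < r) : logProfile g L n (2 * n / L * Real.log r) = n * g r - n * Real.log r := by
  have hn' : (0 : ℝ) < n := by exact_mod_cast hn
  have e : L / (2 * n) * (2 * n / L * Real.log r) = Real.log r := by field_simp
  rw [logProfile, e, Real.exp_log hr]
  field_simp

/-- Removing the linear part `(L/2) t = n log r` sends the constant branch of the obstacle to slope
`-L/2` and the branch `2 log r` to slope `L/2`. These are the continuations used in `softWeight`. -/
theorem confinedPotential_soft_weight (g : ℝ → ℝ) {r₀ r₁ L : ℝ} {c₁ c₂ : ℝ≥0∞} {n : ℕ}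
    (hc₁ : c₁ ≠ ∞) (hc₂ : c₂ ≠ ∞) (hr₀ : 0 < r₀) (hr₁ : 0 < r₁) (hL : 0 < L) (hn : 0 < n) {z : ℂ}
    (hz : z ≠ 0) :
    (EReal.exp (confinedPotential g r₀ r₁ c₁ c₂ z) ^ n)⁻¹ =
      ENNReal.ofReal (Real.exp (-(L / 2 * (2 * n / L * Real.log ‖z‖))) *
        softWeight (logProfile g L n) (L / 2) (2 * n / L * Real.log r₀) (2 * n / L * Real.log r₁)
          c₁.toReal c₂.toReal (2 * n / L * Real.log ‖z‖)) := by
  have hn' : (0 : ℝ) < n := by exact_mod_cast hn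
  have hz' : 0 < ‖z‖ := norm_pos_iff.2 hz
  have hk : 0 < 2 * n / L := by positivity
  have i0 : 2 * n / L * Real.log ‖z‖ < 2 * n / L * Real.log r₀ ↔ ‖z‖ < r₀ := by
    rw [mul_lt_mul_iff_right₀ hk, Real.log_lt_log_iff hz' hr₀]
  have i1 : 2 * n / L * Real.log ‖z‖ ≤ 2 * n / L * Real.log r₁ ↔ ‖z‖ ≤ r₁ := by
    rw [mul_le_mul_iff_right₀ hk, Real.log_le_log_iff hz' hr₁]
  have hlin : ∀ x : ℝ, L / 2 * (2 * n / L * x) = n * x := fun x => by field_simp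
  simp only [softWeight, i0, i1, ← Real.exp_add, ← mul_sub, hlin,
    logProfile_log g hL hn hz', logProfile_log g hL hn hr₀, logProfile_log g hL hn hr₁,
    confinedPotential, confine, hc₁, hc₂, if_false, obstacle, radialPotential]
  by_cases h0 : ‖z‖ < r₀
  · simp only [h0, if_true]
    rw [exp_coe_pow_inv]
    congr 2
    ring
  · simp only [h0, if_false]
    by_cases h1 : ‖z‖ ≤ r₁
    · simp only [h1, if_true]
      rw [exp_coe_pow_inv]
      congr 2
      ring
    · simp only [h1, if_false]
      rw [exp_coe_pow_inv]
      congr 2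
      ring

theorem confinedPotential_hard_weight (g : ℝ → ℝ) {r₀ r₁ L : ℝ} {n : ℕ}
    (hr₀ : 0 < r₀) (hr₁ : 0 < r₁) (hL : 0 < L) (hn : 0 < n) {z : ℂ} (hz : z ≠ 0) :
    (EReal.exp (confinedPotential g r₀ r₁ ∞ ∞ z) ^ n)⁻¹ =
      ENNReal.ofReal (Real.exp (-(L / 2 * (2 * n / L * Real.log ‖z‖))) *
        hardWeight (logProfile g L n) (2 * n / L * Real.log r₀) (2 * n / L * Real.log r₁)
          (2 * n / L * Real.log ‖z‖)) := by
  have hn' : (0 : ℝ) < n := by exact_mod_cast hn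
  have hz' : 0 < ‖z‖ := norm_pos_iff.2 hz
  have hk : 0 < 2 * n / L := by positivity
  have i0 : 2 * n / L * Real.log ‖z‖ < 2 * n / L * Real.log r₀ ↔ ‖z‖ < r₀ := by
    rw [mul_lt_mul_iff_right₀ hk, Real.log_lt_log_iff hz' hr₀]
  have i1 : 2 * n / L * Real.log ‖z‖ ≤ 2 * n / L * Real.log r₁ ↔ ‖z‖ ≤ r₁ := by
    rw [mul_le_mul_iff_right₀ hk, Real.log_le_log_iff hz' hr₁]
  have hlin : ∀ x : ℝ, L / 2 * (2 * n / L * x) = n * x := fun x => by field_simp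
  simp only [confinedPotential, confine, if_true, radialPotential, hardWeight, hlin]
  by_cases h0 : ‖z‖ < r₀
  · rw [if_pos h0, Set.indicator_of_notMem fun h => not_lt.2 h.1 (i0.2 h0)]
    simp [hn.ne']
  · rw [if_neg h0]
    by_cases h1 : ‖z‖ ≤ r₁
    · rw [if_pos h1, Set.indicator_of_mem
        (Set.mem_Icc.2 ⟨not_lt.1 fun h => h0 (i0.1 h), i1.2 h1⟩),
        logProfile_log g hL hn hz', exp_coe_pow_inv, ← Real.exp_add]
      congr 2
      ring
    · rw [if_neg h1, Set.indicator_of_notMem fun h => h1 (i1.1 h.2)]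
      simp [hn.ne']

theorem WeightLimit.isLogWeight {w : ℕ → ℝ → ℝ} {w' : ℝ → ℝ} (hw : WeightLimit w w') {L : ℕ → ℝ}
    {ρ : ℝ} (hρ : 0 < ρ) (hL : Tendsto L atTop (𝓝 ρ)) {Q : ℕ → ℂ → EReal}
    (h0 : ∀ n, Q n 0 ≠ ⊥)
    (hQ : ∀ᶠ n in atTop, ∀ z, z ≠ 0 → (EReal.exp (Q n z) ^ n)⁻¹ =
      ENNReal.ofReal (Real.exp (-(L n / 2 * (2 * n / L n * Real.log ‖z‖))) *
        w n (2 * n / L n * Real.log ‖z‖))) :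
    ∀ᶠ n in atTop, IsLogWeight n (Q n) (L n) (w n) := by
  obtain ⟨m, hm, hmev⟩ := hw.exists_le_expMoment (ρ + 1)
  filter_upwards [hQ, hmev, hw.meas, hw.integrable (ρ + 1), hL.eventually_const_lt hρ,
    hL.eventually_le_const (show ρ < ρ + 1 by linarith), eventually_gt_atTop 0]
    with n h1 h2 h3 h4 h5 h6 hn
  exact ⟨hn, h5, h0 n, h1, h3, hw.nonneg n, fun x hx => h4 x (hx.trans h6),
    fun x hx => hm.trans_le (h2 x (hx.trans h6))⟩

/-! ### Asymptotics of the scaling constants -/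

theorem tendsto_log_natCast : Tendsto (fun n : ℕ => Real.log n) atTop atTop :=
  Real.tendsto_log_atTop.comp tendsto_natCast_atTop_atTop

theorem tendsto_logConst_div_log {ρ c₁ c₂ ξ : ℝ} (hρ : 0 < ρ) :
    Tendsto (fun n : ℕ => logConst ρ c₁ c₂ ξ n / Real.log n) atTop (𝓝 2) := by
  have h1 : Tendsto (fun n : ℕ => Real.log (Real.log n) / Real.log n) atTop (𝓝 0) :=
    (Real.isLittleO_log_id_atTop.tendsto_div_nhds_zero).comp tendsto_log_natCast
  have h2 : Tendsto (fun n : ℕ => (2 * Real.log ρ + 2 * Real.log (2 * Phi ρ c₁ c₂ ξ)) /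
      Real.log n) atTop (𝓝 0) := tendsto_log_natCast.const_div_atTop _
  have h3 : Tendsto (fun n : ℕ => 2 - 2 * (Real.log (Real.log n) / Real.log n) -
      (2 * Real.log ρ + 2 * Real.log (2 * Phi ρ c₁ c₂ ξ)) / Real.log n) atTop (𝓝 2) := by
    simpa using ((h1.const_mul 2).const_sub 2).sub h2
  refine h3.congr' ?_
  filter_upwards [tendsto_log_natCast.eventually_gt_atTop 0, eventually_gt_atTop 0] with n hn hn0
  have hn' : (0 : ℝ) < n := by exact_mod_cast hn0
  rw [logConst, Real.log_div hn'.ne' hρ.ne']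
  field_simp
  ring

theorem exp_neg_half_logConst {ρ c₁ c₂ ξ : ℝ} (hρ : 0 < ρ) (hΦ : 0 < Phi ρ c₁ c₂ ξ) :
    ∀ᶠ n : ℕ in atTop, Real.exp (-(logConst ρ c₁ c₂ ξ n / 2)) =
      ρ / n * Real.log n * (2 * Phi ρ c₁ c₂ ξ) := by
  filter_upwards [tendsto_log_natCast.eventually_gt_atTop 0, eventually_gt_atTop 0] with n hn hn0
  have hn' : (0 : ℝ) < n := by exact_mod_cast hn0
  have e : -(logConst ρ c₁ c₂ ξ n / 2) = -Real.log (n / ρ) + Real.log (Real.log n) +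
      Real.log (2 * Phi ρ c₁ c₂ ξ) := by rw [logConst]; ring
  rw [e, Real.exp_add, Real.exp_add, Real.exp_neg, Real.exp_log (by positivity),
    Real.exp_log hn, Real.exp_log (by positivity), inv_div]

theorem abs_log_one_add_sub_le {z : ℝ} (hz : |z| ≤ 1 / 2) : |Real.log (1 + z) - z| ≤ 2 * z ^ 2 := by
  have h := abs_le.1 hz
  have h1 : 0 < 1 + z := by linarith
  have h2 := Real.log_le_sub_one_of_pos h1
  have h3 := Real.one_sub_inv_le_log_of_pos h1
  have h4 : z - 2 * z ^ 2 ≤ 1 - (1 + z)⁻¹ := by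
    have : 1 - (1 + z)⁻¹ = z / (1 + z) := by field_simp; ring
    rw [this, le_div_iff₀ h1]
    nlinarith [sq_nonneg z, mul_nonneg (sq_nonneg z) (by linarith : 0 ≤ 1 + 2 * z)]
  rw [abs_le]
  constructor <;> nlinarith [sq_nonneg z]

/-- For the exact shift, `c U²/2 = q/2 + x + x²/(2q)`. A perturbation of size `o(1/√q)` changes the
left side by `o(1)`, since `U` has order `√q`. -/
theorem tendsto_of_shift {q U : ℕ → ℝ} {c x : ℝ} (hc : 0 < c) (hq : Tendsto q atTop atTop)
    (hU : Tendsto (fun n => √(q n) * (U n - (√(q n / c) + x / √(c * q n)))) atTop (𝓝 0)) :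
    Tendsto (fun n => c * U n ^ 2 / 2 - q n / 2) atTop (𝓝 x) ∧
      Tendsto (fun n => c * U n ^ 2 / q n) atTop (𝓝 1) ∧ Tendsto U atTop atTop := by
  have hsc : 0 < √c := Real.sqrt_pos.2 hc
  have hqi : Tendsto (fun n => (q n)⁻¹) atTop (𝓝 0) := hq.inv_tendsto_atTop
  have hV : Tendsto (fun n => U n / √(q n)) atTop (𝓝 (√c)⁻¹) := by
    have h1 : Tendsto (fun n => √(q n) * (U n - (√(q n / c) + x / √(c * q n))) * (q n)⁻¹ +
        ((√c)⁻¹ + x * (√c)⁻¹ * (q n)⁻¹)) atTop (𝓝 (√c)⁻¹) := by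
      simpa using (hU.mul hqi).add ((hqi.const_mul (x * (√c)⁻¹)).const_add (√c)⁻¹)
    refine h1.congr' ?_
    filter_upwards [hq.eventually_gt_atTop 0] with n hn
    have hsq := Real.sqrt_pos.2 hn
    rw [Real.sqrt_div hn.le, Real.sqrt_mul hc.le]
    have : q n = √(q n) ^ 2 := (Real.sq_sqrt hn.le).symm
    generalize √(q n) = y at *
    rw [this]
    field_simp
    ring
  have hratio : Tendsto (fun n => c * U n ^ 2 / q n) atTop (𝓝 1) := by
    have h1 := (hV.pow 2).const_mul c
    have e : c * (√c)⁻¹ ^ 2 = 1 := by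
      rw [inv_pow, Real.sq_sqrt hc.le, mul_inv_cancel₀ hc.ne']
    rw [e] at h1
    refine h1.congr' ?_
    filter_upwards [hq.eventually_gt_atTop 0] with n hn
    rw [div_pow, Real.sq_sqrt hn.le, mul_div_assoc]
  refine ⟨?_, hratio, ?_⟩
  · have h1 : Tendsto (fun n => c / 2 * (√(q n) * (U n - (√(q n / c) + x / √(c * q n)))) *
        (U n / √(q n) + (√c)⁻¹ + x * (√c)⁻¹ * (q n)⁻¹) + x + x ^ 2 / 2 * (q n)⁻¹) atTop (𝓝 x) := by
      have h2 := (hV.add_const (√c)⁻¹).add (hqi.const_mul (x * (√c)⁻¹))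
      simpa using (((hU.const_mul (c / 2)).mul h2).add_const x).add (hqi.const_mul (x ^ 2 / 2))
    refine h1.congr' ?_
    filter_upwards [hq.eventually_gt_atTop 0] with n hn
    have hsq := Real.sqrt_pos.2 hn
    rw [Real.sqrt_div hn.le, Real.sqrt_mul hc.le]
    have e1 : q n = √(q n) ^ 2 := (Real.sq_sqrt hn.le).symm
    have e2 : c = √c ^ 2 := (Real.sq_sqrt hc.le).symm
    generalize √(q n) = y at *
    generalize √c = d at *
    rw [e1, e2]
    field_simp
    ring
  · have h1 : Tendsto (fun n => U n / √(q n) * √(q n)) atTop atTop :=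
      hV.pos_mul_atTop (inv_pos.2 hsc) (Real.tendsto_sqrt_atTop.comp hq)
    refine h1.congr' ?_
    filter_upwards [hq.eventually_gt_atTop 0] with n hn
    have hsq := Real.sqrt_pos.2 hn
    field_simp

/-- The sign `σ` covers both edges. In logarithmic coordinates the displacement is `√(q/c) +
x/√(cq)` up to three errors: the second order of the logarithm, `1/r - 1 = O(1/n)`, and `s/L - 1`.
Each must be negligible after multiplication by `q`; for the last this is `hqs`. -/
theorem tendsto_gumbel_scale {L s r q : ℕ → ℝ} {ρ c x τ Φ σ : ℝ} (hρ : 0 < ρ) (hc : 0 < c)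
    (hσ : σ = 1 ∨ σ = -1) (hL : Tendsto L atTop (𝓝 ρ)) (hs : Tendsto s atTop (𝓝 ρ))
    (hr : ∀ᶠ n in atTop, 0 < r n)
    (hrτ : Tendsto (fun n => 2 * n / L n * Real.log (r n)) atTop (𝓝 τ))
    (hqlog : Tendsto (fun n : ℕ => q n / Real.log n) atTop (𝓝 2))
    (hqexp : ∀ᶠ n : ℕ in atTop, Real.exp (-(q n / 2)) = ρ / n * Real.log n * (2 * Φ))
    (hqs : Tendsto (fun n => q n * (s n / L n - 1)) atTop (𝓝 0)) {R U : ℕ → ℝ}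
    (hR : ∀ n, R n = r n + σ * (s n / (2 * n) * (√(q n / c) + x / √(c * q n))))
    (hU : ∀ n, U n = σ * (2 * n / L n * (Real.log (R n) - Real.log (r n)))) :
    (∀ᶠ n in atTop, 0 < q n ∧ 0 < R n) ∧ Tendsto U atTop atTop ∧
      Tendsto (fun n => U n ^ 3 / n) atTop (𝓝 0) ∧
      Tendsto (fun n => n / L n * (Real.exp (-(c * U n ^ 2 / 2)) / (c * U n ^ 2))) atTop
        (𝓝 (Φ * Real.exp (-x))) := by
  have hσ2 : σ ^ 2 = 1 := by rcases hσ with h | h <;> simp [h]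
  have hsc : 0 < √c := Real.sqrt_pos.2 hc
  have hlog := tendsto_log_natCast
  have hq : Tendsto q atTop atTop := by
    refine (hqlog.pos_mul_atTop two_pos hlog).congr' ?_
    filter_upwards [hlog.eventually_gt_atTop 0] with n hn
    field_simp
  have hqi : Tendsto (fun n => (q n)⁻¹) atTop (𝓝 0) := hq.inv_tendsto_atTop
  have hsqi : Tendsto (fun n => (√(q n))⁻¹) atTop (𝓝 0) :=
    (Real.tendsto_sqrt_atTop.comp hq).inv_tendsto_atTop
  have hlogn : Tendsto (fun n : ℕ => Real.log n ^ 2 / n) atTop (𝓝 0) :=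
    ((Real.isLittleO_pow_log_id_atTop (n := 2)).tendsto_div_nhds_zero).comp tendsto_natCast_atTop_atTop
  have hq2n : Tendsto (fun n => q n ^ 2 / n) atTop (𝓝 0) := by
    have h1 := (hqlog.pow 2).mul hlogn
    rw [mul_zero] at h1
    refine h1.congr' ?_
    filter_upwards [hlog.eventually_gt_atTop 0] with n hn
    field_simp
  have hqn : Tendsto (fun n => q n / n) atTop (𝓝 0) := by
    have h1 := hq2n.mul hqi
    rw [mul_zero] at h1
    refine h1.congr' ?_
    filter_upwards [hq.eventually_gt_atTop 0] with n hn
    field_simp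
  -- the radius tends to one at rate `1 / n`
  have hlogr : Tendsto (fun n => Real.log (r n)) atTop (𝓝 0) := by
    have h1 := (hrτ.mul (hL.div_const 2)).mul (tendsto_inv_atTop_nhds_zero_nat (𝕜 := ℝ))
    rw [mul_zero] at h1
    refine h1.congr' ?_
    filter_upwards [hL.eventually_const_lt hρ, eventually_gt_atTop 0] with n h2 hn
    have hn' : (0 : ℝ) < n := by exact_mod_cast hn
    field_simp
  have hqlogr : Tendsto (fun n => q n * Real.log (r n)) atTop (𝓝 0) := by
    have h1 := (hrτ.mul (hL.div_const 2)).mul hqn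
    rw [mul_zero] at h1
    refine h1.congr' ?_
    filter_upwards [hL.eventually_const_lt hρ, eventually_gt_atTop 0] with n h2 hn
    have hn' : (0 : ℝ) < n := by exact_mod_cast hn
    field_simp
  have hr1 : Tendsto r atTop (𝓝 1) := by
    have h1 := (Real.continuous_exp.tendsto 0).comp hlogr
    rw [Real.exp_zero] at h1
    exact h1.congr' (hr.mono fun n hn => Real.exp_log hn)
  have hqr : Tendsto (fun n => q n * ((r n)⁻¹ - 1)) atTop (𝓝 0) := by
    have h1 : Tendsto (fun n => 2 * |q n * Real.log (r n)|) atTop (𝓝 0) := by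
      simpa using hqlogr.abs.const_mul 2
    refine squeeze_zero_norm' ?_ h1
    have habs : ∀ᶠ n in atTop, |Real.log (r n)| ≤ 1 := by
      have := hlogr.abs
      rw [abs_zero] at this
      exact this.eventually_le_const one_pos
    filter_upwards [habs, hr] with n h2 h3
    have h4 : (r n)⁻¹ = Real.exp (-Real.log (r n)) := by rw [Real.exp_neg, Real.exp_log h3]
    have h5 := Real.abs_exp_sub_one_le (x := -Real.log (r n)) (by rwa [abs_neg])
    rw [abs_neg] at h5
    rw [Real.norm_eq_abs, abs_mul, abs_mul, h4]
    nlinarith [abs_nonneg (q n)]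
  -- the shift
  let Y : ℕ → ℝ := fun n => √(q n / c) + x / √(c * q n)
  let z : ℕ → ℝ := fun n => σ * (s n / (2 * n * r n) * Y n)
  have hY : Tendsto (fun n => Y n / √(q n)) atTop (𝓝 (√c)⁻¹) := by
    have h1 : Tendsto (fun n => (√c)⁻¹ + x * (√c)⁻¹ * (q n)⁻¹) atTop (𝓝 (√c)⁻¹) := by
      simpa using (hqi.const_mul (x * (√c)⁻¹)).const_add (√c)⁻¹
    refine h1.congr' ?_
    filter_upwards [hq.eventually_gt_atTop 0] with n hn
    have hsq := Real.sqrt_pos.2 hn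
    simp only [Y]
    rw [Real.sqrt_div hn.le, Real.sqrt_mul hc.le]
    have : q n = √(q n) ^ 2 := (Real.sq_sqrt hn.le).symm
    generalize √(q n) = y at *
    rw [this]
    field_simp
  have hz : Tendsto z atTop (𝓝 0) := by
    have h1 := ((((hs.div_const 2).div hr1 one_ne_zero).mul hY).mul (hqn.mul hsqi)).const_mul σ
    simp only [mul_zero] at h1
    refine h1.congr' ?_
    filter_upwards [hq.eventually_gt_atTop 0, hr, eventually_gt_atTop 0] with n h2 h3 hn
    have hn' : (0 : ℝ) < n := by exact_mod_cast hn
    have hsq := Real.sqrt_pos.2 h2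
    simp only [z, Pi.div_apply]
    generalize Y n = Yn
    have : q n = √(q n) ^ 2 := (Real.sq_sqrt h2.le).symm
    generalize √(q n) = y at *
    rw [this]
    field_simp
  have hnz : Tendsto (fun n => √(q n) * (2 * n / L n * (2 * z n ^ 2))) atTop (𝓝 0) := by
    have h1 := (((hs.pow 2).div (hL.mul (hr1.pow 2)) (by positivity)).mul (hY.pow 2)).mul
      (hq2n.mul hsqi)
    simp only [mul_zero] at h1
    refine h1.congr' ?_
    filter_upwards [hq.eventually_gt_atTop 0, hr, eventually_gt_atTop 0,
      hL.eventually_const_lt hρ] with n h2 h3 hn h4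
    have hn' : (0 : ℝ) < n := by exact_mod_cast hn
    have hsq := Real.sqrt_pos.2 h2
    simp only [z, Pi.div_apply, mul_pow, hσ2]
    generalize Y n = Yn
    have : q n = √(q n) ^ 2 := (Real.sq_sqrt h2.le).symm
    generalize √(q n) = y at *
    rw [this]
    field_simp
  have hRz : ∀ᶠ n in atTop, R n = r n * (1 + z n) := by
    filter_upwards [hr, eventually_gt_atTop 0] with n h3 hn
    have hn' : (0 : ℝ) < n := by exact_mod_cast hn
    rw [hR]
    simp only [z, Y]
    field_simp
  have hzhalf : ∀ᶠ n in atTop, |z n| ≤ 1 / 2 := by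
    have := hz.abs
    rw [abs_zero] at this
    exact this.eventually_le_const one_half_pos
  have hlogR : ∀ᶠ n in atTop, U n = σ * (2 * n / L n * Real.log (1 + z n)) := by
    filter_upwards [hRz, hr, hzhalf] with n h1 h2 h3
    have h4 : 0 < 1 + z n := by linarith [(abs_le.1 h3).1]
    rw [hU, h1, Real.log_mul h2.ne' h4.ne', add_sub_cancel_left]
  have hshift : Tendsto (fun n => √(q n) * (U n - (√(q n / c) + x / √(c * q n)))) atTop (𝓝 0) := by
    have h1 : Tendsto (fun n => √(q n) * (σ * (2 * n / L n * (Real.log (1 + z n) - z n)))) atTop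
        (𝓝 0) := by
      refine squeeze_zero_norm' ?_ hnz
      filter_upwards [hzhalf, hL.eventually_const_lt hρ] with n h2 h3
      have h4 := abs_log_one_add_sub_le h2
      have h5 : |σ| = 1 := by rcases hσ with h | h <;> simp [h]
      rw [Real.norm_eq_abs, abs_mul, abs_mul, abs_mul, h5, one_mul, abs_of_nonneg (Real.sqrt_nonneg _),
        abs_of_nonneg (show 0 ≤ 2 * n / L n by positivity)]
      gcongr
    -- First-order error, split as `s/(L r) - 1 = (s/L)(1/r - 1) + (s/L - 1)`; `Y/√q` stays bounded.
    have h2 : Tendsto (fun n => ((s n / L n) * (q n * ((r n)⁻¹ - 1)) + q n * (s n / L n - 1)) *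
        (Y n / √(q n))) atTop (𝓝 0) := by
      simpa using ((((hs.div hL hρ.ne')).mul hqr).add hqs).mul hY
    have h3 := h1.add h2
    rw [add_zero] at h3
    refine h3.congr' ?_
    filter_upwards [hlogR, hq.eventually_gt_atTop 0, hr, eventually_gt_atTop 0,
      hL.eventually_const_lt hρ] with n h4 h5 h6 hn h7
    have hn' : (0 : ℝ) < n := by exact_mod_cast hn
    have hsq := Real.sqrt_pos.2 h5
    change _ = √(q n) * (U n - Y n)
    rw [h4]
    have e1 : σ * (2 * n / L n * z n) = s n / (L n * r n) * Y n := by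
      have : σ * (2 * n / L n * z n) = σ ^ 2 * (s n / (L n * r n) * Y n) := by
        simp only [z]; field_simp
      rw [this, hσ2, one_mul]
    have e2 : √(q n) * (σ * (2 * n / L n * (Real.log (1 + z n) - z n))) =
        √(q n) * (σ * (2 * n / L n * Real.log (1 + z n))) - √(q n) * (s n / (L n * r n) * Y n) := by
      rw [← e1]; ring
    rw [e2]
    generalize Y n = Yn
    generalize σ * (2 * n / L n * Real.log (1 + z n)) = w
    have : q n = √(q n) ^ 2 := (Real.sq_sqrt h5.le).symm
    generalize √(q n) = y at *
    rw [this]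
    field_simp
    ring
  obtain ⟨k1, k2, k3⟩ := tendsto_of_shift hc hq hshift
  refine ⟨?_, k3, ?_, ?_⟩
  · filter_upwards [hq.eventually_gt_atTop 0, hRz, hr, hzhalf] with n h1 h2 h3 h4
    refine ⟨h1, ?_⟩
    rw [h2]
    exact mul_pos h3 (by linarith [(abs_le.1 h4).1])
  · have h1 := ((k2.pow 2).mul hq2n).const_mul (c ^ 2)⁻¹
    simp only [mul_zero] at h1
    refine squeeze_zero' ((k3.eventually_ge_atTop 0).mono fun n hn => by positivity) ?_ h1
    filter_upwards [k3.eventually_ge_atTop 1, hq.eventually_gt_atTop 0] with n h2 h3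
    have e : (c ^ 2)⁻¹ * ((c * U n ^ 2 / q n) ^ 2 * (q n ^ 2 / n)) = U n ^ 4 / n := by
      field_simp
    rw [e]
    gcongr
    norm_num
  -- The `log n` in `e^{-q/2}` cancels the Gaussian tail denominator `c U² ~ q ~ 2 log n`. This `2`
  -- is the reason for `2Φ` in the scaling constants.
  · have h1 : Tendsto (fun n => ρ / L n * (2 * Φ) * (q n / Real.log n)⁻¹ * (c * U n ^ 2 / q n)⁻¹ *
        Real.exp (-(c * U n ^ 2 / 2 - q n / 2))) atTop
        (𝓝 (ρ / ρ * (2 * Φ) * 2⁻¹ * 1⁻¹ * Real.exp (-x))) :=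
      (((((tendsto_const_nhds (x := ρ)).div hL hρ.ne').mul_const (2 * Φ)).mul
        (hqlog.inv₀ two_ne_zero)).mul (k2.inv₀ one_ne_zero)).mul
        ((Real.continuous_exp.tendsto _).comp k1.neg)
    have e : ρ / ρ * (2 * Φ) * 2⁻¹ * 1⁻¹ * Real.exp (-x) = Φ * Real.exp (-x) := by
      rw [div_self hρ.ne']; ring
    rw [e] at h1
    refine h1.congr' ?_
    filter_upwards [hqexp, hlog.eventually_gt_atTop 0, hq.eventually_gt_atTop 0,
      k3.eventually_gt_atTop 0, eventually_gt_atTop 0, hL.eventually_const_lt hρ]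
      with n h2 h3 h4 h5 hn h6
    have hn' : (0 : ℝ) < n := by exact_mod_cast hn
    have e1 : Real.exp (-(c * U n ^ 2 / 2)) = ρ / n * Real.log n * (2 * Φ) *
        Real.exp (-(c * U n ^ 2 / 2 - q n / 2)) := by
      rw [← h2, ← Real.exp_add]; ring_nf
    rw [e1]
    field_simp

/-! ### Events for the extreme moduli -/

theorem maxModulus_le_iff {n : ℕ} (hn : 0 < n) (ζ : Fin n → ℂ) (r : ℝ) :
    maxModulus ζ ≤ r ↔ ∀ j, ‖ζ j‖ ≤ r := by
  have : Nonempty (Fin n) := ⟨⟨0, hn⟩⟩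
  exact ciSup_le_iff (Set.finite_range _).bddAbove

theorem le_minModulus_iff {n : ℕ} (hn : 0 < n) (ζ : Fin n → ℂ) (r : ℝ) :
    r ≤ minModulus ζ ↔ ∀ j, r ≤ ‖ζ j‖ := by
  have : Nonempty (Fin n) := ⟨⟨0, hn⟩⟩
  exact le_ciInf_iff (Set.finite_range _).bddBelow

/-- The factor `1` is the sign `σ`, kept so that the radius has the form required by
`tendsto_gumbel_scale`. -/
theorem omegaSoft_le_iff {s ρ c₁ c₂ r₁ x : ℝ} {n : ℕ} (hn : 0 < n) (hs : 0 < s) (hc : 0 < c₂)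
    (hq : 0 < logConst ρ c₁ c₂ (ρ / 2) n) (ζ : Fin n → ℂ) :
    omegaSoft s ρ c₁ c₂ r₁ n ζ ≤ x ↔ ∀ j, ‖ζ j‖ ≤ r₁ + 1 * (s / (2 * n) *
      (√(logConst ρ c₁ c₂ (ρ / 2) n / c₂) + x / √(c₂ * logConst ρ c₁ c₂ (ρ / 2) n))) := by
  have hn' : (0 : ℝ) < n := by exact_mod_cast hn
  have ha : 0 < √(c₂ * logConst ρ c₁ c₂ (ρ / 2) n) := Real.sqrt_pos.2 (mul_pos hc hq)
  rw [← maxModulus_le_iff hn, omegaSoft, ← le_div_iff₀' (by positivity), sub_le_iff_le_add]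
  have : x / (2 * n / s * √(c₂ * logConst ρ c₁ c₂ (ρ / 2) n)) =
      s / (2 * n) * (x / √(c₂ * logConst ρ c₁ c₂ (ρ / 2) n)) := by field_simp
  rw [this]
  ring_nf

theorem uSoft_le_iff {s ρ c₁ c₂ r₀ x : ℝ} {n : ℕ} (hn : 0 < n) (hs : 0 < s) (hc : 0 < c₁)
    (hq : 0 < logConst ρ c₁ c₂ (-(ρ / 2)) n) (ζ : Fin n → ℂ) :
    uSoft s ρ c₁ c₂ r₀ n ζ ≤ x ↔ ∀ j, r₀ + -1 * (s / (2 * n) *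
      (√(logConst ρ c₁ c₂ (-(ρ / 2)) n / c₁) + x / √(c₁ * logConst ρ c₁ c₂ (-(ρ / 2)) n))) ≤
        ‖ζ j‖ := by
  have hn' : (0 : ℝ) < n := by exact_mod_cast hn
  have ha : 0 < √(c₁ * logConst ρ c₁ c₂ (-(ρ / 2)) n) := Real.sqrt_pos.2 (mul_pos hc hq)
  rw [← le_minModulus_iff hn, uSoft, ← le_div_iff₀' (by positivity), sub_le_comm]
  have : x / (2 * n / s * √(c₁ * logConst ρ c₁ c₂ (-(ρ / 2)) n)) =
      s / (2 * n) * (x / √(c₁ * logConst ρ c₁ c₂ (-(ρ / 2)) n)) := by field_simp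
  rw [this]
  ring_nf

theorem omegaHard_le_iff {ρ r₁ x : ℝ} {n : ℕ} (hn : 0 < n) (hρ : 0 < ρ) (ζ : Fin n → ℂ) :
    omegaHard ρ r₁ n ζ ≤ x ↔ ∀ j, ‖ζ j‖ ≤
      r₁ + 1 * (ρ ^ 2 * x / (2 * softHardOnePoint ρ ((ρ / 4 : ℝ) : ℂ) * n ^ 2)) := by
  have hn' : (0 : ℝ) < n := by exact_mod_cast hn
  have hc := softHardOnePoint_edge_pos hρ
  rw [← maxModulus_le_iff hn, omegaHard, ← le_div_iff₀' (by positivity), sub_le_iff_le_add']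
  have : x / (2 * softHardOnePoint ρ ((ρ / 4 : ℝ) : ℂ) * n ^ 2 / ρ ^ 2) =
      ρ ^ 2 * x / (2 * softHardOnePoint ρ ((ρ / 4 : ℝ) : ℂ) * n ^ 2) := by field_simp
  rw [this, one_mul]

theorem uHard_le_iff {ρ r₀ x : ℝ} {n : ℕ} (hn : 0 < n) (hρ : 0 < ρ) (ζ : Fin n → ℂ) :
    uHard ρ r₀ n ζ ≤ x ↔ ∀ j,
      r₀ + -1 * (ρ ^ 2 * x / (2 * softHardOnePoint ρ ((ρ / 4 : ℝ) : ℂ) * n ^ 2)) ≤ ‖ζ j‖ := by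
  have hn' : (0 : ℝ) < n := by exact_mod_cast hn
  have hc := softHardOnePoint_edge_pos hρ
  rw [← le_minModulus_iff hn, uHard, softHardOnePoint_neg_edge hρ,
    ← le_div_iff₀' (by positivity), sub_le_comm]
  have : x / (2 * softHardOnePoint ρ ((ρ / 4 : ℝ) : ℂ) * n ^ 2 / ρ ^ 2) =
      ρ ^ 2 * x / (2 * softHardOnePoint ρ ((ρ / 4 : ℝ) : ℂ) * n ^ 2) := by field_simp
  rw [this, neg_one_mul, sub_eq_add_neg]

/-- The scaling `R = r + σ ρ² x / (c n²)` in logarithmic coordinates. -/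
theorem tendsto_exponential_scale {L r : ℕ → ℝ} {ρ c x τ σ : ℝ} (hρ : 0 < ρ) (hc : 0 < c)
    (hx : x ≤ 0) (hσ : σ = 1 ∨ σ = -1) (hL : Tendsto L atTop (𝓝 ρ)) (hr : ∀ᶠ n in atTop, 0 < r n)
    (hrτ : Tendsto (fun n => 2 * n / L n * Real.log (r n)) atTop (𝓝 τ)) {R U : ℕ → ℝ}
    (hR : ∀ n : ℕ, R n = r n + σ * (ρ ^ 2 * x / (c * n ^ 2)))
    (hU : ∀ n, U n = -(σ * (2 * n / L n * (Real.log (R n) - Real.log (r n))))) :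
    (∀ᶠ n in atTop, 0 < R n) ∧ (∀ᶠ n in atTop, 0 ≤ U n) ∧
      Tendsto (fun n => n * U n) atTop (𝓝 (-(2 * ρ * x / c))) := by
  have hLpos : ∀ᶠ n in atTop, 0 < L n := hL.eventually_const_lt hρ
  have hσ2 : σ ^ 2 = 1 := by rcases hσ with h | h <;> simp [h]
  have hr1 : Tendsto r atTop (𝓝 1) := by
    have h1 : Tendsto (fun n : ℕ => 2 * n / L n * Real.log (r n) * (L n / 2 * (n : ℝ)⁻¹)) atTop
        (𝓝 (τ * (ρ / 2 * 0))) :=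
      hrτ.mul ((hL.div_const 2).mul (tendsto_inv_atTop_nhds_zero_nat (𝕜 := ℝ)))
    have h2 := (Real.continuous_exp.tendsto _).comp h1
    simp only [mul_zero, Real.exp_zero] at h2
    refine h2.congr' ?_
    filter_upwards [hr, hLpos, eventually_gt_atTop 0] with n h3 h4 h5
    have h5' : (0 : ℝ) < n := by exact_mod_cast h5
    have : 2 * n / L n * Real.log (r n) * (L n / 2 * (n : ℝ)⁻¹) = Real.log (r n) := by field_simp
    rw [Function.comp_apply, this, Real.exp_log h3]
  -- Relative displacement, of order `n⁻²`, so `log(1 + z)` may be replaced by `z` even after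
  -- multiplication by `n²`.
  set z : ℕ → ℝ := fun n => σ * (ρ ^ 2 * x / (c * n ^ 2)) / r n with hz
  have hnz : Tendsto (fun n : ℕ => (n : ℝ) ^ 2 * z n) atTop (𝓝 (σ * (ρ ^ 2 * x / c))) := by
    have h1 := (tendsto_const_nhds (x := σ * (ρ ^ 2 * x / c))).div hr1 one_ne_zero
    rw [div_one] at h1
    refine h1.congr' ?_
    filter_upwards [eventually_gt_atTop 0] with n h5
    have h5' : (0 : ℝ) < n := by exact_mod_cast h5
    simp only [hz, Pi.div_apply]
    field_simp
  have hni : Tendsto (fun n : ℕ => ((n : ℝ) ^ 2)⁻¹) atTop (𝓝 0) := by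
    simpa using (tendsto_inv_atTop_nhds_zero_nat (𝕜 := ℝ)).pow 2
  have hz0 : Tendsto z atTop (𝓝 0) := by
    have h1 := hni.mul hnz
    rw [zero_mul] at h1
    refine h1.congr' ?_
    filter_upwards [eventually_gt_atTop 0] with n h5
    have h5' : (0 : ℝ) < n := by exact_mod_cast h5
    field_simp
  have hzhalf : ∀ᶠ n in atTop, |z n| ≤ 1 / 2 := by
    have := hz0.abs
    rw [abs_zero] at this
    exact this.eventually_le_const (by norm_num)
  have hRz : ∀ᶠ n in atTop, R n = r n * (1 + z n) := by
    filter_upwards [hr] with n h1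
    rw [hR]
    simp only [hz]
    field_simp
  have hlog : ∀ᶠ n in atTop, Real.log (R n) - Real.log (r n) = Real.log (1 + z n) := by
    filter_upwards [hr, hRz, hzhalf] with n h1 h2 h3
    rw [h2, Real.log_mul h1.ne' (by linarith [(abs_le.1 h3).1]), add_sub_cancel_left]
  refine ⟨?_, ?_, ?_⟩
  · filter_upwards [hRz, hr, hzhalf] with n h1 h2 h3
    rw [h1]
    exact mul_pos h2 (by linarith [(abs_le.1 h3).1])
  · filter_upwards [hlog, hr, hzhalf, hLpos] with n h1 h2 h3 h4
    rw [hU, h1]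
    have h5 : ρ ^ 2 * x / (c * (n : ℝ) ^ 2) ≤ 0 :=
      div_nonpos_of_nonpos_of_nonneg (mul_nonpos_of_nonneg_of_nonpos (by positivity) hx)
        (by positivity)
    have h6 : 0 ≤ 2 * (n : ℝ) / L n := by positivity
    rcases hσ with h | h
    · have : z n ≤ 0 := by
        simp only [hz, h, one_mul]
        exact div_nonpos_of_nonpos_of_nonneg h5 h2.le
      have h7 : Real.log (1 + z n) ≤ 0 :=
        Real.log_nonpos (by linarith [(abs_le.1 h3).1]) (by linarith)
      rw [h, one_mul]
      exact neg_nonneg.2 (mul_nonpos_of_nonneg_of_nonpos h6 h7)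
    · have : 0 ≤ z n := by
        simp only [hz, h, neg_one_mul]
        exact div_nonneg (neg_nonneg.2 h5) h2.le
      have h7 : 0 ≤ Real.log (1 + z n) := Real.log_nonneg (by linarith)
      rw [h, neg_one_mul, neg_neg]
      exact mul_nonneg h6 h7
  · have h1 : Tendsto (fun n : ℕ => (n : ℝ) ^ 2 * Real.log (1 + z n)) atTop
        (𝓝 (σ * (ρ ^ 2 * x / c))) := by
      have h2 : Tendsto (fun n : ℕ => (n : ℝ) ^ 2 * (Real.log (1 + z n) - z n)) atTop (𝓝 0) := by
        have h3 : Tendsto (fun n : ℕ => 2 * ((n : ℝ) ^ 2 * z n * z n)) atTop (𝓝 0) := by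
          simpa using (hnz.mul hz0).const_mul 2
        refine squeeze_zero_norm' ?_ h3
        filter_upwards [hzhalf] with n h4
        rw [Real.norm_eq_abs, abs_mul, abs_of_nonneg (by positivity : (0 : ℝ) ≤ (n : ℝ) ^ 2)]
        calc (n : ℝ) ^ 2 * |Real.log (1 + z n) - z n| ≤ (n : ℝ) ^ 2 * (2 * z n ^ 2) := by
              gcongr
              exact abs_log_one_add_sub_le h4
          _ = _ := by ring
      have h3 := h2.add hnz
      rw [zero_add] at h3
      refine h3.congr fun n => ?_
      ring
    have h2 := ((tendsto_const_nhds (x := -(2 * σ))).div hL hρ.ne').mul h1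
    have e : -(2 * σ) / ρ * (σ * (ρ ^ 2 * x / c)) = -(2 * ρ * x / c) := by
      have : -(2 * σ) / ρ * (σ * (ρ ^ 2 * x / c)) = -(2 * σ ^ 2 * ρ * x / c) := by field_simp
      rw [this, hσ2, mul_one]
    rw [e] at h2
    refine h2.congr' ?_
    filter_upwards [hlog, hLpos] with n h3 h4
    rw [hU, h3, Pi.div_apply]
    field_simp

/-- The only place where the rate of convergence of the width enters: `c_n ~ 2 log n` against
`o(1/log n)`. -/
theorem tendsto_logConst_mul_width_sub {L : ℕ → ℝ} {ρ c₁ c₂ ξ : ℝ} (hρ : 0 < ρ)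
    (hL : Tendsto L atTop (𝓝 ρ)) (h : (fun n => L n - ρ) =o[atTop] fun n : ℕ => 1 / Real.log n) :
    Tendsto (fun n => logConst ρ c₁ c₂ ξ n * (ρ / L n - 1)) atTop (𝓝 0) := by
  have h1 := ((tendsto_logConst_div_log (c₁ := c₁) (c₂ := c₂) (ξ := ξ) hρ).mul
    h.tendsto_div_nhds_zero).neg.div hL hρ.ne'
  rw [mul_zero, neg_zero, zero_div] at h1
  refine h1.congr' ?_
  filter_upwards [tendsto_log_natCast.eventually_gt_atTop 0, hL.eventually_const_lt hρ]
    with n h2 h3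
  simp only [Pi.div_apply]
  field_simp
  ring

/-! ### Limit laws for the confined ensembles -/

section Gibbs

variable {g : ℕ → ℝ → ℝ} {ρ : ℝ} {r₀ r₁ : ℕ → ℝ} {c₁ c₂ : ℝ≥0∞}

theorem IsAlmostCircular.isLogWeight_soft (hg : IsAlmostCircular g ρ)
    (hr : ∀ᶠ n in atTop, IsDropletRadii (g n) (r₀ n) (r₁ n)) (hc₁ : 0 < c₁) (hc₂ : 0 < c₂)
    (hc₁' : c₁ ≠ ∞) (hc₂' : c₂ ≠ ∞) :
    ∀ᶠ n in atTop, IsLogWeight n (confinedPotential (g n) (r₀ n) (r₁ n) c₁ c₂) (widthAt g n)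
      (softWeight (logProfile (g n) (widthAt g n) n) (widthAt g n / 2)
        (2 * n / widthAt g n * Real.log (r₀ n)) (2 * n / widthAt g n * Real.log (r₁ n))
        c₁.toReal c₂.toReal) := by
  refine ((hg.isProfile hr).softWeight_weightLimit (ENNReal.toReal_pos hc₁.ne' hc₁')
    (ENNReal.toReal_pos hc₂.ne' hc₂')).isLogWeight hg.width_pos hg.width_tendsto
    (fun n => confinedPotential_zero_ne_bot _ _ _ _ _ _) ?_
  filter_upwards [hr, hg.width_tendsto.eventually_const_lt hg.width_pos, eventually_gt_atTop 0]
    with n h1 h2 h3 z hz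
  exact confinedPotential_soft_weight (g n) hc₁' hc₂' h1.inner_pos h1.outer_pos h2 h3 hz

theorem IsAlmostCircular.isLogWeight_hard (hg : IsAlmostCircular g ρ)
    (hr : ∀ᶠ n in atTop, IsDropletRadii (g n) (r₀ n) (r₁ n)) :
    ∀ᶠ n in atTop, IsLogWeight n (confinedPotential (g n) (r₀ n) (r₁ n) ∞ ∞) (widthAt g n)
      (hardWeight (logProfile (g n) (widthAt g n) n)
        (2 * n / widthAt g n * Real.log (r₀ n)) (2 * n / widthAt g n * Real.log (r₁ n))) := by
  refine (hg.isProfile hr).hardWeight_weightLimit.isLogWeight hg.width_pos hg.width_tendsto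
    (fun n => confinedPotential_zero_ne_bot _ _ _ _ _ _) ?_
  filter_upwards [hr, hg.width_tendsto.eventually_const_lt hg.width_pos, eventually_gt_atTop 0]
    with n h1 h2 h3 z hz
  exact confinedPotential_hard_weight (g n) h1.inner_pos h1.outer_pos h2 h3 hz

theorem IsAlmostCircular.tendsto_omegaSoft (hg : IsAlmostCircular g ρ)
    (hr : ∀ᶠ n in atTop, IsDropletRadii (g n) (r₀ n) (r₁ n)) (hc₁ : 0 < c₁) (hc₂ : 0 < c₂)
    (hc₁' : c₁ ≠ ∞) (hc₂' : c₂ ≠ ∞) {s : ℕ → ℝ} (hs : Tendsto s atTop (𝓝 ρ))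
    (hqs : Tendsto (fun n => logConst ρ c₁.toReal c₂.toReal (ρ / 2) n *
      (s n / widthAt g n - 1)) atTop (𝓝 0)) (x : ℝ) :
    Tendsto (fun n => gibbs n (confinedPotential (g n) (r₀ n) (r₁ n) c₁ c₂)
      {ζ | omegaSoft (s n) ρ c₁.toReal c₂.toReal (r₁ n) n ζ ≤ x}) atTop
      (𝓝 (ENNReal.ofReal (Real.exp (-Real.exp (-x))))) := by
  have h := hg.isProfile hr
  have hρ := hg.width_pos
  have k₁ := ENNReal.toReal_pos hc₁.ne' hc₁'
  have k₂ := ENNReal.toReal_pos hc₂.ne' hc₂'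
  have hΦ := h.Phi_pos k₁ k₂ (ρ / 2)
  obtain ⟨hpos, hU, hU3, hl⟩ := tendsto_gumbel_scale (x := x) hρ k₂ (Or.inl rfl) hg.width_tendsto hs
    (hr.mono fun n hn => hn.outer_pos) h.tendsto_outer (tendsto_logConst_div_log hρ)
    (exp_neg_half_logConst hρ hΦ) hqs (fun n => rfl) (fun n => rfl)
  have main := h.tendsto_prod_softWeight k₁ k₂ (θ := 0) (by simp) hU hU3 hl
  rw [mul_div_cancel_left₀ _ hΦ.ne'] at main
  refine (ENNReal.tendsto_ofReal main).congr' ?_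
  filter_upwards [hpos, hg.isLogWeight_soft hr hc₁ hc₂ hc₁' hc₂', hs.eventually_const_lt hρ,
    eventually_gt_atTop 0] with n h1 h2 h3 h4
  simp only [omegaSoft_le_iff h4 h3 k₂ h1.1]
  rw [h2.gibbs_norm_le h1.2]
  simp only [one_mul, ← mul_add, add_sub_cancel]

theorem IsAlmostCircular.tendsto_uSoft (hg : IsAlmostCircular g ρ)
    (hr : ∀ᶠ n in atTop, IsDropletRadii (g n) (r₀ n) (r₁ n)) (hc₁ : 0 < c₁) (hc₂ : 0 < c₂)
    (hc₁' : c₁ ≠ ∞) (hc₂' : c₂ ≠ ∞) {s : ℕ → ℝ} (hs : Tendsto s atTop (𝓝 ρ))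
    (hqs : Tendsto (fun n => logConst ρ c₁.toReal c₂.toReal (-(ρ / 2)) n *
      (s n / widthAt g n - 1)) atTop (𝓝 0)) (x : ℝ) :
    Tendsto (fun n => gibbs n (confinedPotential (g n) (r₀ n) (r₁ n) c₁ c₂)
      {ζ | uSoft (s n) ρ c₁.toReal c₂.toReal (r₀ n) n ζ ≤ x}) atTop
      (𝓝 (ENNReal.ofReal (Real.exp (-Real.exp (-x))))) := by
  have h := hg.isProfile hr
  have hρ := hg.width_pos
  have k₁ := ENNReal.toReal_pos hc₁.ne' hc₁'
  have k₂ := ENNReal.toReal_pos hc₂.ne' hc₂'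
  have hΦ := h.Phi_pos k₁ k₂ (-(ρ / 2))
  obtain ⟨hpos, hU, hU3, hl⟩ := tendsto_gumbel_scale (x := x) hρ k₁ (Or.inr rfl) hg.width_tendsto hs
    (hr.mono fun n hn => hn.inner_pos) h.tendsto_inner (tendsto_logConst_div_log hρ)
    (exp_neg_half_logConst hρ hΦ) hqs (fun n => rfl) (fun n => rfl)
  -- Reflection swaps the confinement parameters; `Phi_reflect` turns the resulting `Φ` at `ρ/2`
  -- into the one at `-ρ/2` that occurs in `c_n'`.
  have main := h.reflect.tendsto_prod_softWeight k₂ k₁ (θ := 1) (by simp) hU hU3 hl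
  rw [Phi_reflect ρ c₁.toReal c₂.toReal (ρ / 2), mul_div_cancel_left₀ _ hΦ.ne'] at main
  refine (ENNReal.tendsto_ofReal main).congr' ?_
  filter_upwards [hpos, hg.isLogWeight_soft hr hc₁ hc₂ hc₁' hc₂', hs.eventually_const_lt hρ,
    eventually_gt_atTop 0, h.inner_lt_outer] with n h1 h2 h3 h4 h5
  simp only [uSoft_le_iff h4 h3 k₁ h1.1]
  rw [h2.gibbs_le_norm h1.2]
  have e₁ : ∀ a b d : ℝ, -(a * d) + -1 * (a * (b - d)) = -(a * b) := fun a b d => by ring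
  have e₂ : softWeight (fun t => logProfile (g n) (widthAt g n) n (-t)) (widthAt g n / 2)
      (-(2 * n / widthAt g n * Real.log (r₁ n))) (-(2 * n / widthAt g n * Real.log (r₀ n)))
      c₂.toReal c₁.toReal = fun t => _ :=
    funext fun t => softWeight_neg (logProfile (g n) (widthAt g n) n) (widthAt g n / 2)
      c₁.toReal c₂.toReal t h5.le
  rw [e₁, e₂]

theorem IsAlmostCircular.tendsto_omegaHard (hg : IsAlmostCircular g ρ)
    (hr : ∀ᶠ n in atTop, IsDropletRadii (g n) (r₀ n) (r₁ n)) {x : ℝ} (hx : x ≤ 0) :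
    Tendsto (fun n => gibbs n (confinedPotential (g n) (r₀ n) (r₁ n) ∞ ∞)
      {ζ | omegaHard ρ (r₁ n) n ζ ≤ x}) atTop (𝓝 (ENNReal.ofReal (Real.exp x))) := by
  have h := hg.isProfile hr
  have hρ := hg.width_pos
  have hc := softHardOnePoint_edge_pos hρ
  obtain ⟨hpos, hU, hl⟩ := tendsto_exponential_scale hρ (mul_pos two_pos hc) hx (Or.inl rfl)
    hg.width_tendsto (hr.mono fun n hn => hn.outer_pos) h.tendsto_outer (fun n => rfl)
    (fun n => rfl)
  have main := h.tendsto_prod_hardWeight (θ := 0) (by simp) hU hl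
  -- The normalisation `c = 2 R^{(∞)}(ρ/4)` is exactly what makes the exponent equal to `x`.
  have e : -(-(2 * ρ * x / (2 * softHardOnePoint ρ ((ρ / 4 : ℝ) : ℂ))) / ρ *
      softHardOnePoint ρ ((ρ / 4 : ℝ) : ℂ)) = x := by field_simp
  rw [e] at main
  refine (ENNReal.tendsto_ofReal main).congr' ?_
  filter_upwards [hpos, hg.isLogWeight_hard hr, eventually_gt_atTop 0] with n h1 h2 h4
  simp only [omegaHard_le_iff h4 hρ]
  rw [h2.gibbs_norm_le h1]
  simp only [one_mul, mul_sub, sub_neg_eq_add, add_sub_cancel]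

theorem IsAlmostCircular.tendsto_uHard (hg : IsAlmostCircular g ρ)
    (hr : ∀ᶠ n in atTop, IsDropletRadii (g n) (r₀ n) (r₁ n)) {x : ℝ} (hx : x ≤ 0) :
    Tendsto (fun n => gibbs n (confinedPotential (g n) (r₀ n) (r₁ n) ∞ ∞)
      {ζ | uHard ρ (r₀ n) n ζ ≤ x}) atTop (𝓝 (ENNReal.ofReal (Real.exp x))) := by
  have h := hg.isProfile hr
  have hρ := hg.width_pos
  have hc := softHardOnePoint_edge_pos hρ
  obtain ⟨hpos, hU, hl⟩ := tendsto_exponential_scale hρ (mul_pos two_pos hc) hx (Or.inr rfl)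
    hg.width_tendsto (hr.mono fun n hn => hn.inner_pos) h.tendsto_inner (fun n => rfl)
    (fun n => rfl)
  have main := h.reflect.tendsto_prod_hardWeight (θ := 1) (by simp) hU hl
  have e : -(-(2 * ρ * x / (2 * softHardOnePoint ρ ((ρ / 4 : ℝ) : ℂ))) / ρ *
      softHardOnePoint ρ ((ρ / 4 : ℝ) : ℂ)) = x := by field_simp
  rw [e] at main
  refine (ENNReal.tendsto_ofReal main).congr' ?_
  filter_upwards [hpos, hg.isLogWeight_hard hr, eventually_gt_atTop 0] with n h1 h2 h4
  simp only [uHard_le_iff h4 hρ]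
  rw [h2.gibbs_le_norm h1]
  have e₁ : ∀ a b d : ℝ, -(a * d) - -(-1 * (a * (b - d))) = -(a * b) := fun a b d => by ring
  have e₂ : hardWeight (fun t => logProfile (g n) (widthAt g n) n (-t))
      (-(2 * n / widthAt g n * Real.log (r₁ n))) (-(2 * n / widthAt g n * Real.log (r₀ n))) =
      fun t => _ :=
    funext fun t => hardWeight_neg (logProfile (g n) (widthAt g n) n)
      (2 * n / widthAt g n * Real.log (r₀ n)) (2 * n / widthAt g n * Real.log (r₁ n)) t
  rw [e₁, e₂]

end Gibbs

end AlmostCircular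

theorem theorem2p4 (g : ℕ → ℝ → ℝ) (ρ : ℝ) (hg : AlmostCircular.IsAlmostCircular g ρ)
    (r₀ r₁ : ℕ → ℝ)
    (hr : ∀ᶠ n in atTop, AlmostCircular.IsDropletRadii (g n) (r₀ n) (r₁ n))
    (c₁ c₂ : ℝ≥0∞) (hc₁ : 0 < c₁) (hc₂ : 0 < c₂)
    (P : (n : ℕ) → Measure (Fin n → ℂ))
    (hP : ∀ n, P n = AlmostCircular.gibbs n
      (AlmostCircular.confinedPotential (g n) (r₀ n) (r₁ n) c₁ c₂)) :
    -- finite confinement parameters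
    (c₁ < ∞ → c₂ < ∞ →
      -- scaling constants built with the limiting width `ρ`
      (((fun n => AlmostCircular.widthAt g n - ρ) =o[atTop] fun n : ℕ => 1 / Real.log n) →
        ∀ x : ℝ,
          Tendsto (fun n => P n {ζ | AlmostCircular.omegaSoft ρ ρ c₁.toReal c₂.toReal
              (r₁ n) n ζ ≤ x})
            atTop (𝓝 (ENNReal.ofReal (Real.exp (-Real.exp (-x))))) ∧
          Tendsto (fun n => P n {ζ | AlmostCircular.uSoft ρ ρ c₁.toReal c₂.toReal
              (r₀ n) n ζ ≤ x})
            atTop (𝓝 (ENNReal.ofReal (Real.exp (-Real.exp (-x)))))) ∧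
      -- prefactors built with the width `ρ_n = √(n / ΔQ_n(1))` at finite size
      (∀ x : ℝ,
          Tendsto (fun n => P n {ζ | AlmostCircular.omegaSoft (AlmostCircular.widthAt g n) ρ
              c₁.toReal c₂.toReal (r₁ n) n ζ ≤ x})
            atTop (𝓝 (ENNReal.ofReal (Real.exp (-Real.exp (-x))))) ∧
          Tendsto (fun n => P n {ζ | AlmostCircular.uSoft (AlmostCircular.widthAt g n) ρ
              c₁.toReal c₂.toReal (r₀ n) n ζ ≤ x})
            atTop (𝓝 (ENNReal.ofReal (Real.exp (-Real.exp (-x))))))) ∧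
    -- soft/hard edge
    (c₁ = ∞ → c₂ = ∞ → ∀ x : ℝ, x ≤ 0 →
      Tendsto (fun n => P n {ζ | AlmostCircular.omegaHard ρ (r₁ n) n ζ ≤ x})
        atTop (𝓝 (ENNReal.ofReal (Real.exp x))) ∧
      Tendsto (fun n => P n {ζ | AlmostCircular.uHard ρ (r₀ n) n ζ ≤ x})
        atTop (𝓝 (ENNReal.ofReal (Real.exp x)))) := by
  obtain rfl : P = fun n => AlmostCircular.gibbs n
      (AlmostCircular.confinedPotential (g n) (r₀ n) (r₁ n) c₁ c₂) := funext hP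
  refine ⟨fun h₁ h₂ => ⟨fun hwidth x => ?_, fun x => ?_⟩, fun h₁ h₂ x hx => ?_⟩
  · have hqs := fun ξ => AlmostCircular.tendsto_logConst_mul_width_sub hg.width_pos
      hg.width_tendsto hwidth (c₁ := c₁.toReal) (c₂ := c₂.toReal) (ξ := ξ)
    exact ⟨hg.tendsto_omegaSoft hr hc₁ hc₂ h₁.ne h₂.ne tendsto_const_nhds (hqs _) x,
      hg.tendsto_uSoft hr hc₁ hc₂ h₁.ne h₂.ne tendsto_const_nhds (hqs _) x⟩
  -- With `ρ_n` in the prefactors the width ratio is identically one for large `n`, so no rate is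
  -- needed.
  · have hqs : ∀ ξ, Tendsto (fun n => AlmostCircular.logConst ρ c₁.toReal c₂.toReal ξ n *
        (AlmostCircular.widthAt g n / AlmostCircular.widthAt g n - 1)) atTop (𝓝 0) := fun ξ => by
      refine tendsto_const_nhds.congr' ?_
      filter_upwards [hg.width_tendsto.eventually_const_lt hg.width_pos] with n hn
      rw [div_self hn.ne', sub_self, mul_zero]
    exact ⟨hg.tendsto_omegaSoft hr hc₁ hc₂ h₁.ne h₂.ne hg.width_tendsto (hqs _) x,
      hg.tendsto_uSoft hr hc₁ hc₂ h₁.ne h₂.ne hg.width_tendsto (hqs _) x⟩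
  · subst h₁ h₂
    exact ⟨hg.tendsto_omegaHard hr hx, hg.tendsto_uHard hr hx⟩
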